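/- Let $n\ge 1$ and let $V:\mathbb R\to\mathbb R$ be continuous. Let $A_n$ be a random $n\times n$ Hermitian matrix whose distribution is invariant under conjugation by unitary matrices and whose eigenvalues, in decreasing order, have distribution $$d\mu_n[y]=\frac1{Z_n}\,\Delta_n(y)^2\prod_{i=1}^n e^{-V(y_i)}\,dy\quad\text{on }\{y\in\mathbb R^n: y_1\ge\cdots\ge y_n\},\qquad \Delta_n(y)=\prod_{i<j}(y_i-y_j),$$ with a normalisation constant $Z_n>0$ (a unitary invariant ensemble with potential $V$). For $1\le r\le n$ let $\lambda^{(r)}=(\lambda^{(r)}_1\ge\cdots\ge\lambda^{(r)}_r)$ be the eigenvalues of the upper left $r\times r$ submatrix of $A_n$. Let $\nu_n$ be the distribution of the eigenvalue minor process $(\lambda^{(1)},\ldots,\lambda^{(n)})$, regarded as a random point field of $\frac12 n(n+1)$ particles $(r,\lambda^{(r)}_k)$ on $\{1,\ldots,n\}\times\mathbb R$, with reference measure the product of counting measure and Lebesgue measure. For each $j\ge 0$ let $\psi_j$ be a monic polynomial of degree $j$ and $c_j\in\mathbb R$, such that for all $i,j\ge0$ the function $\psi_i\psi_je^{-V}$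 is integrable and $$\int_{-\infty}^\infty \psi_i(x)\psi_j(x)e^{-V(x)}\,dx=c_ic_j\delta_{ij}.$$ Then $$d\nu_n[y^{(1)},\ldots,y^{(n)}]=\frac1{Z_n'}\,\Delta_n(y^{(n)})\prod_{i=1}^n e^{-V(y^{(n)}_i)}\;dy^{(n)}\cdots dy^{(1)}$$ on the set of Gelfand–Tsetlin patterns (each $y^{(r)}\in\mathbb R^r$ is decreasing, and $y^{(r+1)}_1\ge y^{(r)}_1\ge y^{(r+1)}_2\ge\cdots\ge y^{(r)}_r\ge y^{(r+1)}_{r+1}$ for $1\le r<n$), with a normalisation constant $Z_n'>0$, and the random point field is determinantal: there is a function $K_n:(\{1,\ldots,n\}\times\mathbb R)^2\to\mathbb C$ such that, for every $m\le\frac12 n(n+1)$, the $m$-th correlation function exists and is $\det[K_n(z_i,z_j)]_{i,j=1}^m$, and $$\begin{aligned}K_n((r,u),(s,v))={}&1_{v\le u}\sum_{j=n-s}^{n-1}c_j^{-2}\,\psi_j^{(n-s)}(v)\int_u^\infty\frac{(x-u)^{n-r-1}}{(n-r-1)!}\,\psi_j(x)e^{-V(x)}\,dx\\&-1_{v>u}\sum_{j=n-s}^{n-1}c_j^{-2}\,\psi_j^{(n-s)}(v)\int_{-\infty}^u\frac{(x-u)^{n-r-1}}{(n-r-1)!}\,\psi_j(x)e^{-V(x)}\,dx\end{aligned}$$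 for all $r\in\{1,\ldots,n-1\}$, $s\in\{1,\ldots,n\}$ and $u,v\in\mathbb R$, where $\psi_j^{(i)}$ is the $i$-th derivative of $\psi_j$. -/

import Mathlib

open MeasureTheory Polynomial
open scoped ENNReal

noncomputable section

namespace UIE

/-! ## Random point fields with finitely many particles -/

/-- `𝕄_m[B]`: the expected number of `m`-tuples of distinct particles that lie in `B`, for a
configuration `X ω` of particles of `E` labelled by the finite type `ι`. -/
def factorialMoment {Ω E ι : Type*} [MeasurableSpace Ω] [Fintype ι] [DecidableEq ι]
    (P : Measure Ω) (X : Ω → ι → E) (m : ℕ) (B : Set (Fin m → E)) : ℝ≥0∞ :=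
  ∫⁻ ω, ∑ f : Fin m ↪ ι, B.indicator (fun _ => 1) (fun k => X ω (f k)) ∂P

/-- `ρ` is the `m`-th correlation function with respect to the reference measure `μ` on `E`:
it is integrable, and `𝕄_m[B] = ∫_B ρ dμ^m` for all measurable `B`. -/
def IsCorrelationFunction {Ω E ι : Type*} [MeasurableSpace Ω] [MeasurableSpace E]
    [Fintype ι] [DecidableEq ι] (P : Measure Ω) (X : Ω → ι → E) (μ : Measure E)
    (m : ℕ) (ρ : (Fin m → E) → ℝ) : Prop :=
  Integrable ρ (Measure.pi fun _ : Fin m => μ) ∧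
    ∀ B : Set (Fin m → E), MeasurableSet B →
      factorialMoment P X m B ≠ ∞ ∧
      (factorialMoment P X m B).toReal = ∫ y in B, ρ y ∂(Measure.pi fun _ : Fin m => μ)

/-- The random point field is determinantal with correlation kernel `K`. -/
def IsDeterminantal {Ω E ι : Type*} [MeasurableSpace Ω] [MeasurableSpace E]
    [Fintype ι] [DecidableEq ι] (P : Measure Ω) (X : Ω → ι → E) (μ : Measure E)
    (K : E → E → ℂ) : Prop :=
  ∀ m : ℕ, m ≤ Fintype.card ι →
    ∃ ρ : (Fin m → E) → ℝ, IsCorrelationFunction P X μ m ρ ∧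
      ∀ y : Fin m → E, (ρ y : ℂ) = (Matrix.of fun i j => K (y i) (y j)).det

/-! ## Gelfand-Tsetlin patterns

Levels are indexed by `Fin n`: the index `i` stands for level `i + 1`, which has `i + 1` particles.
-/

/-- `ℝ¹ × ℝ² × ⋯ × ℝⁿ`. -/
abbrev Pattern (n : ℕ) : Type := (i : Fin n) → Fin ((i : ℕ) + 1) → ℝ

/-- Symmetric interlacing `z₁ ≥ y₁ ≥ z₂ ≥ y₂ ≥ ⋯ ≥ y_r ≥ z_{r+1}`. -/
def Interlaced {r : ℕ} (y : Fin r → ℝ) (z : Fin (r + 1) → ℝ) : Prop :=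
  ∀ k : Fin r, y k ≤ z k.castSucc ∧ z k.succ ≤ y k

/-- The set of Gelfand-Tsetlin patterns of depth `n`. -/
def gtPatterns (n : ℕ) : Set (Pattern n) :=
  {y | (∀ i, Antitone (y i)) ∧
    ∀ (i : ℕ) (h : i + 1 < n), Interlaced (y ⟨i, Nat.lt_of_succ_lt h⟩) (y ⟨i + 1, h⟩)}

/-- A pattern as a configuration of `n(n+1)/2` particles on `{1, …, n} × ℝ`. -/
def particles {n : ℕ} (y : Pattern n) : (Σ i : Fin n, Fin ((i : ℕ) + 1)) → Fin n × ℝ :=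
  fun p => (p.1, y p.1 p.2)

/-- Counting measure times Lebesgue measure. -/
def refMeasure (n : ℕ) : Measure (Fin n × ℝ) := Measure.count.prod volume

/-! ## Unitary invariant ensembles -/

/-- The Vandermonde product `∏_{i<j} (y_i - y_j)`. -/
def vandermonde {r : ℕ} (y : Fin r → ℝ) : ℝ :=
  ∏ i : Fin r, ∏ j ∈ Finset.Ioi i, (y i - y j)

/-- The density `Δ_r(y)² ∏ e^{-V(y_i)}` with respect to Lebesgue measure on
`{y ∈ ℝ^r : y₁ ≥ ⋯ ≥ y_r}`, not normalised. -/
def eigenvalueMeasure (V : ℝ → ℝ) (r : ℕ) : Measure (Fin r → ℝ) :=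
  ((volume : Measure (Fin r → ℝ)).restrict {y | Antitone y}).withDensity
    fun y => ENNReal.ofReal (vandermonde y ^ 2 * ∏ i, Real.exp (-V (y i)))

/-- The density `Δ_n(y⁽ⁿ⁾) ∏ e^{-V(y⁽ⁿ⁾_i)}` with respect to `dy⁽ⁿ⁾ ⋯ dy⁽¹⁾` on the set of
Gelfand-Tsetlin patterns, not normalised; `y ⟨n - 1, _⟩` is the top level `y⁽ⁿ⁾`. -/
def patternMeasure (V : ℝ → ℝ) (n : ℕ) (hn : 0 < n) : Measure (Pattern n) :=
  ((volume : Measure (Pattern n)).restrict (gtPatterns n)).withDensity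
    fun y => ENNReal.ofReal (vandermonde (y ⟨n - 1, Nat.sub_one_lt_of_lt hn⟩) *
      ∏ i, Real.exp (-V (y ⟨n - 1, Nat.sub_one_lt_of_lt hn⟩ i)))

/-- The Borel σ-algebra on matrices (the product of those of the entries). -/
instance matrixMeasurableSpace {m n : Type*} : MeasurableSpace (Matrix m n ℂ) :=
  MeasurableSpace.pi

/-- The eigenvalues of a Hermitian matrix with multiplicity, in decreasing order. -/
def sortedEigenvalues {r : ℕ} {H : Matrix (Fin r) (Fin r) ℂ} (hH : H.IsHermitian) : Fin r → ℝ :=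
  fun k => hH.eigenvalues₀ (Fin.cast (Fintype.card_fin r).symm k)

/-- The pattern formed by the eigenvalues of the upper left `r × r` submatrices, `r = 1, …, n`. -/
def minorEigenvalues {n : ℕ} {H : Matrix (Fin n) (Fin n) ℂ} (hH : H.IsHermitian) : Pattern n :=
  fun i => sortedEigenvalues (hH.submatrix (Fin.castLE i.isLt))

/-- `A` is a unitary invariant ensemble with potential `V`: a random Hermitian matrix, with
unitarily invariant distribution, whose ordered eigenvalues have distribution
`Z⁻¹ Δ_n(y)² ∏ e^{-V(y_i)} dy`. -/
structure IsUnitaryInvariantEnsemble {Ω : Type*} [MeasurableSpace Ω] (P : Measure Ω)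
    (V : ℝ → ℝ) {n : ℕ} (A : Ω → Matrix (Fin n) (Fin n) ℂ) : Prop where
  measurable : Measurable A
  hermitian : ∀ ω, (A ω).IsHermitian
  invariant : ∀ U ∈ Matrix.unitaryGroup (Fin n) ℂ,
    P.map (fun ω => U * A ω * U.conjTranspose) = P.map A
  eigenvalue_law : ∃ Z : ℝ, 0 < Z ∧
    P.map (fun ω => sortedEigenvalues (hermitian ω)) =
      ENNReal.ofReal Z⁻¹ • eigenvalueMeasure V n

/-- The monic polynomials `ψ_j` of degree `j` are orthogonal for the weight `e^{-V}`, and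
`∫ ψ_i ψ_j e^{-V} = c_i c_j δ_{ij}`. -/
structure IsMonicOrthogonal (V : ℝ → ℝ) (ψ : ℕ → ℝ[X]) (c : ℕ → ℝ) : Prop where
  monic : ∀ j, (ψ j).Monic
  natDegree : ∀ j, (ψ j).natDegree = j
  integrable : ∀ i j, Integrable fun x => (ψ i).eval x * (ψ j).eval x * Real.exp (-V x)
  orthogonal : ∀ i j,
    ∫ x, (ψ i).eval x * (ψ j).eval x * Real.exp (-V x) = if i = j then c i * c j else 0

/-- The kernel at levels `1 ≤ r ≤ n - 1` and `1 ≤ s ≤ n`. -/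
def kernel (V : ℝ → ℝ) (ψ : ℕ → ℝ[X]) (c : ℕ → ℝ) (n r s : ℕ) (u v : ℝ) : ℝ :=
  (if v ≤ u then
    ∑ j ∈ Finset.Ico (n - s) n, (c j ^ 2)⁻¹ * (derivative^[n - s] (ψ j)).eval v *
      ∫ x in Set.Ioi u,
        (x - u) ^ (n - r - 1) / ((n - r - 1).factorial : ℝ) * (ψ j).eval x * Real.exp (-V x)
  else 0) -
  (if u < v then
    ∑ j ∈ Finset.Ico (n - s) n, (c j ^ 2)⁻¹ * (derivative^[n - s] (ψ j)).eval v *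
      ∫ x in Set.Iic u,
        (x - u) ^ (n - r - 1) / ((n - r - 1).factorial : ℝ) * (ψ j).eval x * Real.exp (-V x)
  else 0)

end UIE

end

/-! The law. A unitarily invariant finite measure on Hermitian matrices is determined by the law of
the eigenvalues: average over Haar measure of the unitary group. Hence the matrix has a density
proportional to `∏ e^{-V(λ_i)}` with respect to additive Haar measure on Hermitian matrices. Under
that measure a matrix of size `n + 1` is a corner `H` bordered by a column `w` and a real entry `a`,
with `(H, w, a)` distributed as a product of Haar measures. In an eigenbasis of `H`, with
eigenvalues `y`, the characteristic polynomial is `(X - a) ∏ (X - y_k) - ∑ |w_k|² ∏_{j ≠ k} (X -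
y_j)`. So the new eigenvalues `z` depend only on `a` and the `|w_k|²`, which are Lebesgue
distributed on `ℝ × (0, ∞)^n` up to a constant, and these coordinates correspond bijectively to the
strictly interlacing `z`, with Jacobian `Δ(z) / Δ(y)` (`lintegral_eig_block`). In the product of
these conditional densities over all sizes the Vandermonde factors telescope, and only the top one
remains (`lintegral_minors`).

The kernel. With depth `a = n - r`, the kernel is the `a`-fold tail integral of `κ e^{-V}` minus a
transition kernel, where `κ` reproduces a derivative at `v` on polynomials of degree less than `n`.
Its determinant at a full configuration is a Schur complement of a larger matrix that a permutation
of rows makes block triangular. The blocks are comparison matrices of consecutive levels, whose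
determinants detect interlacing, and a Vandermonde block for the top level. So the determinant is
proportional to the density (`exists_det_corrMatrix_eq`).

Fewer particles are reached by integrating out one particle at a time. The convolution identity
`integral_minorKernel_mul` shows that integrating out a particle of a level multiplies the
determinant by the level's size minus the number of remaining points there; factorial moments obey
the same rule (`levelMoment_cons`). The empty tuple fixes the constant.

The two-case formula for the kernel holds because tail and head integrals of `κ e^{-V}` differ by a
moment of `κ` against a power, and the reproducing property turns this moment into the transition
kernel (`minorKernel_eq_ite`). -/

noncomputable section

namespace UIE

section

/-! ## Bordered determinants -/

section Bordered

variable {ι R : Type*} [Fintype ι] [DecidableEq ι] [CommRing R]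

open Matrix in
/-- A matrix `A` bordered by a column `b`, a row `c` and a corner entry `d`. -/
def bordered (A : Matrix ι ι R) (b c : ι → R) (d : R) : Matrix (ι ⊕ Unit) (ι ⊕ Unit) R :=
  fromBlocks A (replicateCol Unit b) (replicateRow Unit c) (of fun _ _ => d)

-- Column operations clear the border. Using the adjugate instead of the inverse keeps this valid
-- for singular `A`, at the price of a factor `A.det` on both sides.
open Matrix in
theorem det_mul_det_bordered (A : Matrix ι ι R) (b c : ι → R) (d : R) :
    (bordered A b c d).det * A.det = (d * A.det - c ⬝ᵥ A.adjugate *ᵥ b) * A.det := by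
  have h : bordered A b c d *
      fromBlocks 1 (replicateCol Unit (-(A.adjugate *ᵥ b))) 0 (of fun _ _ => A.det) =
      fromBlocks A 0 (replicateRow Unit c)
        (of fun _ _ => d * A.det - c ⬝ᵥ A.adjugate *ᵥ b) := by
    rw [bordered, fromBlocks_multiply]
    congr 1
    · simp
    · ext i j
      have : A *ᵥ (A.adjugate *ᵥ b) = A.det • b := by
        rw [mulVec_mulVec, mul_adjugate, smul_mulVec, one_mulVec]
      have h2 := congrFun this i
      simp only [mulVec, dotProduct, Pi.smul_apply, smul_eq_mul] at h2
      simp [Matrix.mul_apply, mulVec, dotProduct, h2]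
      ring
    · simp
    · ext i j
      simp [Matrix.mul_apply, dotProduct]
      ring
  have h2 := congrArg Matrix.det h
  rw [Matrix.det_mul, det_fromBlocks_zero₂₁, det_fromBlocks_zero₁₂] at h2
  simp only [det_one, one_mul, det_unique, of_apply] at h2
  rw [h2]; ring

-- The factor `A.det` can be cancelled generically: `charmatrix (-A)` is `X + A`, its determinant is
-- monic and hence regular, and `X = 0` gives back `A`.
open Matrix in
theorem det_bordered (A : Matrix ι ι R) (b c : ι → R) (d : R) :
    (bordered A b c d).det = d * A.det - c ⬝ᵥ A.adjugate *ᵥ b := by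
  have h := det_mul_det_bordered (charmatrix (-A)) (fun i => C (b i)) (fun i => C (c i)) (C d)
  have h2 := (charpoly_monic (-A)).isRegular.right h
  have h3 := congrArg (Polynomial.evalRingHom (0 : R)) h2
  have hA : (Polynomial.evalRingHom (0 : R)).mapMatrix (charmatrix (-A)) = A := by
    ext i j
    by_cases hij : i = j <;> simp [hij]
  have hB : (Polynomial.evalRingHom (0 : R)).mapMatrix
      (bordered (charmatrix (-A)) (fun i => C (b i)) (fun i => C (c i)) (C d)) =
        bordered A b c d := by
    ext i j
    rcases i with i | i <;> rcases j with j | j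
    · have := congrFun (congrFun hA i) j
      simpa [bordered] using this
    all_goals simp [bordered]
  rw [RingHom.map_det, hB] at h3
  rw [h3, map_sub, map_mul, RingHom.map_det, hA, dotProduct, map_sum]
  simp only [mulVec, dotProduct, map_mul, map_sum]
  rw [← hA, ← RingHom.map_adjugate, hA]
  simp

end Bordered

end

section

/-! ## Eigenvalues of Hermitian matrices in decreasing order -/

section Eigenvalues

open Matrix

theorem sortedEigenvalues_antitone {r : ℕ} {H : Matrix (Fin r) (Fin r) ℂ} (hH : H.IsHermitian) :
    Antitone (sortedEigenvalues hH) := fun i j hij =>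
  hH.eigenvalues₀_antitone (by simpa using hij)

theorem exists_perm_sortedEigenvalues {r : ℕ} {H : Matrix (Fin r) (Fin r) ℂ}
    (hH : H.IsHermitian) :
    ∃ e : Equiv.Perm (Fin r), ∀ k, sortedEigenvalues hH k = hH.eigenvalues (e k) := by
  refine ⟨(finCongr (Fintype.card_fin r).symm).trans
    (Fintype.equivOfCardEq (Fintype.card_fin _)), fun k => ?_⟩
  simp only [sortedEigenvalues, IsHermitian.eigenvalues, Equiv.trans_apply, Equiv.symm_apply_apply]
  rfl

theorem charpoly_eq_prod_sortedEigenvalues {r : ℕ} {H : Matrix (Fin r) (Fin r) ℂ}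
    (hH : H.IsHermitian) :
    H.charpoly = ∏ k, (X - C (sortedEigenvalues hH k : ℂ)) := by
  obtain ⟨e, he⟩ := exists_perm_sortedEigenvalues hH
  rw [hH.charpoly_eq]
  simp only [he]
  exact (Equiv.prod_comp e (fun i => (X - C (hH.eigenvalues i : ℂ)))).symm

theorem eq_of_antitone_of_multiset_eq {r : ℕ} {y z : Fin r → ℝ} (hy : Antitone y)
    (hz : Antitone z) (h : Finset.univ.val.map y = Finset.univ.val.map z) : y = z := by
  have h1 : (List.ofFn y).Perm (List.ofFn z) := by
    rw [← Multiset.coe_eq_coe]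
    simpa [Fin.univ_val_map] using h
  have h2 : List.ofFn y = List.ofFn z :=
    h1.eq_of_pairwise' (r := (· ≥ ·)) (by simpa [List.pairwise_ofFn] using fun i j hij => hy hij.le)
      (by simpa [List.pairwise_ofFn] using fun i j hij => hz hij.le)
  exact List.ofFn_injective h2

theorem eq_of_antitone_of_prod_eq {r : ℕ} {y z : Fin r → ℝ} (hy : Antitone y) (hz : Antitone z)
    (h : ∏ k, (X - C (y k : ℂ)) = ∏ k, (X - C (z k : ℂ))) : y = z := by
  have h1 := congrArg Polynomial.roots h
  rw [Polynomial.roots_prod _ _ (by simp [Finset.prod_ne_zero_iff, Polynomial.X_sub_C_ne_zero]),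
    Polynomial.roots_prod _ _ (by simp [Finset.prod_ne_zero_iff, Polynomial.X_sub_C_ne_zero])] at h1
  simp only [roots_X_sub_C, Multiset.bind_singleton] at h1
  apply eq_of_antitone_of_multiset_eq hy hz
  have h2 := congrArg (Multiset.map Complex.re) h1
  simpa only [Multiset.map_map, Function.comp_def, Complex.ofReal_re] using h2

theorem sortedEigenvalues_eq_iff_charpoly {r : ℕ} {H : Matrix (Fin r) (Fin r) ℂ}
    (hH : H.IsHermitian) {z : Fin r → ℝ} (hz : Antitone z)
    (h : H.charpoly = ∏ k, (X - C (z k : ℂ))) : sortedEigenvalues hH = z :=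
  eq_of_antitone_of_prod_eq (sortedEigenvalues_antitone hH) hz
    ((charpoly_eq_prod_sortedEigenvalues hH).symm.trans h)

theorem sortedEigenvalues_congr_of_charpoly {r : ℕ} {H H' : Matrix (Fin r) (Fin r) ℂ}
    (hH : H.IsHermitian) (hH' : H'.IsHermitian) (h : H.charpoly = H'.charpoly) :
    sortedEigenvalues hH = sortedEigenvalues hH' :=
  sortedEigenvalues_eq_iff_charpoly hH (sortedEigenvalues_antitone hH')
    (h.trans (charpoly_eq_prod_sortedEigenvalues hH'))

theorem charpoly_unitary_conj {r : ℕ} {U : Matrix (Fin r) (Fin r) ℂ}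
    (hU : U ∈ unitaryGroup (Fin r) ℂ) (H : Matrix (Fin r) (Fin r) ℂ) :
    (U * H * Uᴴ).charpoly = H.charpoly := by
  rw [charpoly_mul_comm, ← mul_assoc]
  have : Uᴴ * U = 1 := (mem_unitaryGroup_iff'.1 hU)
  rw [this, one_mul]

theorem exists_unitary_diagonal {r : ℕ} {H : Matrix (Fin r) (Fin r) ℂ} (hH : H.IsHermitian) :
    ∃ U ∈ unitaryGroup (Fin r) ℂ,
      H = U * diagonal (fun k => (sortedEigenvalues hH k : ℂ)) * Uᴴ := by
  obtain ⟨e, he⟩ := exists_perm_sortedEigenvalues hH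
  have h := hH.spectral_theorem
  rw [Unitary.conjStarAlgAut_apply] at h
  set W : Matrix (Fin r) (Fin r) ℂ := hH.eigenvectorUnitary.1 with hW
  have hWu : W ∈ unitaryGroup (Fin r) ℂ := hH.eigenvectorUnitary.2
  refine ⟨W.submatrix id e, ?_, ?_⟩
  · rw [mem_unitaryGroup_iff, star_eq_conjTranspose, conjTranspose_submatrix,
      submatrix_mul_equiv]
    simpa [star_eq_conjTranspose] using mem_unitaryGroup_iff.1 hWu
  · have h3 : diagonal (fun k => (sortedEigenvalues hH k : ℂ)) =
        (diagonal (RCLike.ofReal ∘ hH.eigenvalues) : Matrix (Fin r) (Fin r) ℂ).submatrix e e := by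
      rw [submatrix_diagonal_equiv]
      congr 1
      funext k
      simp [he]
    rw [h3, conjTranspose_submatrix, submatrix_mul_equiv, submatrix_mul_equiv]
    simpa [star_eq_conjTranspose] using h

/-- The quadratic form of a Hermitian matrix. -/
def quadForm {r : ℕ} (H : Matrix (Fin r) (Fin r) ℂ) (x : Fin r → ℂ) : ℝ :=
  (star x ⬝ᵥ H *ᵥ x).re

theorem quadForm_conj_diagonal {r : ℕ} (U : Matrix (Fin r) (Fin r) ℂ) (y : Fin r → ℝ)
    (x : Fin r → ℂ) :
    quadForm (U * diagonal (fun k => (y k : ℂ)) * Uᴴ) x =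
      ∑ k, y k * Complex.normSq ((Uᴴ *ᵥ x) k) := by
  have h : star x ᵥ* U = star (Uᴴ *ᵥ x) := by
    rw [star_mulVec, conjTranspose_conjTranspose]
  rw [quadForm, ← mulVec_mulVec, ← mulVec_mulVec, dotProduct_mulVec, h, dotProduct,
    Complex.re_sum]
  refine Finset.sum_congr rfl fun k _ => ?_
  rw [mulVec_diagonal]
  simp [Complex.normSq_apply]
  ring

theorem quadForm_one {r : ℕ} (x : Fin r → ℂ) :
    quadForm 1 x = ∑ k, Complex.normSq (x k) := by
  have h := quadForm_conj_diagonal 1 (fun _ => (1 : ℝ)) x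
  simpa using h

theorem quadForm_one_unitary {r : ℕ} {U : Matrix (Fin r) (Fin r) ℂ}
    (hU : U ∈ unitaryGroup (Fin r) ℂ) (x : Fin r → ℂ) :
    ∑ k, Complex.normSq ((Uᴴ *ᵥ x) k) = ∑ k, Complex.normSq (x k) := by
  have h := quadForm_conj_diagonal U (fun _ => (1 : ℝ)) x
  have hU' : U * Uᴴ = 1 := mem_unitaryGroup_iff.1 hU
  simp only [Complex.ofReal_one, diagonal_one, mul_one, hU', one_mul] at h
  rw [← h, quadForm_one]

/-- A dimension count that compares an eigenvalue of `A` with an eigenvalue of `B`. -/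
theorem exists_quadForm_between {m p q : ℕ} {A : Matrix (Fin p) (Fin p) ℂ}
    {B : Matrix (Fin q) (Fin q) ℂ} (hA : A.IsHermitian) (hB : B.IsHermitian)
    (f : (Fin m → ℂ) →ₗ[ℂ] (Fin p → ℂ)) (g : (Fin m → ℂ) →ₗ[ℂ] (Fin q → ℂ))
    (i : Fin p) (j : Fin q) (h : p - (i + 1) + j < m) :
    ∃ x, x ≠ 0 ∧ sortedEigenvalues hA i * quadForm 1 (f x) ≤ quadForm A (f x) ∧
      quadForm B (g x) ≤ sortedEigenvalues hB j * quadForm 1 (g x) := by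
  obtain ⟨U, hU, hAU⟩ := exists_unitary_diagonal hA
  obtain ⟨W, hW, hBW⟩ := exists_unitary_diagonal hB
  -- `T x = 0` puts `f x` in the span of the eigenvectors of `A` of index at most `i`, and `g x` in
  -- the span of those of `B` of index at least `j`. These are `p - (i + 1) + j < m` linear
  -- conditions.
  let T : (Fin m → ℂ) →ₗ[ℂ] ({k : Fin p // i < k} → ℂ) × ({k : Fin q // k < j} → ℂ) :=
    ((LinearMap.funLeft ℂ ℂ Subtype.val).comp ((Uᴴ).mulVecLin.comp f)).prod
      ((LinearMap.funLeft ℂ ℂ Subtype.val).comp ((Wᴴ).mulVecLin.comp g))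
  have hT : LinearMap.ker T ≠ ⊥ := by
    apply LinearMap.ker_ne_bot_of_finrank_lt
    rw [Module.finrank_prod, Module.finrank_fintype_fun_eq_card,
      Module.finrank_fintype_fun_eq_card, Module.finrank_fintype_fun_eq_card, Fintype.card_fin]
    have h1 : Fintype.card {k : Fin p // i < k} = p - (i + 1) := by
      rw [Fintype.card_subtype, show p - ((i : ℕ) + 1) = p - 1 - i by omega, ← Fin.card_Ioi]
      congr 1; ext; simp
    have h2 : Fintype.card {k : Fin q // k < j} = j := by
      rw [Fintype.card_subtype, ← Fin.card_Iio]
      congr 1; ext; simp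
    omega
  obtain ⟨x, hx, hx0⟩ := (Submodule.ne_bot_iff _).1 hT
  have hx1 : ∀ k, i < k → (Uᴴ *ᵥ f x) k = 0 := fun k hk =>
    congrFun (congrArg Prod.fst hx) ⟨k, hk⟩
  have hx2 : ∀ k, k < j → (Wᴴ *ᵥ g x) k = 0 := fun k hk =>
    congrFun (congrArg Prod.snd hx) ⟨k, hk⟩
  refine ⟨x, hx0, ?_, ?_⟩
  · conv_rhs => rw [hAU]
    rw [quadForm_conj_diagonal, quadForm_one, ← quadForm_one_unitary hU, Finset.mul_sum]
    refine Finset.sum_le_sum fun k _ => ?_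
    rcases le_or_gt k i with hk | hk
    · exact mul_le_mul_of_nonneg_right (sortedEigenvalues_antitone hA hk) (Complex.normSq_nonneg _)
    · simp [hx1 k hk]
  · conv_lhs => rw [hBW]
    rw [quadForm_conj_diagonal, quadForm_one, ← quadForm_one_unitary hW, Finset.mul_sum]
    refine Finset.sum_le_sum fun k _ => ?_
    rcases le_or_gt j k with hk | hk
    · exact mul_le_mul_of_nonneg_right (sortedEigenvalues_antitone hB hk) (Complex.normSq_nonneg _)
    · simp [hx2 k hk]

theorem quadForm_one_pos {r : ℕ} {x : Fin r → ℂ} (hx : x ≠ 0) : 0 < quadForm 1 x := by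
  rw [quadForm_one]
  obtain ⟨k, hk⟩ := Function.ne_iff.1 hx
  exact Finset.sum_pos' (fun _ _ => Complex.normSq_nonneg _)
    ⟨k, Finset.mem_univ _, Complex.normSq_pos.2 hk⟩

theorem quadForm_sub_le {r : ℕ} (A B : Matrix (Fin r) (Fin r) ℂ) (x : Fin r → ℂ) :
    quadForm A x - quadForm B x ≤ (∑ i, ∑ j, ‖A i j - B i j‖) * quadForm 1 x := by
  have h1 : quadForm A x - quadForm B x = (∑ i, ∑ j, star (x i) * ((A i j - B i j) * x j)).re := by
    rw [quadForm, quadForm, ← Complex.sub_re, ← dotProduct_sub, ← sub_mulVec]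
    simp [dotProduct, mulVec, Finset.mul_sum]
  have hN : ∀ i, ‖x i‖ ^ 2 ≤ quadForm 1 x := fun i => by
    rw [quadForm_one, ← Complex.normSq_eq_norm_sq]
    exact Finset.single_le_sum (f := fun k => Complex.normSq (x k))
      (fun k _ => Complex.normSq_nonneg _) (Finset.mem_univ i)
  rw [h1, Complex.re_sum, Finset.sum_mul]
  refine Finset.sum_le_sum fun i _ => ?_
  rw [Complex.re_sum, Finset.sum_mul]
  refine Finset.sum_le_sum fun j _ => (Complex.re_le_norm _).trans ?_
  rw [norm_mul, norm_mul, norm_star]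
  nlinarith [hN i, hN j, norm_nonneg (A i j - B i j), sq_nonneg (‖x i‖ - ‖x j‖),
    mul_le_mul_of_nonneg_left (show ‖x i‖ * ‖x j‖ ≤ quadForm 1 x by
      nlinarith [hN i, hN j, sq_nonneg (‖x i‖ - ‖x j‖)]) (norm_nonneg (A i j - B i j))]

/-- Weyl's perturbation inequality, with the sum of the entry norms as a crude bound for the
operator norm. It gives continuity of the eigenvalues, and with it measurability. -/
theorem sortedEigenvalues_le_add {r : ℕ} {A B : Matrix (Fin r) (Fin r) ℂ} (hA : A.IsHermitian)
    (hB : B.IsHermitian) (k : Fin r) :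
    sortedEigenvalues hA k ≤ sortedEigenvalues hB k + ∑ i, ∑ j, ‖A i j - B i j‖ := by
  obtain ⟨x, hx, h1, h2⟩ := exists_quadForm_between hA hB LinearMap.id LinearMap.id k k (by omega)
  have h3 := quadForm_sub_le A B x
  have h4 := quadForm_one_pos hx
  simp only [LinearMap.id_apply] at h1 h2
  refine le_of_mul_le_mul_right ?_ h4
  linarith

theorem continuous_sortedEigenvalues {r : ℕ} :
    Continuous fun H : {H : Matrix (Fin r) (Fin r) ℂ // H.IsHermitian} =>
      sortedEigenvalues H.2 := by
  refine continuous_pi fun k => continuous_iff_continuousAt.2 fun H₀ => ?_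
  have hd : Filter.Tendsto (fun H : {H : Matrix (Fin r) (Fin r) ℂ // H.IsHermitian} =>
      ∑ i, ∑ j, ‖H.1 i j - H₀.1 i j‖) (nhds H₀) (nhds 0) := by
    have : Continuous fun H : {H : Matrix (Fin r) (Fin r) ℂ // H.IsHermitian} =>
        ∑ i, ∑ j, ‖H.1 i j - H₀.1 i j‖ := by
      refine continuous_finsetSum _ fun i _ => continuous_finsetSum _ fun j _ => ?_
      exact ((continuous_subtype_val.matrix_elem i j).sub continuous_const).norm
    simpa using this.tendsto H₀
  rw [ContinuousAt, tendsto_iff_dist_tendsto_zero]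
  refine squeeze_zero (fun _ => dist_nonneg) (fun H => ?_) hd
  rw [Real.dist_eq, abs_le]
  have h1 := sortedEigenvalues_le_add H.2 H₀.2 k
  have h2 := sortedEigenvalues_le_add H₀.2 H.2 k
  simp only [norm_sub_rev (H₀.1 _ _)] at h2
  constructor <;> linarith

theorem quadForm_submatrix_castSucc {r : ℕ} (H : Matrix (Fin (r + 1)) (Fin (r + 1)) ℂ)
    (x : Fin r → ℂ) :
    quadForm H (Fin.snoc (α := fun _ => ℂ) x 0) = quadForm (H.submatrix Fin.castSucc Fin.castSucc) x := by
  simp [quadForm, dotProduct, mulVec, Fin.sum_univ_castSucc]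

/-- Cauchy interlacing. -/
theorem interlaced_sortedEigenvalues {r : ℕ} {H : Matrix (Fin (r + 1)) (Fin (r + 1)) ℂ}
    (hH : H.IsHermitian) :
    Interlaced (sortedEigenvalues (hH.submatrix Fin.castSucc)) (sortedEigenvalues hH) := by
  let f : (Fin r → ℂ) →ₗ[ℂ] (Fin (r + 1) → ℂ) :=
    { toFun := fun x => Fin.snoc (α := fun _ => ℂ) x 0
      map_add' := fun x y => by
        ext i; refine Fin.lastCases ?_ (fun i => ?_) i <;> simp
      map_smul' := fun c x => by
        ext i; refine Fin.lastCases ?_ (fun i => ?_) i <;> simp }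
  have hf : ∀ x, f x = Fin.snoc (α := fun _ => ℂ) x 0 := fun _ => rfl
  have hf1 : ∀ x, quadForm 1 (f x) = quadForm 1 x := fun x => by
    rw [quadForm_one, quadForm_one, Fin.sum_univ_castSucc]
    simp [hf]
  intro k
  constructor
  -- On vectors with last coordinate `0` the forms of the matrix and of its corner agree. Both
  -- halves impose `r - 1` conditions on `r` unknowns.
  · obtain ⟨x, hx, h1, h2⟩ := exists_quadForm_between (hH.submatrix Fin.castSucc) hH
      LinearMap.id f k k.castSucc (by simp; omega)
    rw [hf, quadForm_submatrix_castSucc, ← hf, hf1] at h2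
    exact le_of_mul_le_mul_right (h1.trans h2) (quadForm_one_pos hx)
  · obtain ⟨x, hx, h1, h2⟩ := exists_quadForm_between hH (hH.submatrix Fin.castSucc)
      f LinearMap.id k.succ k (by simp; omega)
    rw [hf1, hf, quadForm_submatrix_castSucc] at h1
    exact le_of_mul_le_mul_right (h1.trans h2) (quadForm_one_pos hx)

end Eigenvalues

end

section

/-! ## The space of Hermitian matrices -/

section Herm

open Matrix

instance matrixBorelSpace {m n : Type*} [Countable m] [Countable n] :
    BorelSpace (Matrix m n ℂ) :=
  inferInstanceAs (BorelSpace (m → n → ℂ))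

instance matrixSecondCountable {m n : Type*} [Countable m] [Countable n] :
    SecondCountableTopology (Matrix m n ℂ) :=
  inferInstanceAs (SecondCountableTopology (m → n → ℂ))

instance matrixLocallyCompact {m n : Type*} [Finite m] [Finite n] :
    LocallyCompactSpace (Matrix m n ℂ) :=
  inferInstanceAs (LocallyCompactSpace (m → n → ℂ))

/-- Hermitian `n × n` matrices. -/
abbrev Herm (n : ℕ) : Type := selfAdjoint (Matrix (Fin n) (Fin n) ℂ)

theorem Herm.isHermitian {n : ℕ} (H : Herm n) : H.1.IsHermitian := H.2

theorem isClosed_herm (n : ℕ) : 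
    IsClosed (selfAdjoint (Matrix (Fin n) (Fin n) ℂ) : Set (Matrix (Fin n) (Fin n) ℂ)) :=
  isClosed_eq continuous_star continuous_id

instance hermLocallyCompact (n : ℕ) : LocallyCompactSpace (Herm n) :=
  (isClosed_herm n).isClosedEmbedding_subtypeVal.locallyCompactSpace

instance hermBorel (n : ℕ) : BorelSpace (Herm n) := Subtype.borelSpace _

instance hermSecondCountable (n : ℕ) : SecondCountableTopology (Herm n) :=
  TopologicalSpace.Subtype.secondCountableTopology _

/-- The decreasing eigenvalues of a Hermitian matrix. -/
def Herm.eig {n : ℕ} (H : Herm n) : Fin n → ℝ := sortedEigenvalues H.isHermitian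

theorem continuous_eig {n : ℕ} : Continuous (Herm.eig (n := n)) :=
  continuous_sortedEigenvalues (r := n)

theorem measurable_eig {n : ℕ} : Measurable (Herm.eig (n := n)) := continuous_eig.measurable

/-- The conjugate `Uᴴ H U`. -/
def Herm.conj {n : ℕ} (U : Matrix (Fin n) (Fin n) ℂ) (H : Herm n) : Herm n :=
  ⟨Uᴴ * H.1 * U, isHermitian_conjTranspose_mul_mul U H.isHermitian⟩

theorem Herm.conj_mul {n : ℕ} (U W : Matrix (Fin n) (Fin n) ℂ) (H : Herm n) :
    Herm.conj (U * W) H = Herm.conj W (Herm.conj U H) :=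
  Subtype.ext (by simp [Herm.conj, mul_assoc])

theorem Herm.conj_one {n : ℕ} (H : Herm n) : Herm.conj 1 H = H :=
  Subtype.ext (by simp [Herm.conj])

theorem continuous_conj {n : ℕ} :
    Continuous fun p : Matrix (Fin n) (Fin n) ℂ × Herm n => Herm.conj p.1 p.2 := by
  refine Continuous.subtype_mk ?_ _
  have h1 : Continuous fun p : Matrix (Fin n) (Fin n) ℂ × Herm n => p.1ᴴ :=
    continuous_fst.matrix_conjTranspose
  exact (h1.matrix_mul (continuous_subtype_val.comp continuous_snd)).matrix_mul continuous_fst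

theorem Herm.eig_conj {n : ℕ} {U : Matrix (Fin n) (Fin n) ℂ} (hU : U ∈ unitaryGroup (Fin n) ℂ)
    (H : Herm n) : (Herm.conj U H).eig = H.eig := by
  apply sortedEigenvalues_congr_of_charpoly
  have h := charpoly_unitary_conj (Unitary.star_mem hU) H.1
  rwa [star_eq_conjTranspose, conjTranspose_conjTranspose] at h

/-- The diagonal matrix with real entries `y`. -/
def Herm.diag {n : ℕ} (y : Fin n → ℝ) : Herm n :=
  ⟨diagonal fun k => (y k : ℂ), isHermitian_diagonal_of_self_adjoint _ (by
    ext i; simp [Pi.star_apply])⟩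

theorem continuous_diag {n : ℕ} : Continuous (Herm.diag (n := n)) := by
  refine Continuous.subtype_mk ?_ _
  exact (continuous_pi fun k => Complex.continuous_ofReal.comp (continuous_apply k)).matrix_diagonal

theorem Herm.exists_eq_conj_diag {n : ℕ} (H : Herm n) :
    ∃ U ∈ unitaryGroup (Fin n) ℂ, H = Herm.conj U (Herm.diag H.eig) := by
  obtain ⟨U, hU, h⟩ := exists_unitary_diagonal H.isHermitian
  refine ⟨Uᴴ, Unitary.star_mem hU, Subtype.ext ?_⟩
  simpa [Herm.conj, Herm.diag, Herm.eig] using h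

theorem Herm.coe_conj {n : ℕ} (U : Matrix (Fin n) (Fin n) ℂ) (H : Herm n) :
    (Herm.conj U H).1 = Uᴴ * H.1 * U := rfl

theorem Herm.coe_diag {n : ℕ} (y : Fin n → ℝ) :
    (Herm.diag y).1 = diagonal fun k => (y k : ℂ) := rfl

attribute [irreducible] Herm.conj Herm.diag

instance unitaryGroup_compactSpace (n : ℕ) : CompactSpace (unitaryGroup (Fin n) ℂ) := by
  refine isCompact_iff_compactSpace.1 (?_ : IsCompact
    (unitaryGroup (Fin n) ℂ : Set (Matrix (Fin n) (Fin n) ℂ)))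
  have h1 : IsCompact (Set.univ.pi fun _ : Fin n => Set.univ.pi fun _ : Fin n =>
      Metric.closedBall (0 : ℂ) 1) :=
    isCompact_univ_pi fun _ => isCompact_univ_pi fun _ => isCompact_closedBall _ _
  have h2 : IsClosed (unitaryGroup (Fin n) ℂ : Set (Matrix (Fin n) (Fin n) ℂ)) := by
    have : (unitaryGroup (Fin n) ℂ : Set (Matrix (Fin n) (Fin n) ℂ)) = {U | U * star U = 1} := by
      ext U; exact mem_unitaryGroup_iff
    rw [this]
    exact isClosed_eq (continuous_id.matrix_mul continuous_star) continuous_const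
  refine h1.of_isClosed_subset h2 fun U hU i _ j _ => ?_
  simpa using entry_norm_bound_of_unitary hU i j

instance unitaryGroup_borelSpace (n : ℕ) : BorelSpace (unitaryGroup (Fin n) ℂ) :=
  Subtype.borelSpace _

instance unitaryGroup_secondCountable (n : ℕ) :
    SecondCountableTopology (unitaryGroup (Fin n) ℂ) :=
  TopologicalSpace.Subtype.secondCountableTopology _

theorem measurable_conj_unitary (n : ℕ) :
    Measurable fun p : unitaryGroup (Fin n) ℂ × Herm n => Herm.conj p.1.1 p.2 := by
  have h1 : Measurable fun p : unitaryGroup (Fin n) ℂ × Herm n => p.1.1 :=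
    measurable_subtype_coe.comp measurable_fst
  have h2 : Measurable fun p : Matrix (Fin n) (Fin n) ℂ × Herm n => Herm.conj p.1 p.2 :=
    continuous_conj.measurable
  have h3 : Measurable fun p : unitaryGroup (Fin n) ℂ × Herm n => (p.1.1, p.2) :=
    h1.prodMk measurable_snd
  exact h2.comp h3

/-- A finite unitarily invariant measure on Hermitian matrices is determined by the eigenvalue
distribution. -/
theorem measure_eq_of_map_eig_eq {n : ℕ} (Q R : Measure (Herm n)) [IsFiniteMeasure Q]
    [IsFiniteMeasure R]
    (hQ : ∀ U ∈ unitaryGroup (Fin n) ℂ, Q.map (Herm.conj U) = Q)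
    (hR : ∀ U ∈ unitaryGroup (Fin n) ℂ, R.map (Herm.conj U) = R)
    (h : Q.map Herm.eig = R.map Herm.eig) : Q = R := by
  let η : Measure (unitaryGroup (Fin n) ℂ) := Measure.haar
  -- Average the invariance over Haar measure on the unitary group and swap the integrals: the
  -- integral over `U` then depends on the matrix only through its eigenvalues.
  have key : ∀ s : Set (Herm n), MeasurableSet s → ∀ S : Measure (Herm n), IsFiniteMeasure S →
      (∀ U ∈ unitaryGroup (Fin n) ℂ, S.map (Herm.conj U) = S) →
      S s * η Set.univ = ∫⁻ y, (∫⁻ U : unitaryGroup (Fin n) ℂ,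
        s.indicator 1 (Herm.conj U.1 (Herm.diag y)) ∂η) ∂(S.map Herm.eig) := by
    intro s hs S _ hS
    set g : Herm n → ℝ≥0∞ := s.indicator 1 with hgd
    have hg : Measurable g := measurable_one.indicator hs
    have hm : Measurable fun p : unitaryGroup (Fin n) ℂ × Herm n =>
        g (Herm.conj p.1.1 p.2) := hg.comp (measurable_conj_unitary n)
    have hd : Measurable fun p : unitaryGroup (Fin n) ℂ × (Fin n → ℝ) =>
        g (Herm.conj p.1.1 (Herm.diag p.2)) :=
      hm.comp (measurable_fst.prodMk (continuous_diag.measurable.comp measurable_snd))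
    have h1 : ∀ U : unitaryGroup (Fin n) ℂ,
        ∫⁻ H, g (Herm.conj U.1 H) ∂S = S s := by
      intro U
      have hc : Measurable (Herm.conj U.1) :=
        (continuous_conj.comp (continuous_const.prodMk continuous_id)).measurable
      rw [← lintegral_map (f := g) hg hc, hS U.1 U.2, hgd,
        lintegral_indicator_one hs]
    have h2 : ∫⁻ U : unitaryGroup (Fin n) ℂ, ∫⁻ H, g (Herm.conj U.1 H) ∂S ∂η =
        S s * η Set.univ := by
      simp only [h1, lintegral_const]
    rw [← h2, lintegral_lintegral_swap hm.aemeasurable,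
      lintegral_map (Measurable.lintegral_prod_left' hd) measurable_eig]
    refine lintegral_congr fun H => ?_
    -- With `H = conj W D`, conjugation by `U` gives `conj (W * U) D`, and left invariance of Haar
    -- measure absorbs `W`.
    obtain ⟨W, hW, hH⟩ := H.exists_eq_conj_diag
    conv_lhs => rw [hH]
    simp only [← Herm.conj_mul]
    exact lintegral_mul_left_eq_self (μ := η)
      (fun U : unitaryGroup (Fin n) ℂ => g (Herm.conj U.1 (Herm.diag H.eig)))
      (⟨W, hW⟩ : unitaryGroup (Fin n) ℂ)
  ext s hs
  have h1 := (key s hs Q inferInstance hQ).trans (h ▸ (key s hs R inferInstance hR).symm)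
  have h0 : η Set.univ ≠ 0 := IsOpen.measure_ne_zero _ isOpen_univ Set.univ_nonempty
  exact (ENNReal.mul_left_inj h0 (measure_ne_top _ _)).1 h1

end Herm

/-! ## Haar measures under automorphisms -/

/-- A continuous additive automorphism that preserves a compact neighbourhood of `0` preserves
Haar measure. -/
theorem map_addHaar_eq_of_preimage_eq {G : Type*} [AddCommGroup G] [TopologicalSpace G]
    [IsTopologicalAddGroup G] [LocallyCompactSpace G] [SecondCountableTopology G]
    [MeasurableSpace G] [BorelSpace G] (μ : Measure G) [μ.IsAddHaarMeasure] (f : G ≃ₜ+ G)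
    {S : Set G} (hS : IsCompact S) (hS0 : S ∈ nhds 0) (hf : f ⁻¹' S = S) (hSm : MeasurableSet S) :
    μ.map f = μ := by
  have := f.isAddHaarMeasure_map μ
  have h := Measure.isAddLeftInvariant_eq_smul (μ.map f) μ
  have h1 := congrArg (fun ν : Measure G => ν S) h
  simp only [Measure.smul_apply] at h1
  have hfc : Continuous f := f.toHomeomorph.continuous
  rw [Measure.map_apply hfc.measurable hSm, hf, ENNReal.smul_def, smul_eq_mul] at h1
  have h0 : μ S ≠ 0 := (Measure.measure_pos_of_mem_nhds μ hS0).ne'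
  -- Uniqueness of Haar measure leaves a scalar; `S` has finite nonzero measure and is its own
  -- preimage, so the scalar is `1`.
  have h2 : (1 : ℝ≥0∞) = (Measure.addHaarScalarFactor (μ.map f) μ : ℝ≥0∞) :=
    (ENNReal.mul_left_inj h0 hS.measure_ne_top).1 (by rw [one_mul]; exact h1)
  rw [h]
  have h3 : Measure.addHaarScalarFactor (μ.map f) μ = 1 := by exact_mod_cast h2.symm
  rw [h3, one_smul]

end

section

/-! ## Hermitian matrices bordered by a row and a column -/

section Block

open Matrix

theorem Herm.eig_diag {n : ℕ} {y : Fin n → ℝ} (hy : Antitone y) : (Herm.diag y).eig = y := by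
  refine sortedEigenvalues_eq_iff_charpoly _ hy ?_
  rw [Herm.coe_diag, charpoly_diagonal]

/-- The matrix of size `n + 1` with upper left corner `H`, last column `(w, a)`. -/
def blockMatrix {n : ℕ} (H : Matrix (Fin n) (Fin n) ℂ) (w : Fin n → ℂ) (a : ℝ) :
    Matrix (Fin (n + 1)) (Fin (n + 1)) ℂ :=
  (bordered H w (star w) (a : ℂ)).submatrix
    ((finSuccEquivLast).trans (Equiv.optionEquivSumPUnit.{0} (Fin n)))
    ((finSuccEquivLast).trans (Equiv.optionEquivSumPUnit.{0} (Fin n)))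

section entries

variable {n : ℕ} (H : Matrix (Fin n) (Fin n) ℂ) (w : Fin n → ℂ) (a : ℝ) (i j : Fin n)

@[simp] theorem blockMatrix_castSucc_castSucc :
    blockMatrix H w a i.castSucc j.castSucc = H i j := by simp [blockMatrix, bordered]

@[simp] theorem blockMatrix_castSucc_last :
    blockMatrix H w a i.castSucc (Fin.last n) = w i := by simp [blockMatrix, bordered]

@[simp] theorem blockMatrix_last_castSucc :
    blockMatrix H w a (Fin.last n) j.castSucc = star (w j) := by simp [blockMatrix, bordered]

@[simp] theorem blockMatrix_last_last :
    blockMatrix H w a (Fin.last n) (Fin.last n) = a := by simp [blockMatrix, bordered]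

end entries

/-- The bordered Hermitian matrix with upper left corner `H`, last column `(w, a)`. -/
def Herm.block {n : ℕ} (H : Herm n) (w : Fin n → ℂ) (a : ℝ) : Herm (n + 1) :=
  ⟨blockMatrix H.1 w a, by
    have h : ∀ i j, star (H.1 i j) = H.1 j i := fun i j => H.isHermitian.apply j i
    refine Matrix.IsHermitian.ext fun i j => ?_
    refine Fin.lastCases ?_ (fun i => ?_) i <;> refine Fin.lastCases ?_ (fun j => ?_) j
    · simp
    · simp
    · simp
    · simp only [blockMatrix_castSucc_castSucc]; exact h _ _⟩

/-- The upper left corner. -/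
def Herm.minor {n : ℕ} (H : Herm (n + 1)) : Herm n :=
  ⟨H.1.submatrix Fin.castSucc Fin.castSucc, H.isHermitian.submatrix Fin.castSucc⟩

theorem Herm.coe_block {n : ℕ} (H : Herm n) (w : Fin n → ℂ) (a : ℝ) :
    (H.block w a).1 = blockMatrix H.1 w a := rfl

theorem Herm.coe_minor {n : ℕ} (H : Herm (n + 1)) :
    H.minor.1 = H.1.submatrix Fin.castSucc Fin.castSucc := rfl

theorem Herm.minor_block {n : ℕ} (H : Herm n) (w : Fin n → ℂ) (a : ℝ) :
    (H.block w a).minor = H :=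
  Subtype.ext (by ext i j; simp [Herm.coe_minor, Herm.coe_block])

theorem continuous_minor {n : ℕ} : Continuous (Herm.minor (n := n)) :=
  Continuous.subtype_mk (continuous_subtype_val.matrix_submatrix _ _) _

theorem interlaced_eig {n : ℕ} (H : Herm (n + 1)) : Interlaced H.minor.eig H.eig :=
  interlaced_sortedEigenvalues H.isHermitian

theorem continuous_block {n : ℕ} :
    Continuous fun p : Herm n × (Fin n → ℂ) × ℝ => Herm.block p.1 p.2.1 p.2.2 := by
  refine Continuous.subtype_mk (continuous_matrix fun i j => ?_) _
  refine Fin.lastCases ?_ (fun i => ?_) i <;> refine Fin.lastCases ?_ (fun j => ?_) j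
  · simp only [blockMatrix_last_last]; fun_prop
  · simp only [blockMatrix_last_castSucc]; fun_prop
  · simp only [blockMatrix_castSucc_last]; fun_prop
  · simp only [blockMatrix_castSucc_castSucc]
    exact (continuous_subtype_val.comp continuous_fst).matrix_elem i j

/-- Hermitian matrices of size `n + 1`, decomposed into the upper left corner and the last
column. -/
def blockEquiv (n : ℕ) : (Herm n × (Fin n → ℂ) × ℝ) ≃ₜ+ Herm (n + 1) where
  toFun p := Herm.block p.1 p.2.1 p.2.2
  invFun H := (H.minor, fun i => H.1 i.castSucc (Fin.last n), (H.1 (Fin.last n) (Fin.last n)).re)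
  left_inv p := by
    ext i j
    · simp [Herm.minor_block]
    · simp [Herm.coe_block]
    · simp [Herm.coe_block]
  right_inv H := by
    have h : ∀ i j, star (H.1 i j) = H.1 j i := fun i j => H.isHermitian.apply j i
    refine Subtype.ext (Matrix.ext fun i j => ?_)
    refine Fin.lastCases ?_ (fun i => ?_) i <;> refine Fin.lastCases ?_ (fun j => ?_) j
    · simp only [Herm.coe_block, blockMatrix_last_last]
      exact Complex.conj_eq_iff_re.1 (h _ _)
    · simp only [Herm.coe_block, blockMatrix_last_castSucc]; exact h _ _
    · simp [Herm.coe_block]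
    · simp [Herm.coe_block, Herm.coe_minor]
  map_add' p q := by
    refine Subtype.ext (Matrix.ext fun i j => ?_)
    refine Fin.lastCases ?_ (fun i => ?_) i <;> refine Fin.lastCases ?_ (fun j => ?_) j <;>
      simp [Herm.coe_block]
  continuous_toFun := continuous_block
  continuous_invFun := by
    refine continuous_minor.prodMk (Continuous.prodMk ?_ ?_)
    · exact continuous_pi fun i => continuous_subtype_val.matrix_elem _ _
    · exact Complex.continuous_re.comp (continuous_subtype_val.matrix_elem _ _)

/-- Haar measure on Hermitian matrices. -/
def hermMeasure (n : ℕ) : Measure (Herm n) := Measure.addHaar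

instance (n : ℕ) : (hermMeasure n).IsAddHaarMeasure :=
  inferInstanceAs (Measure.addHaar : Measure (Herm n)).IsAddHaarMeasure

/-- Bordering is an isomorphism of topological groups, so it sends the product Haar measure to a
Haar measure, and uniqueness leaves one constant. -/
theorem hermMeasure_succ (n : ℕ) : ∃ c : ℝ≥0∞, c ≠ 0 ∧ c ≠ ∞ ∧ hermMeasure (n + 1) =
    c • ((hermMeasure n).prod ((volume : Measure (Fin n → ℂ)).prod (volume : Measure ℝ))).map
      fun p => Herm.block p.1 p.2.1 p.2.2 := by
  set μ := (hermMeasure n).prod ((volume : Measure (Fin n → ℂ)).prod (volume : Measure ℝ))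
  have h1 : (μ.map (blockEquiv n)).IsAddHaarMeasure := by
    have h1 : SFinite (hermMeasure n) := inferInstance
    have h2 : (volume : Measure (Fin n → ℂ)).IsAddHaarMeasure := inferInstance
    have h7 : MeasurableAdd (Fin n → ℂ) := inferInstance
    have h3 : ((volume : Measure (Fin n → ℂ)).prod (volume : Measure ℝ)).IsAddHaarMeasure :=
      Measure.prod.instIsAddHaarMeasure volume volume
    have h4 : MeasurableAdd (Herm n) := inferInstance
    have h5 : MeasurableAdd ((Fin n → ℂ) × ℝ) := inferInstance
    have h6 : SFinite (volume : Measure ((Fin n → ℂ) × ℝ)) := inferInstance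
    have : μ.IsAddHaarMeasure := Measure.prod.instIsAddHaarMeasure _ _
    exact (blockEquiv n).isAddHaarMeasure_map μ
  refine ⟨Measure.addHaarScalarFactor (hermMeasure (n + 1)) (μ.map (blockEquiv n)), ?_,
    ENNReal.coe_ne_top, ?_⟩
  · simpa using (Measure.addHaarScalarFactor_pos_of_isAddHaarMeasure (hermMeasure (n + 1))
      (μ.map (blockEquiv n))).ne'
  · exact Measure.isAddLeftInvariant_eq_smul (hermMeasure (n + 1)) (μ.map (blockEquiv n))

theorem lintegral_hermMeasure_succ (n : ℕ) : ∃ c : ℝ≥0∞, c ≠ 0 ∧ c ≠ ∞ ∧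
    ∀ F : Herm (n + 1) → ℝ≥0∞, Measurable F → ∫⁻ H, F H ∂(hermMeasure (n + 1)) =
      c * ∫⁻ H, ∫⁻ p : (Fin n → ℂ) × ℝ, F (Herm.block H p.1 p.2) ∂volume ∂(hermMeasure n) := by
  obtain ⟨c, h0, h1, h⟩ := hermMeasure_succ n
  refine ⟨c, h0, h1, fun F hF => ?_⟩
  rw [h, lintegral_smul_measure, lintegral_map hF continuous_block.measurable, smul_eq_mul,
    lintegral_prod (fun p : Herm n × (Fin n → ℂ) × ℝ => F (Herm.block p.1 p.2.1 p.2.2))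
      (hF.comp continuous_block.measurable).aemeasurable]
  rfl

/-- The invariant compact neighbourhood of `0` consists of the matrices with spectrum in `[-1, 1]`.
It is compact as the image of the unitary group times the ordered spectra in a cube. -/
theorem map_conj_hermMeasure {n : ℕ} {U : Matrix (Fin n) (Fin n) ℂ}
    (hU : U ∈ unitaryGroup (Fin n) ℂ) : (hermMeasure n).map (Herm.conj U) = hermMeasure n := by
  have hc : ∀ W : Matrix (Fin n) (Fin n) ℂ, Continuous (Herm.conj W) := fun W =>
    continuous_conj.comp (continuous_const.prodMk continuous_id)
  let f : Herm n ≃ₜ+ Herm n :=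
    { toFun := Herm.conj U
      invFun := Herm.conj Uᴴ
      left_inv := fun H => by
        rw [← Herm.conj_mul, show U * Uᴴ = 1 from mem_unitaryGroup_iff.1 hU, Herm.conj_one]
      right_inv := fun H => by
        rw [← Herm.conj_mul, show Uᴴ * U = 1 from mem_unitaryGroup_iff'.1 hU, Herm.conj_one]
      map_add' := fun H K => Subtype.ext (by simp [Herm.coe_conj, mul_add, add_mul])
      continuous_toFun := hc U
      continuous_invFun := hc Uᴴ }
  have hE : {H : Herm n | H.eig ∈ Set.Icc (-1) 1} =
      (fun p : unitaryGroup (Fin n) ℂ × (Fin n → ℝ) => Herm.conj p.1.1 (Herm.diag p.2)) ''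
        (Set.univ ×ˢ {y | Antitone y ∧ y ∈ Set.Icc (-1) 1}) := by
    ext H
    constructor
    · intro hH
      obtain ⟨W, hW, h⟩ := H.exists_eq_conj_diag
      exact ⟨(⟨W, hW⟩, H.eig), ⟨trivial, sortedEigenvalues_antitone H.isHermitian, hH⟩, h.symm⟩
    · rintro ⟨⟨W, y⟩, ⟨-, hy, hy'⟩, rfl⟩
      simpa [Herm.eig_conj W.2, Herm.eig_diag hy] using hy'
  have hcl : IsClosed {y : Fin n → ℝ | Antitone y} := by
    have : {y : Fin n → ℝ | Antitone y} = ⋂ (i) (j) (_ : i ≤ j), {y | y j ≤ y i} := by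
      ext y; simp [Antitone]
    rw [this]
    exact isClosed_iInter fun i => isClosed_iInter fun j => isClosed_iInter fun _ =>
      isClosed_le (continuous_apply j) (continuous_apply i)
  have hS : IsCompact {H : Herm n | H.eig ∈ Set.Icc (-1) 1} := by
    rw [hE]
    refine (isCompact_univ.prod (isCompact_Icc.inter_left hcl)).image ?_
    exact continuous_conj.comp ((continuous_subtype_val.comp continuous_fst).prodMk
      (continuous_diag.comp continuous_snd))
  have hS0 : {H : Herm n | H.eig ∈ Set.Icc (-1) 1} ∈ nhds 0 := by
    have h0 : (0 : Herm n).eig = 0 := by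
      refine sortedEigenvalues_eq_iff_charpoly _ (fun _ _ _ => le_rfl) ?_
      simp [charpoly_zero]
    refine continuous_eig.continuousAt.preimage_mem_nhds ?_
    rw [h0]
    refine Filter.mem_of_superset (isOpen_set_pi Set.finite_univ (s := fun _ => Set.Ioo (-1 : ℝ) 1)
      (fun _ _ => isOpen_Ioo) |>.mem_nhds (by simp)) fun y hy => ?_
    exact ⟨fun i => (hy i trivial).1.le, fun i => (hy i trivial).2.le⟩
  exact map_addHaar_eq_of_preimage_eq (hermMeasure n) f hS hS0
    (by ext H; simp [f, Herm.eig_conj hU]) (hS.isClosed.measurableSet)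

/-- Here the invariant compact neighbourhood is the Euclidean unit ball. -/
theorem map_mulVec_volume {n : ℕ} {U : Matrix (Fin n) (Fin n) ℂ}
    (hU : U ∈ unitaryGroup (Fin n) ℂ) :
    (volume : Measure (Fin n → ℂ)).map (fun w => U *ᵥ w) = volume := by
  have hc : ∀ W : Matrix (Fin n) (Fin n) ℂ, Continuous fun w : Fin n → ℂ => W *ᵥ w := fun W =>
    continuous_const.matrix_mulVec continuous_id
  let f : (Fin n → ℂ) ≃ₜ+ (Fin n → ℂ) :=
    { toFun := fun w => U *ᵥ w
      invFun := fun w => Uᴴ *ᵥ w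
      left_inv := fun H => by
        have := mem_unitaryGroup_iff'.1 hU
        rw [star_eq_conjTranspose] at this
        simp [this]
      right_inv := fun H => by
        have := mem_unitaryGroup_iff.1 hU
        rw [star_eq_conjTranspose] at this
        simp [this]
      map_add' := fun H K => mulVec_add _ _ _
      continuous_toFun := hc U
      continuous_invFun := hc Uᴴ }
  have hQ : Continuous fun w : Fin n → ℂ => ∑ k, Complex.normSq (w k) :=
    continuous_finsetSum _ fun k _ => Complex.continuous_normSq.comp (continuous_apply k)
  have hcl : IsClosed {w : Fin n → ℂ | ∑ k, Complex.normSq (w k) ≤ 1} :=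
    isClosed_le hQ continuous_const
  have hS : IsCompact {w : Fin n → ℂ | ∑ k, Complex.normSq (w k) ≤ 1} := by
    refine (isCompact_univ_pi (s := fun _ => Metric.closedBall (0 : ℂ) 1)
      fun _ => isCompact_closedBall _ _).of_isClosed_subset hcl fun w hw k _ => ?_
    have h1 : Complex.normSq (w k) ≤ 1 :=
      (Finset.single_le_sum (f := fun k => Complex.normSq (w k))
        (fun k _ => Complex.normSq_nonneg _) (Finset.mem_univ k)).trans hw
    rw [Complex.normSq_eq_norm_sq] at h1
    simpa using h1
  have hS0 : {w : Fin n → ℂ | ∑ k, Complex.normSq (w k) ≤ 1} ∈ nhds 0 := by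
    refine Filter.mem_of_superset ((isOpen_lt hQ continuous_const).mem_nhds
      (show ∑ k, Complex.normSq ((0 : Fin n → ℂ) k) < 1 by simp)) fun w hw => (show ∑ k, Complex.normSq (w k) < 1 from hw).le
  have hinv : ∀ w : Fin n → ℂ, ∑ k, Complex.normSq ((U *ᵥ w) k) = ∑ k, Complex.normSq (w k) := by
    intro w
    have := quadForm_one_unitary (Unitary.star_mem hU) w
    simpa [star_eq_conjTranspose] using this
  exact map_addHaar_eq_of_preimage_eq volume f hS hS0
    (by ext w; simp [f, hinv]) hcl.measurableSet

/-- The polynomial `(X - a) ∏ (X - y_k) - ∑ q_k ∏_{j ≠ k} (X - y_j)`. -/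
def secularPoly {n : ℕ} (y q : Fin n → ℝ) (a : ℝ) : ℝ[X] :=
  (X - C a) * ∏ k, (X - C (y k)) - ∑ k, C (q k) * ∏ j ∈ Finset.univ.erase k, (X - C (y j))

/-- The formula for bordered determinants applies to the characteristic matrix; the adjugate of its
diagonal part supplies the products over `j ≠ k`. -/
theorem charpoly_bordered_diagonal {n : ℕ} (y : Fin n → ℝ) (w : Fin n → ℂ) (a : ℝ) :
    (bordered (diagonal fun k => (y k : ℂ)) w (star w) (a : ℂ)).charpoly =
      (secularPoly y (fun k => Complex.normSq (w k)) a).map Complex.ofRealHom := by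
  have h : charmatrix (bordered (diagonal fun k => (y k : ℂ)) w (star w) (a : ℂ)) =
      bordered (diagonal fun k => X - C (y k : ℂ)) (fun k => - C (w k)) (fun k => - C (star (w k)))
        (X - C (a : ℂ)) := by
    ext1 i j
    rcases i with i | i <;> rcases j with j | j
    · by_cases hij : i = j <;> simp [bordered, hij]
    all_goals simp [bordered]
  rw [charpoly, h, det_bordered, det_diagonal, adjugate_diagonal, secularPoly]
  simp only [dotProduct, mulVec_diagonal, Polynomial.map_sub, Polynomial.map_mul,
    Polynomial.map_prod, Polynomial.map_sum, map_X, map_C]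
  congr 1
  refine Finset.sum_congr rfl fun k _ => ?_
  have : C (Complex.ofRealHom (Complex.normSq (w k))) = C (star (w k)) * C (w k) := by
    rw [← C_mul]; congr 1
    simp [Complex.normSq_eq_conj_mul_self]
  rw [this]
  simp
  ring

/-- Conjugation by the block matrix with blocks `U` and `1` diagonalises the corner, replaces `w` by
`U w`, and preserves the characteristic polynomial. -/
theorem charpoly_block_conj_diag {n : ℕ} {U : Matrix (Fin n) (Fin n) ℂ}
    (hU : U ∈ unitaryGroup (Fin n) ℂ) (y : Fin n → ℝ) (w : Fin n → ℂ) (a : ℝ) :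
    (Herm.block (Herm.conj U (Herm.diag y)) w a).1.charpoly =
      (secularPoly y (fun k => Complex.normSq ((U *ᵥ w) k)) a).map Complex.ofRealHom := by
  have hU' : U * Uᴴ = 1 := mem_unitaryGroup_iff.1 hU
  have hU'' : Uᴴ * U = 1 := mem_unitaryGroup_iff'.1 hU
  rw [← charpoly_bordered_diagonal, Herm.coe_block, blockMatrix, Herm.coe_conj, Herm.coe_diag]
  set e := (finSuccEquivLast (n := n)).trans (Equiv.optionEquivSumPUnit.{0} (Fin n))
  have h1 := charpoly_reindex e.symm
    (bordered ((Uᴴ * diagonal fun k => (y k : ℂ)) * U) w (star w) (a : ℂ))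
  rw [reindex_apply, Equiv.symm_symm] at h1
  rw [h1]
  set V : Matrix (Fin n ⊕ Unit) (Fin n ⊕ Unit) ℂ := fromBlocks U 0 0 1 with hV
  have hVV : V * Vᴴ = 1 := by
    rw [hV, fromBlocks_conjTranspose, fromBlocks_multiply]
    simp [hU']
  have h2 : bordered ((Uᴴ * diagonal fun k => (y k : ℂ)) * U) w (star w) (a : ℂ) =
      Vᴴ * bordered (diagonal fun k => (y k : ℂ)) (U *ᵥ w) (star (U *ᵥ w)) (a : ℂ) * V := by
    have h3 : Uᴴ * replicateCol Unit (U *ᵥ w) = replicateCol Unit w := by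
      rw [replicateCol_mulVec, ← Matrix.mul_assoc, hU'', Matrix.one_mul]
    have h4 : replicateRow Unit (star (U *ᵥ w)) * U = replicateRow Unit (star w) := by
      rw [star_mulVec, replicateRow_vecMul, Matrix.mul_assoc, hU'', Matrix.mul_one]
    rw [hV, bordered, bordered, fromBlocks_conjTranspose, fromBlocks_multiply, fromBlocks_multiply]
    simp [h3, h4]
  rw [h2, mul_assoc, charpoly_mul_comm, mul_assoc, hVV, mul_one]

end Block

end

section

/-! ## Interlacing coordinates -/

section Secular

variable {n : ℕ}

/-- Strict interlacing. -/
def strictInterlaced (y : Fin n → ℝ) : Set (Fin (n + 1) → ℝ) :=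
  {z | ∀ k : Fin n, y k < z k.castSucc ∧ z k.succ < y k}

theorem Interlaced.antitone {y : Fin n → ℝ} {z : Fin (n + 1) → ℝ} (h : Interlaced y z) :
    Antitone z :=
  Fin.antitone_iff_succ_le.2 fun k => (h k).2.trans (h k).1

theorem interlaced_of_mem_strictInterlaced {y : Fin n → ℝ} {z : Fin (n + 1) → ℝ}
    (h : z ∈ strictInterlaced y) : Interlaced y z := fun k => ⟨(h k).1.le, (h k).2.le⟩

/-- The coordinates `(∑ z - ∑ y, q)` of `z`, where
`∏ (X - z_j) = (X - a) ∏ (X - y_k) - ∑ q_k ∏_{j ≠ k} (X - y_j)`. -/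
def secularCoord (y : Fin n → ℝ) (z : Fin (n + 1) → ℝ) : Fin (n + 1) → ℝ :=
  Fin.cons (∑ j, z j - ∑ k, y k)
    fun k => -(∏ j, (y k - z j)) / ∏ j ∈ Finset.univ.erase k, (y k - y j)

theorem secularCoord_zero (y : Fin n → ℝ) (z : Fin (n + 1) → ℝ) :
    secularCoord y z 0 = ∑ j, z j - ∑ k, y k := rfl

theorem secularCoord_succ (y : Fin n → ℝ) (z : Fin (n + 1) → ℝ) (k : Fin n) :
    secularCoord y z k.succ =
      -(∏ j, (y k - z j)) / ∏ j ∈ Finset.univ.erase k, (y k - y j) := rfl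

theorem prod_erase_sub_ne_zero {y : Fin n → ℝ} (hy : Function.Injective y) (k : Fin n) :
    ∏ j ∈ Finset.univ.erase k, (y k - y j) ≠ 0 :=
  Finset.prod_ne_zero_iff.2 fun _ hj => sub_ne_zero.2 fun h =>
    Finset.ne_of_mem_erase hj (hy h).symm

/-- The factors of `z` just above and just below `y_k` have opposite signs, which absorbs the minus
sign. Every other `y_i` is paired with its neighbour in `z` on the far side from `y_k`, so that both
differences from `y_k` have the same sign. -/
theorem secularCoord_succ_pos {y : Fin n → ℝ} (hy : StrictAnti y) {z : Fin (n + 1) → ℝ}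
    (hz : z ∈ strictInterlaced y) (k : Fin n) : 0 < secularCoord y z k.succ := by
  have hn : n = (n - 1) + 1 := by have := k.2; omega
  generalize n - 1 = m at hn
  subst hn
  rw [secularCoord_succ, Fin.prod_univ_succAbove _ k.castSucc, Fin.prod_univ_succAbove _ k,
    Fin.succAbove_castSucc_self]
  have h1 : ∏ j ∈ Finset.univ.erase k, (y k - y j) = ∏ j, (y k - y (k.succAbove j)) := by
    rw [← Finset.compl_singleton, ← Fin.image_succAbove_univ,
      Finset.prod_image fun a _ b _ h => Fin.succAbove_right_injective h]
  rw [h1]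
  have h2 : -((y k - z k.castSucc) * ((y k - z k.succ) *
      ∏ i, (y k - z (k.castSucc.succAbove (k.succAbove i))))) / ∏ j, (y k - y (k.succAbove j)) =
      ((z k.castSucc - y k) * (y k - z k.succ)) *
      ∏ i, (y k - z (k.castSucc.succAbove (k.succAbove i))) / (y k - y (k.succAbove i)) := by
    rw [Finset.prod_div_distrib]; ring
  rw [h2]
  refine mul_pos (mul_pos (sub_pos.2 (hz k).1) (sub_pos.2 (hz k).2))
    (Finset.prod_pos fun i _ => ?_)
  rcases lt_or_gt_of_ne (Fin.succAbove_ne k i) with h | h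
  · have h3 : k.castSucc.succAbove (k.succAbove i) = (k.succAbove i).castSucc :=
      Fin.succAbove_castSucc_of_lt _ _ h
    rw [h3]
    refine div_pos_of_neg_of_neg (sub_neg.2 ?_) (sub_neg.2 (hy h))
    exact (hy h).trans (hz _).1
  · have h3 : k.castSucc.succAbove (k.succAbove i) = (k.succAbove i).succ :=
      Fin.succAbove_castSucc_of_le _ _ h.le
    rw [h3]
    refine div_pos (sub_pos.2 ?_) (sub_pos.2 (hy h))
    exact (hz _).2.trans (hy h)

theorem coeff_prod_X_sub_C (z : Fin (n + 1) → ℝ) :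
    (∏ j, (X - C (z j))).coeff n = -∑ j, z j := by
  have := prod_X_sub_C_coeff_card_pred (Finset.univ : Finset (Fin (n + 1))) z (by simp)
  simpa using this

theorem degree_sum_prod_erase_lt (y q : Fin n → ℝ) :
    (∑ k, C (q k) * ∏ j ∈ Finset.univ.erase k, (X - C (y j))).degree < n := by
  refine (degree_sum_le _ _).trans_lt ((Finset.sup_lt_iff (WithBot.bot_lt_coe n)).2 fun k _ => ?_)
  refine (degree_mul_le _ _).trans_lt ((add_le_add_left degree_C_le _).trans_lt ?_)
  rw [degree_prod, zero_add]
  simp only [degree_X_sub_C, Finset.sum_const, nsmul_eq_mul, mul_one]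
  have := k.2
  rw [Finset.card_erase_of_mem (Finset.mem_univ _), Finset.card_univ, Fintype.card_fin]
  exact Nat.cast_lt.2 (by omega)

theorem secularPoly_eq (y q : Fin n → ℝ) (a : ℝ) :
    secularPoly y q a = ∏ j : Fin (n + 1), (X - C ((Fin.cons a y : Fin (n + 1) → ℝ) j)) -
      ∑ k, C (q k) * ∏ j ∈ Finset.univ.erase k, (X - C (y j)) := by
  rw [secularPoly, Fin.prod_univ_succ]; simp

theorem eval_secularPoly (y q : Fin n → ℝ) (a : ℝ) (k : Fin n) :
    (secularPoly y q a).eval (y k) = -(q k * ∏ j ∈ Finset.univ.erase k, (y k - y j)) := by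
  rw [secularPoly, eval_sub, eval_mul, eval_prod, Finset.prod_eq_zero (Finset.mem_univ k) (by simp),
    mul_zero, zero_sub, eval_finsetSum, Finset.sum_eq_single k]
  · simp [eval_prod]
  · intro b _ hb
    rw [eval_mul, eval_prod, Finset.prod_eq_zero (i := k) (by simp [hb.symm]) (by simp), mul_zero]
  · simp

/-- `∏ (X - z_j)` is the secular polynomial of `(y, q, a)` iff `(a, q)` are the coordinates
of `z`. -/
theorem secularCoord_eq_cons_iff {y : Fin n → ℝ} (hy : Function.Injective y)
    (z : Fin (n + 1) → ℝ) (q : Fin n → ℝ) (a : ℝ) :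
    secularCoord y z = Fin.cons a q ↔ ∏ j, (X - C (z j)) = secularPoly y q a := by
  have hq : ∀ k, (-(∏ j, (y k - z j)) / ∏ j ∈ Finset.univ.erase k, (y k - y j) = q k) ↔
      (∏ j, (X - C (z j))).eval (y k) = (secularPoly y q a).eval (y k) := fun k => by
    rw [eval_secularPoly, eval_prod, div_eq_iff (prod_erase_sub_ne_zero hy k), neg_eq_iff_eq_neg]
    simp
  have hs : ∑ j, z j - ∑ k, y k = a ↔
      (∏ j, (X - C (z j))).coeff n = (secularPoly y q a).coeff n := by
    rw [secularPoly_eq, coeff_sub, coeff_prod_X_sub_C, coeff_prod_X_sub_C,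
      coeff_eq_zero_of_degree_lt (degree_sum_prod_erase_lt y q), Fin.sum_univ_succ (Fin.cons a y)]
    simp only [Fin.cons_zero, Fin.cons_succ]
    constructor <;> intro h <;> linarith
  constructor
  · intro h
    have h0 := hs.1 (by simpa [secularCoord_zero] using congrFun h 0)
    have h1 := fun k : Fin n => (hq k).1 (by simpa [secularCoord_succ] using congrFun h k.succ)
    -- Both polynomials are monic of degree `n + 1` and share the coefficient of `X^n`, so their
    -- difference has degree below `n` and vanishes at the `n` distinct points `y_k`.
    refine eq_of_degree_sub_lt_of_eval_index_eq (s := Finset.univ) (v := y) (hy.injOn) ?_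
      (fun k _ => h1 k)
    rw [Finset.card_univ, Fintype.card_fin, degree_lt_iff_coeff_zero]
    intro m hm
    rw [coeff_sub, sub_eq_zero]
    rcases hm.eq_or_lt with rfl | hm
    · exact h0
    · rw [secularPoly_eq, coeff_sub, coeff_eq_zero_of_degree_lt
        ((degree_sum_prod_erase_lt y q).trans (by exact_mod_cast hm)), sub_zero]
      have hmon : ∀ x : Fin (n + 1) → ℝ, (∏ j, (X - C (x j))).coeff m =
          if m = n + 1 then 1 else 0 := fun x => by
        have hd : (∏ j, (X - C (x j))).natDegree = n + 1 := by
          rw [natDegree_prod _ _ fun j _ => X_sub_C_ne_zero _]; simp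
        split_ifs with h
        · have := (monic_prod_of_monic Finset.univ (fun j => X - C (x j))
            fun j _ => monic_X_sub_C _).coeff_natDegree
          subst h
          rwa [hd] at this
        · exact coeff_eq_zero_of_natDegree_lt (by omega)
      rw [hmon, hmon]
  · intro h
    funext j
    refine Fin.cases ?_ (fun k => ?_) j
    · simpa [secularCoord_zero] using hs.2 (by rw [h])
    · simpa [secularCoord_succ] using (hq k).2 (by rw [h])

theorem secularCoord_injective {y : Fin n → ℝ} (hy : Function.Injective y) :
    Set.InjOn (secularCoord y) {z | Antitone z} := by
  intro z hz z' hz' h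
  have e : ∀ w : Fin (n + 1) → ℝ, w = Fin.cons (w 0) (Fin.tail w) := fun w =>
    (Fin.cons_self_tail w).symm
  have h1 := (secularCoord_eq_cons_iff hy z _ _).1 (e (secularCoord y z))
  have h2 := (secularCoord_eq_cons_iff hy z' _ _).1 (e (secularCoord y z'))
  rw [h, ← h2] at h1
  apply eq_of_antitone_of_prod_eq hz hz'
  have := congrArg (Polynomial.map Complex.ofRealHom) h1
  simpa [Polynomial.map_prod] using this

/-! ### The Jacobian determinant -/

/-- The Jacobian matrix of `secularCoord y`. -/
def secularJacobian (y : Fin n → ℝ) (z : Fin (n + 1) → ℝ) :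
    Matrix (Fin (n + 1)) (Fin (n + 1)) ℝ :=
  Matrix.of (Fin.cons (fun _ => 1) fun k j =>
    (∏ i ∈ Finset.univ.erase j, (y k - z i)) / ∏ j ∈ Finset.univ.erase k, (y k - y j))

theorem hasFDerivAt_secularCoord (y : Fin n → ℝ) (z : Fin (n + 1) → ℝ) :
    HasFDerivAt (secularCoord y)
      (Matrix.toLin' (secularJacobian y z)).toContinuousLinearMap z := by
  rw [hasFDerivAt_pi']
  intro j
  refine Fin.cases ?_ (fun k => ?_) j
  · have h : HasFDerivAt (fun z : Fin (n + 1) → ℝ => ∑ j, z j - ∑ k, y k)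
        (∑ j, ContinuousLinearMap.proj (R := ℝ) (φ := fun _ : Fin (n + 1) => ℝ) j) z :=
      (HasFDerivAt.fun_sum fun j _ => hasFDerivAt_apply j z).sub_const _
    refine h.congr_fderiv ?_
    ext v
    simp [secularJacobian, Matrix.mulVec, dotProduct]
  · have h1 : ∀ j : Fin (n + 1), HasFDerivAt (fun z : Fin (n + 1) → ℝ => y k - z j)
        (-ContinuousLinearMap.proj (R := ℝ) (φ := fun _ : Fin (n + 1) => ℝ) j) z := fun j =>
      (hasFDerivAt_apply j z).const_sub _
    have h2 := (HasFDerivAt.finsetProd (u := Finset.univ) fun j _ => h1 j).neg.mul_const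
      (∏ j ∈ Finset.univ.erase k, (y k - y j))⁻¹
    refine (h2.congr_fderiv ?_).congr_of_eventuallyEq (Filter.Eventually.of_forall fun z => ?_)
    · ext v
      simp [secularJacobian, Matrix.mulVec, dotProduct, Finset.mul_sum, div_eq_mul_inv]
      exact Finset.sum_congr rfl fun _ _ => by ring
    · simp [secularCoord_succ, div_eq_mul_inv]

theorem abs_prod_prod_erase (z : Fin n → ℝ) :
    |∏ j, ∏ i ∈ Finset.univ.erase j, (z j - z i)| = vandermonde z ^ 2 := by
  have h1 : ∀ j : Fin n, ∏ i ∈ Finset.univ.erase j, |z j - z i| =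
      (∏ i ∈ Finset.Ioi j, |z j - z i|) * ∏ i ∈ Finset.Iio j, |z j - z i| := fun j => by
    rw [← Finset.prod_union (Finset.disjoint_left.2 fun i hi hi' =>
      absurd ((Finset.mem_Ioi.1 hi).trans (Finset.mem_Iio.1 hi')) (lt_irrefl _))]
    refine Finset.prod_congr ?_ fun _ _ => rfl
    ext i
    simp [lt_or_lt_iff_ne, ne_comm]
  have h2 : ∏ j, ∏ i ∈ Finset.Iio j, |z j - z i| = ∏ i, ∏ j ∈ Finset.Ioi i, |z i - z j| := by
    rw [Finset.prod_comm' (t' := Finset.univ) (s' := fun i => Finset.Ioi i) (by simp)]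
    exact Finset.prod_congr rfl fun i _ => Finset.prod_congr rfl fun j _ => abs_sub_comm _ _
  rw [← sq_abs, vandermonde]
  simp only [Finset.abs_prod, h1]
  rw [Finset.prod_mul_distrib, h2, sq]

theorem vandermonde_ne_zero {z : Fin n → ℝ} (hz : Function.Injective z) : vandermonde z ≠ 0 :=
  Finset.prod_ne_zero_iff.2 fun _ _ => Finset.prod_ne_zero_iff.2 fun _ hj =>
    sub_ne_zero.2 fun h => (Finset.mem_Ioi.1 hj).ne (hz h)

theorem abs_det_vandermonde (z : Fin n → ℝ) :
    |(Matrix.vandermonde z).det| = |vandermonde z| := by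
  rw [Matrix.det_vandermonde, vandermonde]
  simp only [Finset.abs_prod]
  exact Finset.prod_congr rfl fun i _ => Finset.prod_congr rfl fun j _ => abs_sub_comm _ _

/-- The Jacobian matrix consists of values of the polynomials `∏_{i ≠ j} (X - z_i)` at the `y_k`,
with rows rescaled. It factors into a diagonal matrix, a Vandermonde matrix in `y` and a matrix of
coefficients. -/
theorem abs_det_secularJacobian {y : Fin n → ℝ} (hy : Function.Injective y)
    {z : Fin (n + 1) → ℝ} (hz : Function.Injective z) :
    |(secularJacobian y z).det| = |vandermonde z / vandermonde y| := by
  set P : Fin (n + 1) → ℝ[X] := fun j => ∏ i ∈ Finset.univ.erase j, (X - C (z i)) with hP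
  have hPd : ∀ j, (P j).natDegree = n := fun j => by
    rw [hP, natDegree_prod _ _ fun j _ => X_sub_C_ne_zero _]; simp
  have hPm : ∀ j, (P j).coeff n = 1 := fun j => by
    have := (monic_prod_of_monic (Finset.univ.erase j) (fun i => X - C (z i))
      fun j _ => monic_X_sub_C _).coeff_natDegree
    rwa [← hPd j]
  have hPe : ∀ j t, ∑ l : Fin (n + 1), t ^ (l : ℕ) * (P j).coeff l =
      ∏ i ∈ Finset.univ.erase j, (t - z i) := fun j t => by
    have h := eval_eq_sum_range' (p := P j) (n := n + 1) (by rw [hPd]; omega) t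
    rw [Finset.sum_range] at h
    rw [← Finset.sum_congr rfl fun l _ => mul_comm _ _, ← h, hP, eval_prod]
    simp
  -- Row `0` is the point at infinity: it reads off the leading coefficient, which is `1`, and
  -- thereby produces the row of ones that comes from the trace coordinate.
  set W : Matrix (Fin (n + 1)) (Fin (n + 1)) ℝ :=
    Matrix.projVandermonde (Fin.cons 1 y) (Fin.cons 0 fun _ => 1) with hW
  set D : Matrix (Fin (n + 1)) (Fin (n + 1)) ℝ := Matrix.of fun l j => (P j).coeff l with hD
  have hJ : secularJacobian y z = Matrix.diagonal
      (Fin.cons 1 fun k => (∏ j ∈ Finset.univ.erase k, (y k - y j))⁻¹) * (W * D) := by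
    ext i j
    rw [Matrix.diagonal_mul, Matrix.mul_apply]
    refine Fin.cases ?_ (fun k => ?_) i
    · simp only [secularJacobian, Matrix.of_apply, Fin.cons_zero, one_mul, hW, hD,
        Matrix.projVandermonde_apply]
      rw [Finset.sum_eq_single (Fin.last n)]
      · simp [hPm]
      · intro b _ hb
        have : (b.rev : ℕ) ≠ 0 := fun h => hb (by
          have := Fin.rev_eq_iff.1 (Fin.ext h : b.rev = 0); simpa using this)
        simp only [zero_pow this]
        simp
      · simp
    · simp only [secularJacobian, Matrix.of_apply, Fin.cons_succ, hW, hD,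
        Matrix.projVandermonde_apply, one_pow, mul_one, hPe]
      rw [div_eq_inv_mul]
  have hWdet : |W.det| = |vandermonde y| := by
    rw [hW, Matrix.det_projVandermonde, Fin.prod_univ_succ, vandermonde]
    simp only [Fin.cons_zero, Fin.prod_Ioi_zero, Fin.prod_Ioi_succ, Fin.cons_succ, abs_mul,
      Finset.abs_prod]
    simp [abs_sub_comm]
  -- Evaluated at the `z_i`, the same polynomials form a diagonal matrix, so the determinant of the
  -- coefficient matrix can be found by dividing by `Δ(z)`.
  have hVD : Matrix.vandermonde z * D =
      Matrix.diagonal fun j => ∏ i ∈ Finset.univ.erase j, (z j - z i) := by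
    ext i j
    rw [Matrix.mul_apply]
    simp only [Matrix.vandermonde_apply, hD, Matrix.of_apply, hPe]
    by_cases hij : i = j
    · rw [hij, Matrix.diagonal_apply_eq]
    · rw [Matrix.diagonal_apply_ne _ hij]
      exact Finset.prod_eq_zero (i := i) (by simp [hij]) (sub_self _)
  have hDdet : |D.det| = |vandermonde z| := by
    have h := congrArg (fun M => |Matrix.det M|) hVD
    simp only [Matrix.det_mul, abs_mul, Matrix.det_diagonal, abs_prod_prod_erase,
      abs_det_vandermonde] at h
    rw [← sq_abs, sq] at h
    exact mul_left_cancel₀ (abs_ne_zero.2 (vandermonde_ne_zero hz)) h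
  have hy0 := vandermonde_ne_zero hy
  rw [hJ, Matrix.det_mul, Matrix.det_mul, Matrix.det_diagonal, Fin.prod_univ_succ, abs_mul, abs_mul,
    abs_mul, hWdet, hDdet]
  simp only [Fin.cons_zero, Fin.cons_succ, Finset.prod_inv_distrib, abs_inv,
    abs_prod_prod_erase]
  rw [← sq_abs, abs_div]
  field_simp
  rw [abs_one, one_mul]

end Secular

end

section

/-! ## The law of the eigenvalues of a bordered matrix -/

/-- Half-open intervals pull back to annuli, with area `π` times the difference of the squared
radii. The convention that `√` vanishes on negative numbers covers intervals that reach below `0`.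
-/
theorem map_normSq_volume :
    (volume : Measure ℂ).map Complex.normSq =
      ENNReal.ofReal Real.pi • (volume : Measure ℝ).restrict (Set.Ioi 0) := by
  have hm : Measurable Complex.normSq := Complex.continuous_normSq.measurable
  symm
  have : IsLocallyFiniteMeasure
      (ENNReal.ofReal Real.pi • (volume : Measure ℝ).restrict (Set.Ioi 0)) := by
    rw [ENNReal.ofReal]
    exact inferInstanceAs (IsLocallyFiniteMeasure (Real.pi.toNNReal • _))
  refine Measure.ext_of_Ico _ _ fun a b hab => ?_
  have hset : Complex.normSq ⁻¹' Set.Ico a b = Metric.ball 0 (√b) \ Metric.ball 0 (√a) := by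
    ext z
    simp only [Set.mem_preimage, Set.mem_Ico, Set.mem_sdiff, Metric.mem_ball, dist_zero_right,
      Real.lt_sqrt (norm_nonneg _), Complex.normSq_eq_norm_sq, not_lt]
    tauto
  have hab' : √a ≤ √b := Real.sqrt_le_sqrt hab.le
  rw [Measure.map_apply hm measurableSet_Ico, hset,
    measure_sdiff (Metric.ball_subset_ball hab') measurableSet_ball.nullMeasurableSet
      measure_ball_lt_top.ne, Complex.volume_ball, Complex.volume_ball, Measure.smul_apply,
    Measure.restrict_apply measurableSet_Ico, ← ENNReal.ofReal_pow (Real.sqrt_nonneg _),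
    ← ENNReal.ofReal_pow (Real.sqrt_nonneg _), smul_eq_mul]
  have h1 : volume (Set.Ico a b ∩ Set.Ioi 0) = ENNReal.ofReal (√b ^ 2) - ENNReal.ofReal (√a ^ 2) := by
    rcases le_or_gt 0 a with ha | ha
    · have : (Set.Ico a b ∩ Set.Ioi 0 : Set ℝ) =ᵐ[volume] Set.Ico a b := by
        have h := (ae_eq_refl (μ := volume) (Set.Ico a b)).inter
          (Ioi_ae_eq_Ici (μ := volume) (a := (0 : ℝ)))
        rwa [show Set.Ico a b ∩ Set.Ici 0 = Set.Ico a b from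
          Set.inter_eq_left.2 fun x hx => ha.trans hx.1] at h
      rw [measure_congr this, Real.volume_Ico, Real.sq_sqrt ha, Real.sq_sqrt (ha.trans hab.le),
        ENNReal.ofReal_sub _ ha]
    · have : Set.Ico a b ∩ Set.Ioi 0 = Set.Ioo 0 b := by
        ext x; simp; constructor <;> intro h <;> constructor <;> (try constructor) <;> linarith [h.1, h.2]
      rw [this, Real.volume_Ioo, Real.sqrt_eq_zero_of_nonpos ha.le]
      rcases le_or_gt 0 b with hb | hb
      · simp [Real.sq_sqrt hb]
      · simp [Real.sqrt_eq_zero_of_nonpos hb.le, hb.le]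
  rw [h1, ENNReal.mul_sub (by simp)]
  have : (NNReal.pi : ℝ≥0∞) = ENNReal.ofReal Real.pi := by
    rw [ENNReal.ofReal, ← NNReal.coe_real_pi, Real.toNNReal_coe]
  rw [this, mul_comm, mul_comm (ENNReal.ofReal (√a ^ 2))]

theorem pi_smul_const {ι : Type*} [Fintype ι] (c : ℝ≥0∞) (hc : c ≠ ∞) (μ : Measure ℝ)
    [SigmaFinite μ] :
    Measure.pi (fun _ : ι => c • μ) = c ^ Fintype.card ι • Measure.pi fun _ : ι => μ := by
  have : SigmaFinite (c • μ) := by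
    lift c to NNReal using hc
    exact inferInstanceAs (SigmaFinite (c • μ))
  refine Measure.pi_eq fun s _ => ?_
  simp [Measure.pi_pi, Finset.prod_mul_distrib]

theorem map_normSq_pi (n : ℕ) :
    (volume : Measure (Fin n → ℂ)).map (fun w k => Complex.normSq (w k)) =
      ENNReal.ofReal Real.pi ^ n •
        (volume : Measure (Fin n → ℝ)).restrict (Set.univ.pi fun _ => Set.Ioi 0) := by
  have hs : SigmaFinite ((volume : Measure ℂ).map Complex.normSq) := by
    rw [map_normSq_volume, ENNReal.ofReal]
    exact inferInstanceAs (SigmaFinite (Real.pi.toNNReal • (volume : Measure ℝ).restrict (Set.Ioi 0)))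
  rw [volume_pi, Measure.pi_map_pi fun _ => Complex.continuous_normSq.aemeasurable,
    map_normSq_volume, pi_smul_const _ ENNReal.ofReal_ne_top, volume_pi,
    Measure.restrict_pi_pi, Fintype.card_fin]

variable {n : ℕ}

/-- The eigenvalues with coordinates `x`. -/
def secularRoots (y : Fin n → ℝ) (x : Fin (n + 1) → ℝ) : Fin (n + 1) → ℝ :=
  (Herm.block (Herm.diag y) (fun k => (√(x k.succ) : ℂ)) (x 0)).eig

theorem continuous_secularRoots (y : Fin n → ℝ) : Continuous (secularRoots y) := by
  refine continuous_eig.comp (continuous_block.comp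
    (continuous_const.prodMk (Continuous.prodMk ?_ (continuous_apply 0))))
  exact continuous_pi fun k => Complex.continuous_ofReal.comp (continuous_apply k.succ).sqrt

theorem charpoly_block_sqrt (y : Fin n → ℝ) {x : Fin (n + 1) → ℝ} (hx : ∀ k : Fin n, 0 ≤ x k.succ) :
    (Herm.block (Herm.diag y) (fun k => (√(x k.succ) : ℂ)) (x 0)).1.charpoly =
      (secularPoly y (fun k => x k.succ) (x 0)).map Complex.ofRealHom := by
  have h := charpoly_block_conj_diag (one_mem _) y (fun k => (√(x k.succ) : ℂ)) (x 0)
  rw [Herm.conj_one] at h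
  rw [h]
  congr 2
  funext k
  simp [Real.mul_self_sqrt (hx k)]

/-- The phases of the components of `U w` do not enter the characteristic polynomial, so they may be
replaced by the square roots of their squared moduli. -/
theorem eig_block_conj_diag {U : Matrix (Fin n) (Fin n) ℂ} (hU : U ∈ Matrix.unitaryGroup (Fin n) ℂ)
    (y : Fin n → ℝ) (w : Fin n → ℂ) (a : ℝ) :
    (Herm.block (Herm.conj U (Herm.diag y)) w a).eig =
      secularRoots y (Fin.cons a fun k => Complex.normSq ((U.mulVec w) k)) := by
  refine sortedEigenvalues_congr_of_charpoly (Herm.isHermitian _) (Herm.isHermitian _) ?_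
  rw [charpoly_block_conj_diag hU, charpoly_block_sqrt]
  · simp
  · intro k
    simpa using Complex.normSq_nonneg _

theorem secularCoord_secularRoots {y : Fin n → ℝ} (hy : StrictAnti y) {x : Fin (n + 1) → ℝ}
    (hx : ∀ k : Fin n, 0 ≤ x k.succ) : secularCoord y (secularRoots y x) = x := by
  have e : x = Fin.cons (x 0) fun k : Fin n => x k.succ := (Fin.cons_self_tail x).symm
  conv_rhs => rw [e]
  rw [secularCoord_eq_cons_iff hy.injective]
  apply Polynomial.map_injective _ Complex.ofRealHom.injective
  rw [← charpoly_block_sqrt y hx, charpoly_eq_prod_sortedEigenvalues (Herm.isHermitian _)]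
  simp [Polynomial.map_prod, secularRoots, Herm.eig]

/-- Weak interlacing is Cauchy's theorem for a bordered matrix. It is strict since a common value
`y_k = z_j` would make the coordinate `q_k` vanish. -/
theorem secularRoots_mem {y : Fin n → ℝ} (hy : StrictAnti y) {x : Fin (n + 1) → ℝ}
    (hx : ∀ k : Fin n, 0 < x k.succ) : secularRoots y x ∈ strictInterlaced y := by
  have h1 : Interlaced y (secularRoots y x) := by
    have := interlaced_eig (Herm.block (Herm.diag y) (fun k => (√(x k.succ) : ℂ)) (x 0))
    rwa [Herm.minor_block, Herm.eig_diag hy.antitone] at this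
  have h2 := secularCoord_secularRoots hy fun k => (hx k).le
  have h3 : ∀ (k : Fin n) j, y k ≠ secularRoots y x j := fun k j h => by
    have h4 := congrFun h2 k.succ
    rw [secularCoord_succ, Finset.prod_eq_zero (Finset.mem_univ j) (sub_eq_zero.2 h)] at h4
    exact (hx k).ne (by simpa using h4)
  exact fun k => ⟨lt_of_le_of_ne (h1 k).1 (h3 k _), lt_of_le_of_ne (h1 k).2 (h3 k _).symm⟩

/-- Surjectivity needs no root counting: the preimage is the spectrum of the bordered diagonal
matrix with the prescribed entries. -/
theorem image_secularCoord {y : Fin n → ℝ} (hy : StrictAnti y) :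
    secularCoord y '' strictInterlaced y = {x | ∀ k : Fin n, 0 < x k.succ} := by
  ext x
  constructor
  · rintro ⟨z, hz, rfl⟩ k
    exact secularCoord_succ_pos hy hz k
  · intro hx
    exact ⟨secularRoots y x, secularRoots_mem hy hx,
      secularCoord_secularRoots hy fun k => (hx k).le⟩

theorem secularRoots_secularCoord {y : Fin n → ℝ} (hy : StrictAnti y) {z : Fin (n + 1) → ℝ}
    (hz : z ∈ strictInterlaced y) : secularRoots y (secularCoord y z) = z :=
  secularCoord_injective hy.injective (sortedEigenvalues_antitone (Herm.isHermitian _))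
    (interlaced_of_mem_strictInterlaced hz).antitone
    (secularCoord_secularRoots hy fun k => (secularCoord_succ_pos hy hz k).le)

theorem measurableSet_strictInterlaced (y : Fin n → ℝ) : MeasurableSet (strictInterlaced y) := by
  have : strictInterlaced y = ⋂ k : Fin n, {z | y k < z k.castSucc} ∩ {z | z k.succ < y k} := by
    ext z; simp [strictInterlaced]
  rw [this]
  exact MeasurableSet.iInter fun k => (measurableSet_lt measurable_const (measurable_pi_apply _)).inter
    (measurableSet_lt (measurable_pi_apply _) measurable_const)

theorem vandermonde_pos {z : Fin n → ℝ} (hz : StrictAnti z) : 0 < vandermonde z :=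
  Finset.prod_pos fun _ _ => Finset.prod_pos fun _ hj => sub_pos.2 (hz (Finset.mem_Ioi.1 hj))

theorem vandermonde_nonneg {z : Fin n → ℝ} (hz : Antitone z) : 0 ≤ vandermonde z :=
  Finset.prod_nonneg fun _ _ => Finset.prod_nonneg fun _ hj =>
    sub_nonneg.2 (hz (Finset.mem_Ioi.1 hj).le)

theorem strictAnti_of_mem_strictInterlaced {y : Fin n → ℝ} {z : Fin (n + 1) → ℝ}
    (h : z ∈ strictInterlaced y) : StrictAnti z :=
  Fin.strictAnti_iff_succ_lt.2 fun k => (h k).2.trans (h k).1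

/-- The substitution `x = secularCoord y z`. Both `y` and `z` decrease strictly, so the Jacobian is
positive without absolute values. -/
theorem setLIntegral_secularRoots {y : Fin n → ℝ} (hy : StrictAnti y)
    (F : (Fin (n + 1) → ℝ) → ℝ≥0∞) :
    ∫⁻ x in {x | ∀ k : Fin n, 0 < x k.succ}, F (secularRoots y x) =
      ∫⁻ z in strictInterlaced y, ENNReal.ofReal (vandermonde z / vandermonde y) * F z := by
  rw [← image_secularCoord hy, lintegral_image_eq_lintegral_abs_det_fderiv_mul volume
    (measurableSet_strictInterlaced y)
    (fun z _ => (hasFDerivAt_secularCoord y z).hasFDerivWithinAt)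
    ((secularCoord_injective hy.injective).mono fun z hz =>
      (interlaced_of_mem_strictInterlaced hz).antitone)]
  refine setLIntegral_congr_fun (measurableSet_strictInterlaced y) fun z hz => ?_
  have h1 := strictAnti_of_mem_strictInterlaced hz
  rw [secularRoots_secularCoord hy hz, ContinuousLinearMap.det, LinearMap.coe_toContinuousLinearMap,
    LinearMap.det_toLin', abs_det_secularJacobian hy.injective h1.injective,
    abs_of_pos (div_pos (vandermonde_pos h1) (vandermonde_pos hy))]

theorem strictInterlaced_ae_eq (y : Fin n → ℝ) :
    strictInterlaced y =ᵐ[volume] {z | Interlaced y z} := by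
  have h : ∀ᵐ z : Fin (n + 1) → ℝ, ∀ (k : Fin n) (j : Fin (n + 1)), z j ≠ y k :=
    ae_all_iff.2 fun k => ae_all_iff.2 fun j => 
    Measure.ae_eval_ne (μ := fun _ : Fin (n + 1) => (volume : Measure ℝ)) j (y k)
  filter_upwards [h] with z hz
  refine propext ⟨fun h => interlaced_of_mem_strictInterlaced h, fun h k =>
    ⟨lt_of_le_of_ne (h k).1 (hz _ _).symm, lt_of_le_of_ne (h k).2 (hz _ _)⟩⟩

/-- The law of the eigenvalues of a bordered matrix. -/
theorem lintegral_eig_block (H : Herm n) (hH : StrictAnti H.eig) {F : (Fin (n + 1) → ℝ) → ℝ≥0∞}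
    (hF : Measurable F) :
    ∫⁻ p : (Fin n → ℂ) × ℝ, F (Herm.block H p.1 p.2).eig =
      ENNReal.ofReal Real.pi ^ n * ∫⁻ z in {z | Interlaced H.eig z},
        ENNReal.ofReal (vandermonde z / vandermonde H.eig) * F z := by
  obtain ⟨U, hU, h⟩ := H.exists_eq_conj_diag
  set y := H.eig with hy
  have hG : Measurable fun x => F (secularRoots y x) := hF.comp (continuous_secularRoots y).measurable
  let e := MeasurableEquiv.piFinSuccAbove (fun _ : Fin (n + 1) => ℝ) 0
  have he := (volume_preserving_piFinSuccAbove (fun _ : Fin (n + 1) => ℝ) 0).symm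
  have hes : ∀ p : ℝ × (Fin n → ℝ), e.symm p = Fin.cons p.1 p.2 := fun p => by
    simp [e, MeasurableEquiv.piFinSuccAbove, Fin.consEquiv]
  have hcons : Measurable fun p : (Fin n → ℝ) × ℝ => (Fin.cons p.2 p.1 : Fin (n + 1) → ℝ) := by
    have := e.symm.measurable.comp (measurable_swap (α := Fin n → ℝ) (β := ℝ))
    simpa only [Function.comp_def, hes, Prod.fst_swap, Prod.snd_swap] using this
  have hGc : Measurable fun p : (Fin n → ℝ) × ℝ =>
      F (secularRoots y (Fin.cons p.2 p.1 : Fin (n + 1) → ℝ)) := hG.comp hcons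
  have hG1 : Measurable fun q : Fin n → ℝ =>
      ∫⁻ a, F (secularRoots y (Fin.cons a q : Fin (n + 1) → ℝ)) := hGc.lintegral_prod_right'
  have hN : Measurable fun (w : Fin n → ℂ) k => Complex.normSq (w k) :=
    measurable_pi_lambda _ fun k => Complex.continuous_normSq.measurable.comp (measurable_pi_apply k)
  have hUm : Measurable fun w : Fin n → ℂ => U.mulVec w :=
    (continuous_const.matrix_mulVec continuous_id).measurable
  calc ∫⁻ p : (Fin n → ℂ) × ℝ, F (Herm.block H p.1 p.2).eig
      = ∫⁻ p : (Fin n → ℂ) × ℝ,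
          F (secularRoots y (Fin.cons p.2 fun k => Complex.normSq ((U.mulVec p.1) k))) := by
        refine lintegral_congr fun p => ?_
        rw [h, eig_block_conj_diag hU]
    _ = ∫⁻ w : Fin n → ℂ, ∫⁻ a : ℝ,
          F (secularRoots y (Fin.cons a fun k => Complex.normSq ((U.mulVec w) k))) := by
        exact lintegral_prod _ (hGc.comp (((hN.comp hUm).comp measurable_fst).prodMk
          measurable_snd)).aemeasurable
    -- Unitary invariance of Lebesgue measure on the columns removes `U`.
    _ = ∫⁻ w : Fin n → ℂ, ∫⁻ a : ℝ,
          F (secularRoots y (Fin.cons a fun k => Complex.normSq (w k))) := by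
        conv_rhs => rw [← map_mulVec_volume hU]
        have h1 : Measurable fun w : Fin n → ℂ => ∫⁻ a : ℝ,
          F (secularRoots y (Fin.cons a fun k => Complex.normSq (w k))) := hG1.comp hN
        rw [lintegral_map h1 hUm]
    -- The squared moduli are jointly distributed as `π^n` times Lebesgue measure on the positive
    -- orthant.
    _ = ENNReal.ofReal Real.pi ^ n * ∫⁻ q in Set.univ.pi fun _ => Set.Ioi 0, ∫⁻ a : ℝ,
          F (secularRoots y (Fin.cons a q)) := by
        rw [← smul_eq_mul, ← lintegral_smul_measure, ← map_normSq_pi, lintegral_map hG1 hN]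
    _ = ENNReal.ofReal Real.pi ^ n *
          ∫⁻ x in {x | ∀ k : Fin n, 0 < x k.succ}, F (secularRoots y x) := by
        congr 1
        have hms : MeasurableSet {x : Fin (n + 1) → ℝ | ∀ k : Fin n, 0 < x k.succ} := by
          rw [Set.ofPred_forall]
          exact MeasurableSet.iInter fun k => measurableSet_lt measurable_const (measurable_pi_apply _)
        have h1 := he.setLIntegral_comp_preimage hms hG
        have h2 : e.symm ⁻¹' {x : Fin (n + 1) → ℝ | ∀ k : Fin n, 0 < x k.succ} =
            Set.univ ×ˢ Set.univ.pi fun _ => Set.Ioi 0 := by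
          ext p; simp [hes]
        rw [← h1, h2, Measure.volume_eq_prod, ← Measure.prod_restrict, Measure.restrict_univ,
          lintegral_prod_symm (fun p => F (secularRoots y (e.symm p)))
            (hG.comp e.symm.measurable).aemeasurable]
        simp only [hes]
    _ = _ := by
        rw [setLIntegral_secularRoots hH, setLIntegral_congr (strictInterlaced_ae_eq y)]

end

/-! ## Integration of the Vandermonde product over interlacing sequences -/

theorem vandermonde_eq_det {n : ℕ} (y : Fin n → ℝ) :
    vandermonde y = (Matrix.vandermonde fun i => -y i).det := by
  rw [Matrix.det_vandermonde, vandermonde]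
  exact Finset.prod_congr rfl fun i _ => Finset.prod_congr rfl fun j _ => by ring

/-- Subtract from each row its predecessor: the first column becomes `(1, 0, …, 0)`, and the
determinant is expanded along it. -/
theorem det_vandermonde_succ {n : ℕ} (x : Fin (n + 1) → ℝ) :
    (Matrix.vandermonde x).det =
      (Matrix.of fun i j : Fin n => x i.succ ^ (j + 1 : ℕ) - x i.castSucc ^ (j + 1 : ℕ)).det := by
  rw [Matrix.det_eq_of_forall_row_eq_smul_add_pred (B := Matrix.of (Fin.cons
    (Matrix.vandermonde x 0) fun i j => x i.succ ^ (j : ℕ) - x i.castSucc ^ (j : ℕ)))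
    (fun _ => (1 : ℝ)) (by simp) (by simp [Matrix.vandermonde_apply]),
    Matrix.det_succ_column_zero, Fin.sum_univ_succ]
  simp only [Matrix.of_apply, Fin.cons_succ]
  simp
  rfl

/-- Andréief's identity for product measures. -/
theorem integral_det_pi {n : ℕ} (μ : Fin n → Measure ℝ) [∀ i, SigmaFinite (μ i)]
    (f : Fin n → ℝ → ℝ) (hf : ∀ i j, Integrable (f j) (μ i)) :
    Integrable (fun y : Fin n → ℝ => (Matrix.of fun i j => f j (y i)).det) (Measure.pi μ) ∧
    ∫ y, (Matrix.of fun i j => f j (y i)).det ∂(Measure.pi μ) =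
      (Matrix.of fun i j => ∫ t, f j t ∂(μ i)).det := by
  have h : ∀ y : Fin n → ℝ, (Matrix.of fun i j => f j (y i)).det =
      ∑ σ : Equiv.Perm (Fin n), ((Equiv.Perm.sign σ : ℤ) : ℝ) * ∏ i, f (σ i) (y i) := fun y => by
    rw [← Matrix.det_transpose, Matrix.det_apply']
    simp
  have hi : ∀ σ : Equiv.Perm (Fin n), Integrable
      (fun y : Fin n → ℝ => ((Equiv.Perm.sign σ : ℤ) : ℝ) * ∏ i, f (σ i) (y i))
      (Measure.pi μ) := fun σ =>
    (Integrable.fintype_prod (f := fun i => f (σ i)) fun i => hf i _).const_mul _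
  simp only [h]
  refine ⟨integrable_finsetSum _ fun σ _ => hi σ, ?_⟩
  rw [integral_finsetSum _ fun σ _ => hi σ, ← Matrix.det_transpose, Matrix.det_apply']
  refine Finset.sum_congr rfl fun σ _ => ?_
  rw [integral_const_mul, integral_fintype_prod_eq_prod (f := fun i => f (σ i))]
  simp

theorem Interlaced.antitone_left {n : ℕ} {y : Fin n → ℝ} {z : Fin (n + 1) → ℝ}
    (h : Interlaced y z) : Antitone y := by
  rcases n with _ | n
  · exact fun i => i.elim0
  · refine Fin.antitone_iff_succ_le.2 fun k => ?_
    exact (h k.succ).1.trans ((h k.castSucc).2 : z k.castSucc.succ ≤ y k.castSucc)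

/-- The interlacing sequences form a box, so the Vandermonde determinant can be integrated row by
row. The entries become differences of powers of consecutive `-z_k`, divided by `j + 1`, and
`det_vandermonde_succ` identifies the result. -/
theorem setLIntegral_vandermonde_interlaced {n : ℕ} {z : Fin (n + 1) → ℝ} (hz : Antitone z) :
    ∫⁻ y in {y | Interlaced y z}, ENNReal.ofReal (vandermonde y) =
      ENNReal.ofReal (vandermonde z) * ENNReal.ofReal (∏ j : Fin n, ((j : ℝ) + 1))⁻¹ := by
  have hset : {y : Fin n → ℝ | Interlaced y z} =
      Set.univ.pi fun k => Set.Icc (z k.succ) (z k.castSucc) := by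
    ext y; simp only [Interlaced, Set.mem_ofPred_eq, Set.mem_univ_pi, Set.mem_Icc, and_comm]
  have hza : ∀ k : Fin n, z k.succ ≤ z k.castSucc := fun k => hz (Fin.castSucc_le_succ k)
  have hint := integral_det_pi (fun k : Fin n =>
    (volume : Measure ℝ).restrict (Set.Icc (z k.succ) (z k.castSucc)))
    (fun j t => (-t) ^ (j : ℕ)) fun i j =>
      (Continuous.integrableOn_Icc (by fun_prop))
  rw [← Measure.restrict_pi_pi, ← volume_pi, ← hset] at hint
  have hV : (fun y : Fin n → ℝ => vandermonde y) =
      fun y => (Matrix.of fun i j : Fin n => (-y i) ^ (j : ℕ)).det := by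
    funext y; rw [vandermonde_eq_det]; rfl
  simp only at hint
  rw [← hV] at hint
  have hms : MeasurableSet {y : Fin n → ℝ | Interlaced y z} := by
    rw [hset]; exact MeasurableSet.univ_pi fun _ => measurableSet_Icc
  have hnn : 0 ≤ᵐ[volume.restrict {y : Fin n → ℝ | Interlaced y z}]
      fun y => vandermonde y := by
    filter_upwards [ae_restrict_mem hms] with y hy
    exact vandermonde_nonneg (Interlaced.antitone_left hy)
  rw [← ofReal_integral_eq_lintegral_ofReal hint.1 hnn, ← ENNReal.ofReal_mul
    (vandermonde_nonneg hz)]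
  congr 1
  have hI : ∀ (i j : Fin n), ∫ t in Set.Icc (z i.succ) (z i.castSucc), (-t) ^ (j : ℕ) =
      ((j : ℝ) + 1)⁻¹ * ((-z i.succ) ^ (j + 1 : ℕ) - (-z i.castSucc) ^ (j + 1 : ℕ)) := fun i j => by
    rw [integral_Icc_eq_integral_Ioc, ← intervalIntegral.integral_of_le (hza i),
      intervalIntegral.integral_comp_neg (fun t => t ^ (j : ℕ)), integral_pow]
    ring
  have h2 := hint.2
  rw [show (∫ y in {y | Interlaced y z}, vandermonde y) = _ from h2]
  simp only [hI]
  rw [vandermonde_eq_det, det_vandermonde_succ, mul_comm, ← Finset.prod_inv_distrib,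
    ← Matrix.det_mul_row]
  rfl

/-! ## Generic points -/

theorem ae_injective (n : ℕ) : ∀ᵐ y : Fin n → ℝ, Function.Injective y := by
  have h : ∀ i j : Fin n, i ≠ j → ∀ᵐ y : Fin n → ℝ, y i ≠ y j := fun i j hij => by
    have := Measure.addHaar_submodule (volume : Measure (Fin n → ℝ))
      (LinearMap.ker (LinearMap.proj (R := ℝ) (φ := fun _ : Fin n => ℝ) i - LinearMap.proj j))
      (fun h => by
        have h1 : Pi.single i (1 : ℝ) ∈ LinearMap.ker
          (LinearMap.proj (R := ℝ) (φ := fun _ : Fin n => ℝ) i - LinearMap.proj j) := h ▸ trivial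
        simp [hij.symm] at h1)
    rw [ae_iff]
    convert this using 2
    ext y
    simp [sub_eq_zero]
  have h2 : ∀ᵐ y : Fin n → ℝ, ∀ i j : Fin n, i ≠ j → y i ≠ y j :=
    ae_all_iff.2 fun i => ae_all_iff.2 fun j => ae_all_iff.2 fun hij => h i j hij
  filter_upwards [h2] with y hy i j hij
  by_contra hne
  exact hy i j hne hij

theorem measurable_vandermonde (n : ℕ) : Measurable (vandermonde (r := n)) :=
  Finset.measurable_fun_prod _ fun i _ => Finset.measurable_fun_prod _ fun j _ =>
    (measurable_pi_apply i).sub (measurable_pi_apply j)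

theorem measurableSet_antitone (n : ℕ) : MeasurableSet {y : Fin n → ℝ | Antitone y} := by
  have : {y : Fin n → ℝ | Antitone y} = ⋂ (i) (j) (_ : i ≤ j), {y | y j ≤ y i} := by
    ext y; simp [Antitone]
  rw [this]
  exact MeasurableSet.iInter fun i => MeasurableSet.iInter fun j => MeasurableSet.iInter fun _ =>
    measurableSet_le (measurable_pi_apply j) (measurable_pi_apply i)

theorem measurableSet_interlaced (n : ℕ) :
    MeasurableSet {p : (Fin n → ℝ) × (Fin (n + 1) → ℝ) | Interlaced p.1 p.2} := by
  have : {p : (Fin n → ℝ) × (Fin (n + 1) → ℝ) | Interlaced p.1 p.2} =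
      ⋂ k : Fin n, {p | p.1 k ≤ p.2 k.castSucc} ∩ {p | p.2 k.succ ≤ p.1 k} := by
    ext z; simp [Interlaced]
  rw [this]
  refine MeasurableSet.iInter fun k => (measurableSet_le ?_ ?_).inter (measurableSet_le ?_ ?_) <;>
    fun_prop

/-! ## Haar measure in eigenvalue coordinates -/

/-- The conditional law of the spectrum given the corner. A simple spectrum of the corner is
required because the coordinates divide by the differences `y_k - y_j`. -/
theorem lintegral_minor_eig (n : ℕ) (hn : ∀ᵐ H ∂(hermMeasure n), StrictAnti H.eig) :
    ∃ c : ℝ≥0∞, c ≠ 0 ∧ c ≠ ∞ ∧ ∀ F : Herm n → (Fin (n + 1) → ℝ) → ℝ≥0∞,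
      Measurable (Function.uncurry F) → ∫⁻ H, F H.minor H.eig ∂(hermMeasure (n + 1)) =
        c * ∫⁻ H, (∫⁻ z in {z | Interlaced H.eig z},
          ENNReal.ofReal (vandermonde z / vandermonde H.eig) * F H z) ∂(hermMeasure n) := by
  obtain ⟨c, h0, h1, h⟩ := lintegral_hermMeasure_succ n
  refine ⟨c * ENNReal.ofReal Real.pi ^ n, mul_ne_zero h0 (pow_ne_zero _ (by simp [Real.pi_pos])),
    ENNReal.mul_ne_top h1 (ENNReal.pow_ne_top ENNReal.ofReal_ne_top), fun F hF => ?_⟩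
  have hF' : Measurable fun H : Herm (n + 1) => F H.minor H.eig :=
    hF.comp (continuous_minor.measurable.prodMk measurable_eig)
  rw [h _ hF', mul_assoc, ← lintegral_const_mul' _ _ (ENNReal.pow_ne_top ENNReal.ofReal_ne_top)]
  congr 1
  refine lintegral_congr_ae ?_
  filter_upwards [hn] with H hH
  simp only [Herm.minor_block]
  exact lintegral_eig_block H hH (hF.comp (measurable_const.prodMk measurable_id))

theorem strictAnti_of_vandermonde_ne_zero {n : ℕ} {y : Fin n → ℝ} (hy : Antitone y)
    (h : vandermonde y ≠ 0) : StrictAnti y := by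
  refine hy.strictAnti_of_injective fun i j hij => ?_
  by_contra hne
  rcases lt_or_gt_of_ne hne with hl | hl
  · exact h (Finset.prod_eq_zero (Finset.mem_univ i)
      (Finset.prod_eq_zero (Finset.mem_Ioi.2 hl) (sub_eq_zero.2 hij)))
  · exact h (Finset.prod_eq_zero (Finset.mem_univ j)
      (Finset.prod_eq_zero (Finset.mem_Ioi.2 hl) (sub_eq_zero.2 hij.symm)))

/-- The integral over an interlacing set, as an integral with an indicator function. -/
theorem setLIntegral_interlaced_eq {n : ℕ} (y : Fin n → ℝ) (G : (Fin (n + 1) → ℝ) → ℝ≥0∞) :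
    ∫⁻ z in {z | Interlaced y z}, G z =
      ∫⁻ z, {p : (Fin n → ℝ) × (Fin (n + 1) → ℝ) | Interlaced p.1 p.2}.indicator
        (fun p => G p.2) (y, z) := by
  have hm : MeasurableSet {z : Fin (n + 1) → ℝ | Interlaced y z} :=
    (measurableSet_interlaced n).preimage measurable_prodMk_left
  rw [← lintegral_indicator hm]
  rfl

/-- The eigenvalues have a density proportional to `Δ²` under Haar measure on Hermitian matrices. -/
def EigenvalueDensity (n : ℕ) : Prop :=
  ∃ c : ℝ≥0∞, c ≠ 0 ∧ c ≠ ∞ ∧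
    ∀ F : (Fin n → ℝ) → ℝ≥0∞, Measurable F → ∫⁻ H, F H.eig ∂(hermMeasure n) =
      c * ∫⁻ y in {y | Antitone y}, ENNReal.ofReal (vandermonde y ^ 2) * F y

/-- The factor `Δ²` annihilates the indicator of the zero set of `Δ`, which is used as test
function. -/
theorem EigenvalueDensity.ae_strictAnti {n : ℕ} (h : EigenvalueDensity n) :
    ∀ᵐ H ∂(hermMeasure n), StrictAnti H.eig := by
  obtain ⟨c, -, -, h⟩ := h
  have hms : MeasurableSet {y : Fin n → ℝ | vandermonde y = 0} :=
    measurable_vandermonde n (measurableSet_singleton 0)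
  have hm : Measurable ({y : Fin n → ℝ | vandermonde y = 0}.indicator (1 : (Fin n → ℝ) → ℝ≥0∞)) :=
    measurable_one.indicator hms
  have h1 := h _ hm
  have h2 : ∀ y : Fin n → ℝ, ENNReal.ofReal (vandermonde y ^ 2) *
      {y : Fin n → ℝ | vandermonde y = 0}.indicator (1 : (Fin n → ℝ) → ℝ≥0∞) y = 0 := fun y => by
    by_cases hy : vandermonde y = 0 <;> simp [hy]
  simp only [h2, lintegral_zero, mul_zero] at h1
  have h4 := (lintegral_eq_zero_iff (hm.comp measurable_eig)).1 h1
  filter_upwards [h4] with H hH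
  refine strictAnti_of_vandermonde_ne_zero (sortedEigenvalues_antitone H.isHermitian) fun h0 => ?_
  have h3 : vandermonde H.eig = 0 := h0
  simp [h3] at hH

/-- Integration of `Δ(y)` over the sequences `y` that interlace with `z`. -/
theorem lintegral_lintegral_interlaced (n : ℕ) {F : (Fin (n + 1) → ℝ) → ℝ≥0∞} (hF : Measurable F) :
    ∫⁻ y in {y | Antitone y}, ENNReal.ofReal (vandermonde y ^ 2) *
      ∫⁻ z in {z | Interlaced y z}, ENNReal.ofReal (vandermonde z / vandermonde y) * F z =
    ENNReal.ofReal (∏ j : Fin n, ((j : ℝ) + 1))⁻¹ *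
      ∫⁻ z in {z | Antitone z}, ENNReal.ofReal (vandermonde z ^ 2) * F z := by
  set S := {p : (Fin n → ℝ) × (Fin (n + 1) → ℝ) | Interlaced p.1 p.2} with hS
  have hSm : MeasurableSet S := measurableSet_interlaced n
  set G : (Fin n → ℝ) × (Fin (n + 1) → ℝ) → ℝ≥0∞ := S.indicator fun p =>
    ENNReal.ofReal (vandermonde p.1) * (ENNReal.ofReal (vandermonde p.2) * F p.2) with hG
  have hGm : Measurable G := by
    refine Measurable.indicator ?_ hSm
    exact (((measurable_vandermonde n).comp measurable_fst).ennreal_ofReal).mul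
      ((((measurable_vandermonde (n + 1)).comp measurable_snd).ennreal_ofReal).mul
        (hF.comp measurable_snd))
  calc _ = ∫⁻ y, ∫⁻ z, G (y, z) := by
        rw [← lintegral_indicator (measurableSet_antitone n)]
        refine lintegral_congr_ae ?_
        -- Off the null set of repeated coordinates, one factor of `Δ(y)²` cancels the denominator.
        filter_upwards [ae_injective n] with y hy
        by_cases hya : Antitone y
        · have hpos := vandermonde_pos (hya.strictAnti_of_injective hy)
          rw [Set.indicator_of_mem (show y ∈ {y | Antitone y} from hya),
            ← lintegral_const_mul' _ _ ENNReal.ofReal_ne_top,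
            setLIntegral_interlaced_eq]
          refine lintegral_congr fun z => ?_
          simp only [hG, Set.indicator]
          split_ifs with h
          · rw [← mul_assoc, ← mul_assoc, ← ENNReal.ofReal_mul (sq_nonneg _),
              ← ENNReal.ofReal_mul hpos.le]
            congr 2
            field_simp
          · rfl
        · rw [Set.indicator_of_notMem (show y ∉ {y | Antitone y} from hya)]
          refine ((lintegral_congr fun z => ?_).trans lintegral_zero).symm
          exact Set.indicator_of_notMem (fun h : Interlaced y z => hya h.antitone_left) _
    _ = ∫⁻ z, ∫⁻ y, G (y, z) := lintegral_lintegral_swap hGm.aemeasurable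
    _ = _ := by
        rw [← lintegral_const_mul' _ _ ENNReal.ofReal_ne_top,
          ← lintegral_indicator (measurableSet_antitone (n + 1))]
        refine lintegral_congr fun z => ?_
        by_cases hza : Antitone z
        · rw [Set.indicator_of_mem (show z ∈ {y | Antitone y} from hza)]
          have h1 : ∀ y, G (y, z) = {y | Interlaced y z}.indicator (fun y =>
              ENNReal.ofReal (vandermonde y)) y * (ENNReal.ofReal (vandermonde z) * F z) := by
            intro y
            simp only [hG, Set.indicator]
            by_cases h : Interlaced y z
            · rw [if_pos (show (y, z) ∈ S from h), if_pos (show y ∈ {y | Interlaced y z} from h)]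
            · rw [if_neg (show (y, z) ∉ S from h), if_neg (show y ∉ {y | Interlaced y z} from h),
                zero_mul]
          have hm : MeasurableSet {y : Fin n → ℝ | Interlaced y z} :=
            hSm.preimage measurable_prodMk_right
          rw [lintegral_congr h1, lintegral_mul_const _ ((measurable_vandermonde n).ennreal_ofReal.indicator hm),
            lintegral_indicator hm, setLIntegral_vandermonde_interlaced hza, sq,
            ENNReal.ofReal_mul (vandermonde_nonneg hza)]
          ring
        · rw [Set.indicator_of_notMem (show z ∉ {y | Antitone y} from hza)]
          refine (lintegral_congr fun y => ?_).trans lintegral_zero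
          exact Set.indicator_of_notMem (fun h : Interlaced y z => hza h.antitone) _

theorem measurable_setLIntegral_interlaced (n : ℕ) {G : (Fin n → ℝ) × (Fin (n + 1) → ℝ) → ℝ≥0∞}
    (hG : Measurable G) : Measurable fun y => ∫⁻ z in {z | Interlaced y z}, G (y, z) := by
  simp only [setLIntegral_interlaced_eq]
  have h : Measurable fun p : (Fin n → ℝ) × (Fin (n + 1) → ℝ) =>
      {p : (Fin n → ℝ) × (Fin (n + 1) → ℝ) | Interlaced p.1 p.2}.indicator G p :=
    hG.indicator (measurableSet_interlaced n)
  exact h.lintegral_prod_right'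

theorem measurable_vandermonde_div (n : ℕ) : Measurable
    fun p : (Fin n → ℝ) × (Fin (n + 1) → ℝ) =>
      ENNReal.ofReal (vandermonde p.2 / vandermonde p.1) :=
  (((measurable_vandermonde (n + 1)).comp measurable_snd).div
    ((measurable_vandermonde n).comp measurable_fst)).ennreal_ofReal

/-- Induction on the size: the corner contributes `Δ(y)²` and the conditional law `Δ(z) / Δ(y)`, and
the integral of `Δ(y)` over the interlacing `y` is a multiple of `Δ(z)`. -/
theorem eigenvalueDensity (n : ℕ) : EigenvalueDensity n := by
  induction n with
  | zero =>
    refine ⟨hermMeasure 0 Set.univ, IsOpen.measure_ne_zero _ isOpen_univ Set.univ_nonempty, ?_,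
      fun F hF => ?_⟩
    · have : Subsingleton (Herm 0) := ⟨fun A B => Subtype.ext (Subsingleton.elim _ _)⟩
      exact (Set.subsingleton_univ.finite.isCompact).measure_ne_top
    · have h1 : ∀ y : Fin 0 → ℝ, y = 0 := fun y => Subsingleton.elim _ _
      have h2 : {y : Fin 0 → ℝ | Antitone y} = Set.univ :=
        Set.eq_univ_of_forall fun y i => i.elim0
      have h3 : ∀ y : Fin 0 → ℝ, vandermonde y = 1 := fun y => by simp [vandermonde]
      rw [h2, Measure.restrict_univ]
      rw [lintegral_congr fun H : Herm 0 => congrArg F (h1 H.eig), lintegral_const, mul_comm]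
      rw [lintegral_congr fun y => (by rw [h1 y, h3] :
        ENNReal.ofReal (vandermonde y ^ 2) * F y = ENNReal.ofReal (1 ^ 2) * F 0)]
      simp [volume_pi]
  | succ n ih =>
    obtain ⟨c, hc0, hc1, hc⟩ := lintegral_minor_eig n ih.ae_strictAnti
    obtain ⟨C, hC0, hC1, hC⟩ := ih
    have hp : 0 < (∏ j : Fin n, ((j : ℝ) + 1))⁻¹ :=
      inv_pos.2 (Finset.prod_pos fun j _ => by positivity)
    refine ⟨c * (C * ENNReal.ofReal (∏ j : Fin n, ((j : ℝ) + 1))⁻¹),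
      mul_ne_zero hc0 (mul_ne_zero hC0 (by simpa using hp)),
      ENNReal.mul_ne_top hc1 (ENNReal.mul_ne_top hC1 ENNReal.ofReal_ne_top), fun F hF => ?_⟩
    rw [hc (fun _ z => F z) (hF.comp measurable_snd), mul_assoc, mul_assoc,
      ← lintegral_lintegral_interlaced n hF]
    congr 1
    exact hC (fun y => ∫⁻ z in {z | Interlaced y z},
      ENNReal.ofReal (vandermonde z / vandermonde y) * F z)
      (measurable_setLIntegral_interlaced n
        ((measurable_vandermonde_div n).mul (hF.comp measurable_snd)))

/-! ## The law of the pattern of a Haar distributed Hermitian matrix -/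

/-- A pattern of depth `n + 1` from a pattern of depth `n` and a top level. -/
def Pattern.snoc {n : ℕ} (y : Pattern n) (z : Fin (n + 1) → ℝ) : Pattern (n + 1) := fun i =>
  Fin.lastCases (motive := fun i : Fin (n + 1) => Fin ((i : ℕ) + 1) → ℝ) z y i

@[simp] theorem Pattern.snoc_last {n : ℕ} (y : Pattern n) (z : Fin (n + 1) → ℝ) :
    Pattern.snoc y z (Fin.last n) = z := by
  simp [Pattern.snoc]

@[simp] theorem Pattern.snoc_castSucc {n : ℕ} (y : Pattern n) (z : Fin (n + 1) → ℝ) (i : Fin n) :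
    Pattern.snoc y z i.castSucc = y i := by
  simp [Pattern.snoc]

/-- A pattern of depth `n + 1` consists of a pattern of depth `n` and a top level. -/
def patternEquiv (n : ℕ) : Pattern n × (Fin (n + 1) → ℝ) ≃ᵐ Pattern (n + 1) where
  toFun p := Pattern.snoc p.1 p.2
  invFun y := (fun i => y i.castSucc, y (Fin.last n))
  left_inv p := by
    refine Prod.ext (funext fun i => ?_) ?_
    · exact Pattern.snoc_castSucc _ _ _
    · exact Pattern.snoc_last _ _
  right_inv y := by
    funext i
    refine Fin.lastCases ?_ (fun i => ?_) i
    · exact Pattern.snoc_last _ _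
    · exact Pattern.snoc_castSucc _ _ _
  measurable_toFun := by
    refine measurable_pi_iff.2 fun i => ?_
    refine Fin.lastCases ?_ (fun i => ?_) i
    · simpa using measurable_snd
    · have h : Measurable fun p : Pattern n × (Fin (n + 1) → ℝ) => p.1 i :=
        (measurable_pi_apply i).comp measurable_fst
      simpa using h
  measurable_invFun := by
    refine Measurable.prodMk (measurable_pi_iff.2 fun i => ?_) ?_
    · exact measurable_pi_apply _
    · exact measurable_pi_apply _

theorem measurePreserving_patternEquiv (n : ℕ) :
    MeasurePreserving (patternEquiv n)
      ((volume : Measure (Pattern n)).prod (volume : Measure (Fin (n + 1) → ℝ))) volume := by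
  refine ⟨(patternEquiv n).measurable, ?_⟩
  symm
  rw [volume_pi]
  refine Measure.pi_eq fun s hs => ?_
  have h : patternEquiv n ⁻¹' Set.univ.pi s =
      (Set.univ.pi fun i : Fin n => s i.castSucc) ×ˢ s (Fin.last n) := by
    ext p
    constructor
    · intro hp
      refine ⟨fun i _ => ?_, ?_⟩
      · have := hp i.castSucc trivial
        rwa [show patternEquiv n p i.castSucc = p.1 i from Pattern.snoc_castSucc _ _ _] at this
      · have := hp (Fin.last n) trivial
        rwa [show patternEquiv n p (Fin.last n) = p.2 from Pattern.snoc_last _ _] at this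
    · rintro ⟨h1, h2⟩ i -
      refine Fin.lastCases ?_ (fun i => ?_) i
      · rw [show patternEquiv n p (Fin.last n) = p.2 from Pattern.snoc_last _ _]; exact h2
      · rw [show patternEquiv n p i.castSucc = p.1 i from Pattern.snoc_castSucc _ _ _]
        exact h1 i trivial
  rw [Measure.map_apply (patternEquiv n).measurable (MeasurableSet.univ_pi hs), h,
    Measure.prod_prod, Fin.prod_univ_castSucc]
  congr 1
  exact Measure.pi_pi _ _

/-- The top level of a pattern, empty at depth `0`. -/
def Pattern.top : {n : ℕ} → Pattern n → Fin n → ℝ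
  | 0, _ => Fin.elim0
  | n + 1, y => y (Fin.last n)

theorem measurable_top : {n : ℕ} → Measurable (Pattern.top (n := n))
  | 0 => measurable_const
  | n + 1 => measurable_pi_apply (Fin.last n)

theorem mem_gtPatterns_snoc {n : ℕ} (y : Pattern n) (z : Fin (n + 1) → ℝ) :
    Pattern.snoc y z ∈ gtPatterns (n + 1) ↔ y ∈ gtPatterns n ∧ Interlaced y.top z := by
  have e : ∀ (i : ℕ) (h : i < n) (h' : i < n + 1),
      (Pattern.snoc y z ⟨i, h'⟩ : Fin (i + 1) → ℝ) = y ⟨i, h⟩ := fun i h h' =>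
    Pattern.snoc_castSucc y z ⟨i, h⟩
  have e' : ∀ h : n < n + 1, (Pattern.snoc y z ⟨n, h⟩ : Fin (n + 1) → ℝ) = z := fun h =>
    Pattern.snoc_last y z
  constructor
  · rintro ⟨h1, h2⟩
    refine ⟨⟨fun i => ?_, fun i h => ?_⟩, ?_⟩
    · have := h1 i.castSucc
      rwa [Pattern.snoc_castSucc] at this
    · have := h2 i (by omega)
      rwa [e i (by omega), e (i + 1) h] at this
    · obtain _ | n := n
      · exact fun k => k.elim0
      · have := h2 n (by omega)
        rwa [e n (by omega), e'] at this
  · rintro ⟨⟨h1, h2⟩, h3⟩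
    refine ⟨fun i => ?_, fun i h => ?_⟩
    · refine Fin.lastCases ?_ (fun i => ?_) i
      · rw [Pattern.snoc_last]; exact h3.antitone
      · rw [Pattern.snoc_castSucc]; exact h1 i
    · rcases Nat.lt_or_ge (i + 1) n with hi | hi
      · rw [e i (by omega), e (i + 1) hi]; exact h2 i hi
      · obtain rfl : n = i + 1 := by omega
        rw [e i (by omega), e']; exact h3

/-- Patterns of depth `n` with a further level. -/
def extendedPatterns (n : ℕ) : Set (Pattern n × (Fin (n + 1) → ℝ)) :=
  {p | p.1 ∈ gtPatterns n ∧ Interlaced p.1.top p.2}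

theorem patternEquiv_preimage_gtPatterns (n : ℕ) :
    patternEquiv n ⁻¹' gtPatterns (n + 1) = extendedPatterns n :=
  Set.ext fun p => mem_gtPatterns_snoc p.1 p.2

theorem measurableSet_extendedPatterns (n : ℕ) (h : MeasurableSet (gtPatterns n)) :
    MeasurableSet (extendedPatterns n) :=
  (h.preimage measurable_fst).inter ((measurableSet_interlaced n).preimage
    ((measurable_top.comp measurable_fst).prodMk measurable_snd))

theorem measurableSet_gtPatterns (n : ℕ) : MeasurableSet (gtPatterns n) := by
  induction n with
  | zero =>
    have h2 : gtPatterns 0 = Set.univ :=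
      Set.eq_univ_of_forall fun y => ⟨fun i => i.elim0, fun i h => by omega⟩
    rw [h2]; exact MeasurableSet.univ
  | succ n ih =>
    rw [← (patternEquiv n).measurableSet_preimage, patternEquiv_preimage_gtPatterns]
    exact measurableSet_extendedPatterns n ih

theorem antitone_top {n : ℕ} {y : Pattern n} (h : y ∈ gtPatterns n) : Antitone y.top := by
  obtain _ | n := n
  · exact fun i => i.elim0
  · exact h.1 (Fin.last n)

theorem ae_injective_top (n : ℕ) : ∀ᵐ y : Pattern n, Function.Injective y.top := by
  rcases n with _ | n
  · exact Filter.Eventually.of_forall fun y i => i.elim0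
  · have := (Measure.quasiMeasurePreserving_eval
      (fun i : Fin (n + 1) => (volume : Measure (Fin ((i : ℕ) + 1) → ℝ))) (Fin.last n)).ae
      (ae_injective (n + 1))
    exact this

/-- The pattern of a Hermitian matrix. -/
def Herm.minors {n : ℕ} (H : Herm n) : Pattern n := minorEigenvalues H.isHermitian

theorem Herm.minors_succ {n : ℕ} (H : Herm (n + 1)) :
    H.minors = Pattern.snoc H.minor.minors H.eig := by
  funext i
  refine Fin.lastCases ?_ (fun i => ?_) i
  · rw [Pattern.snoc_last]; rfl
  · rw [Pattern.snoc_castSucc]; rfl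

theorem Herm.top_minors : {n : ℕ} → (H : Herm n) → H.minors.top = H.eig
  | 0, _ => funext fun i => i.elim0
  | _ + 1, _ => rfl

/-- The upper left corner of size `r`. -/
def Herm.corner {n r : ℕ} (h : r ≤ n) (H : Herm n) : Herm r :=
  ⟨H.1.submatrix (Fin.castLE h) (Fin.castLE h), H.isHermitian.submatrix _⟩

theorem measurable_corner {n r : ℕ} (h : r ≤ n) : Measurable (Herm.corner h) :=
  (Continuous.subtype_mk (continuous_subtype_val.matrix_submatrix _ _) _ :
    Continuous (Herm.corner h)).measurable

theorem Herm.minors_apply {n : ℕ} (H : Herm n) (i : Fin n) :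
    H.minors i = (Herm.corner i.isLt H).eig := rfl

theorem measurable_herm_minors {n : ℕ} : Measurable (Herm.minors (n := n)) := by
  refine measurable_pi_iff.2 fun i => ?_
  simp only [Herm.minors_apply]
  exact measurable_eig.comp (measurable_corner i.isLt)

/-- Induction on the size: the Vandermonde weight of the smaller pattern cancels the denominator of
the conditional density `Δ(z) / Δ(y)` of the next spectrum. -/
theorem lintegral_minors (n : ℕ) : ∃ c : ℝ≥0∞, c ≠ 0 ∧ c ≠ ∞ ∧
    ∀ F : Pattern n → ℝ≥0∞, Measurable F → ∫⁻ H, F H.minors ∂(hermMeasure n) =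
      c * ∫⁻ y in gtPatterns n, ENNReal.ofReal (vandermonde y.top) * F y := by
  induction n with
  | zero =>
    refine ⟨hermMeasure 0 Set.univ, IsOpen.measure_ne_zero _ isOpen_univ Set.univ_nonempty, ?_,
      fun F hF => ?_⟩
    · have : Subsingleton (Herm 0) := ⟨fun A B => Subtype.ext (Subsingleton.elim _ _)⟩
      exact (Set.subsingleton_univ.finite.isCompact).measure_ne_top
    · have h1 : ∀ y : Pattern 0, y = fun i => i.elim0 := fun y => funext fun i => i.elim0
      have h2 : gtPatterns 0 = Set.univ :=
        Set.eq_univ_of_forall fun y => ⟨fun i => i.elim0, fun i h => by omega⟩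
      have h3 : ∀ y : Pattern 0, vandermonde y.top = 1 := fun y => by simp [vandermonde]
      rw [h2, Measure.restrict_univ]
      rw [lintegral_congr fun H : Herm 0 => congrArg F (h1 H.minors), lintegral_const, mul_comm]
      rw [lintegral_congr fun y => (by rw [h1 y, h3] :
        ENNReal.ofReal (vandermonde y.top) * F y = ENNReal.ofReal 1 * F fun i => i.elim0)]
      simp [volume_pi]
  | succ n ih =>
    obtain ⟨c, hc0, hc1, hc⟩ := lintegral_minor_eig n (eigenvalueDensity n).ae_strictAnti
    obtain ⟨C, hC0, hC1, hC⟩ := ih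
    refine ⟨c * C, mul_ne_zero hc0 hC0, ENNReal.mul_ne_top hc1 hC1, fun F hF => ?_⟩
    have hFs : Measurable fun p : Pattern n × (Fin (n + 1) → ℝ) => F (Pattern.snoc p.1 p.2) :=
      hF.comp (patternEquiv n).measurable
    have h1 := hc (fun H z => F (Pattern.snoc H.minors z))
      (hFs.comp ((measurable_herm_minors.comp measurable_fst).prodMk measurable_snd))
    simp only [← Herm.minors_succ] at h1
    rw [h1, mul_assoc]
    congr 1
    have hFt : Measurable fun p : Pattern n × (Fin (n + 1) → ℝ) =>
        ENNReal.ofReal (vandermonde p.2) * F (Pattern.snoc p.1 p.2) :=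
      ((measurable_vandermonde _).comp measurable_snd).ennreal_ofReal.mul hFs
    set G : Pattern n × (Fin (n + 1) → ℝ) → ℝ≥0∞ := fun p =>
      {p : Pattern n × (Fin (n + 1) → ℝ) | Interlaced p.1.top p.2}.indicator
        (fun p => ENNReal.ofReal (vandermonde p.2 / vandermonde p.1.top) *
          F (Pattern.snoc p.1 p.2)) p with hG
    have hmi : MeasurableSet {p : Pattern n × (Fin (n + 1) → ℝ) | Interlaced p.1.top p.2} :=
      (measurableSet_interlaced n).preimage
        ((measurable_top.comp measurable_fst).prodMk measurable_snd)
    have hGm : Measurable G := by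
      refine Measurable.indicator ?_ hmi
      exact ((measurable_vandermonde_div n).comp
        ((measurable_top.comp measurable_fst).prodMk measurable_snd)).mul hFs
    have h2 : ∀ H : Herm n, ∫⁻ z in {z | Interlaced H.eig z},
        ENNReal.ofReal (vandermonde z / vandermonde H.eig) * F (Pattern.snoc H.minors z) =
        ∫⁻ z, G (H.minors, z) := fun H => by
      rw [← Herm.top_minors, setLIntegral_interlaced_eq]
      rfl
    simp only [h2]
    rw [hC (fun y => ∫⁻ z, G (y, z)) hGm.lintegral_prod_right']
    congr 1
    have hgm := measurableSet_gtPatterns n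
    have hFv : Measurable fun y : Pattern (n + 1) => ENNReal.ofReal (vandermonde y.top) * F y :=
      ((measurable_vandermonde _).comp measurable_top).ennreal_ofReal.mul hF
    have hem := measurableSet_extendedPatterns n hgm
    have h3 := (measurePreserving_patternEquiv n).setLIntegral_comp_preimage
      (measurableSet_gtPatterns (n + 1)) hFv
    have hFe : Measurable fun p => ENNReal.ofReal (vandermonde (patternEquiv n p).top) *
      F (patternEquiv n p) := hFv.comp (patternEquiv n).measurable
    rw [patternEquiv_preimage_gtPatterns, ← lintegral_indicator hem,
      lintegral_prod _ (hFe.indicator hem).aemeasurable] at h3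
    rw [← h3, ← lintegral_indicator hgm]
    refine lintegral_congr_ae ?_
    filter_upwards [ae_injective_top n] with y hy
    by_cases hyg : y ∈ gtPatterns n
    · have hpos := vandermonde_pos ((antitone_top hyg).strictAnti_of_injective hy)
      rw [Set.indicator_of_mem hyg, ← lintegral_const_mul' _ _ ENNReal.ofReal_ne_top]
      refine lintegral_congr fun z => ?_
      by_cases h : Interlaced y.top z
      · rw [hG, Set.indicator_of_mem (show (y, z) ∈ extendedPatterns n from ⟨hyg, h⟩)]
        simp only
        rw [Set.indicator_of_mem (show (y, z) ∈ {p : Pattern n × (Fin (n + 1) → ℝ) |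
          Interlaced p.1.top p.2} from h), ← mul_assoc, ← ENNReal.ofReal_mul hpos.le,
          mul_div_cancel₀ _ hpos.ne']
        congr 3
        exact (Pattern.snoc_last y z).symm
      · rw [hG, Set.indicator_of_notMem (show (y, z) ∉ extendedPatterns n from fun h' => h h'.2)]
        simp only
        rw [Set.indicator_of_notMem (show (y, z) ∉ {p : Pattern n × (Fin (n + 1) → ℝ) |
          Interlaced p.1.top p.2} from h), mul_zero]
    · rw [Set.indicator_of_notMem hyg]
      refine ((lintegral_congr fun z => ?_).trans lintegral_zero).symm
      exact Set.indicator_of_notMem (fun h' => hyg h'.1) _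

section

/-! ## The law of the eigenvalue minor process -/

/-- The weight `∏ e^{-V(y_i)}`. -/
def expWeight (V : ℝ → ℝ) {n : ℕ} (y : Fin n → ℝ) : ℝ≥0∞ :=
  ENNReal.ofReal (∏ i, Real.exp (-V (y i)))

theorem measurable_expWeight {V : ℝ → ℝ} (hV : Continuous V) (n : ℕ) :
    Measurable (expWeight V (n := n)) := by
  have : Continuous fun y : Fin n → ℝ => ∏ i, Real.exp (-V (y i)) := by fun_prop
  exact this.measurable.ennreal_ofReal

theorem lintegral_eigenvalueMeasure {V : ℝ → ℝ} (hV : Continuous V) (n : ℕ)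
    {F : (Fin n → ℝ) → ℝ≥0∞} (hF : Measurable F) : ∫⁻ y, F y ∂(eigenvalueMeasure V n) =
      ∫⁻ y in {y | Antitone y}, ENNReal.ofReal (vandermonde y ^ 2) * (expWeight V y * F y) := by
  have hm : Measurable fun y : Fin n → ℝ =>
      ENNReal.ofReal (vandermonde y ^ 2 * ∏ i, Real.exp (-V (y i))) := by
    have h1 : Continuous fun y : Fin n → ℝ => ∏ i, Real.exp (-V (y i)) := by fun_prop
    exact (((measurable_vandermonde n).pow_const 2).mul h1.measurable).ennreal_ofReal
  rw [eigenvalueMeasure, lintegral_withDensity_eq_lintegral_mul _ hm hF]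
  refine lintegral_congr fun y => ?_
  rw [Pi.mul_apply, ENNReal.ofReal_mul (sq_nonneg _), mul_assoc]
  rfl

theorem lintegral_patternMeasure {V : ℝ → ℝ} (hV : Continuous V) (n : ℕ) (hn : 0 < n)
    {F : Pattern n → ℝ≥0∞} (hF : Measurable F) : ∫⁻ y, F y ∂(patternMeasure V n hn) =
      ∫⁻ y in gtPatterns n, ENNReal.ofReal (vandermonde y.top) * (expWeight V y.top * F y) := by
  obtain _ | n := n
  · exact absurd hn (lt_irrefl _)
  have hm : Measurable fun y : Pattern (n + 1) =>
      ENNReal.ofReal (vandermonde y.top * ∏ i, Real.exp (-V (y.top i))) := by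
    have h1 : Continuous fun y : Fin (n + 1) → ℝ => ∏ i, Real.exp (-V (y i)) := by fun_prop
    exact (((measurable_vandermonde (n + 1)).comp measurable_top).mul
      (h1.measurable.comp measurable_top)).ennreal_ofReal
  have e : patternMeasure V (n + 1) hn =
      ((volume : Measure (Pattern (n + 1))).restrict (gtPatterns (n + 1))).withDensity
        fun y : Pattern (n + 1) =>
          ENNReal.ofReal (vandermonde y.top * ∏ i, Real.exp (-V (y.top i))) := rfl
  rw [e, lintegral_withDensity_eq_lintegral_mul _ hm hF]
  refine lintegral_congr fun y => ?_
  rw [Pi.mul_apply, ENNReal.ofReal_mul' (Finset.prod_nonneg fun _ _ => (Real.exp_pos _).le),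
    mul_assoc]
  rfl

theorem measurableEmbedding_herm (n : ℕ) :
    MeasurableEmbedding (Subtype.val : Herm n → Matrix (Fin n) (Fin n) ℂ) :=
  MeasurableEmbedding.subtype_coe (isClosed_herm n).measurableSet

variable {Ω : Type*} [MeasurableSpace Ω] {P : Measure Ω} {V : ℝ → ℝ} {n : ℕ}
  {A : Ω → Matrix (Fin n) (Fin n) ℂ}

/-- The random matrix as a random element of the space of Hermitian matrices. -/
def IsUnitaryInvariantEnsemble.toHerm (hA : IsUnitaryInvariantEnsemble P V A) (ω : Ω) : Herm n :=
  ⟨A ω, hA.hermitian ω⟩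

theorem IsUnitaryInvariantEnsemble.measurable_toHerm (hA : IsUnitaryInvariantEnsemble P V A) :
    Measurable hA.toHerm :=
  hA.measurable.subtype_mk

theorem measurable_herm_conj {n : ℕ} (U : Matrix (Fin n) (Fin n) ℂ) : Measurable (Herm.conj U) :=
  (continuous_conj.comp (continuous_const.prodMk continuous_id)).measurable

theorem IsUnitaryInvariantEnsemble.map_conj (hA : IsUnitaryInvariantEnsemble P V A)
    {U : Matrix (Fin n) (Fin n) ℂ} (hU : U ∈ Matrix.unitaryGroup (Fin n) ℂ) :
    (P.map hA.toHerm).map (Herm.conj U) = P.map hA.toHerm := by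
  have he := measurableEmbedding_herm n
  -- `Herm.conj U` is `H ↦ Uᴴ H U`, so invariance is applied to `Uᴴ`.
  have h := hA.invariant (star U) (Unitary.star_mem hU)
  have key : ((P.map hA.toHerm).map (Herm.conj U)).map Subtype.val =
      (P.map hA.toHerm).map Subtype.val := by
    rw [Measure.map_map (measurable_herm_conj U) hA.measurable_toHerm,
      Measure.map_map he.measurable ((measurable_herm_conj U).comp hA.measurable_toHerm),
      Measure.map_map he.measurable hA.measurable_toHerm]
    convert h using 2
    swap
    · rfl
    funext ω
    simp only [Function.comp_apply, Herm.coe_conj, Matrix.star_eq_conjTranspose,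
      Matrix.conjTranspose_conjTranspose]
    rfl
  rw [← he.comap_map ((P.map hA.toHerm).map (Herm.conj U)), key, he.comap_map]

theorem map_conj_withDensity_eig (hV : Continuous V) {U : Matrix (Fin n) (Fin n) ℂ}
    (hU : U ∈ Matrix.unitaryGroup (Fin n) ℂ) :
    ((hermMeasure n).withDensity fun H => expWeight V H.eig).map (Herm.conj U) =
      (hermMeasure n).withDensity fun H => expWeight V H.eig := by
  have hm : Measurable fun H : Herm n => expWeight V H.eig :=
    (measurable_expWeight hV n).comp measurable_eig
  have hc := measurable_herm_conj U
  ext s hs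
  rw [Measure.map_apply hc hs, withDensity_apply _ (hc hs), withDensity_apply _ hs]
  have h : MeasurePreserving (Herm.conj U) (hermMeasure n) (hermMeasure n) :=
    ⟨hc, map_conj_hermMeasure hU⟩
  rw [← h.setLIntegral_comp_preimage hs hm]
  simp only [Herm.eig_conj hU]

/-- The law of a unitary invariant ensemble has density proportional to `e^{-tr V(H)}`. -/
theorem IsUnitaryInvariantEnsemble.exists_map_toHerm_eq [IsProbabilityMeasure P]
    (hV : Continuous V) (hA : IsUnitaryInvariantEnsemble P V A) :
    ∃ k : ℝ≥0∞, k ≠ 0 ∧ k ≠ ∞ ∧ P.map hA.toHerm =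
      k • (hermMeasure n).withDensity fun H => expWeight V H.eig := by
  set R := (hermMeasure n).withDensity fun H => expWeight V H.eig with hR
  set Q := P.map hA.toHerm with hQ
  have hQp : IsProbabilityMeasure Q := Measure.isProbabilityMeasure_map hA.measurable_toHerm.aemeasurable
  have hm : Measurable fun H : Herm n => expWeight V H.eig :=
    (measurable_expWeight hV n).comp measurable_eig
  obtain ⟨Z, hZ, hlaw⟩ := hA.eigenvalue_law
  have hQe : Q.map Herm.eig = ENNReal.ofReal Z⁻¹ • eigenvalueMeasure V n := by
    rw [hQ, Measure.map_map measurable_eig hA.measurable_toHerm, ← hlaw]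
    rfl
  obtain ⟨c, hc0, hc1, hc⟩ := eigenvalueDensity n
  have hRe : R.map Herm.eig = c • eigenvalueMeasure V n := by
    refine Measure.ext_of_lintegral _ fun F hF => ?_
    have hFe : Measurable fun H : Herm n => F H.eig := hF.comp measurable_eig
    rw [lintegral_map hF measurable_eig, hR,
      lintegral_withDensity_eq_lintegral_mul _ hm hFe,
      lintegral_smul_measure, lintegral_eigenvalueMeasure hV n hF, smul_eq_mul]
    exact hc (fun y => expWeight V y * F y) ((measurable_expWeight hV n).mul hF)
  -- The eigenvalue laws of `Q` and `R` are `Z⁻¹` and `c` times the same measure; this factor makes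
  -- them agree.
  set k := ENNReal.ofReal Z⁻¹ * c⁻¹ with hk
  have hk0 : k ≠ 0 := mul_ne_zero (by simpa using hZ) (by simpa using hc1)
  have hk1 : k ≠ ∞ := ENNReal.mul_ne_top ENNReal.ofReal_ne_top (by simpa using hc0)
  have hkR : (k • R).map Herm.eig = Q.map Herm.eig := by
    rw [Measure.map_smul, hRe, hQe, smul_smul, hk, mul_assoc, ENNReal.inv_mul_cancel hc0 hc1,
      mul_one]
  -- The total mass of `k • R` is that of its eigenvalue law, which is the eigenvalue law of a
  -- probability measure.
  have hfin : IsFiniteMeasure (k • R) := ⟨by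
    have h1 := congrArg (fun μ => μ Set.univ) hkR
    simp only [Measure.map_apply measurable_eig MeasurableSet.univ, Set.preimage_univ] at h1
    rw [h1]
    exact measure_lt_top _ _⟩
  refine ⟨k, hk0, hk1, measure_eq_of_map_eig_eq Q (k • R) (fun U hU => hA.map_conj hU)
    (fun U hU => ?_) hkR.symm⟩
  rw [Measure.map_smul, hR, map_conj_withDensity_eig hV hU]

theorem IsUnitaryInvariantEnsemble.measurable_minors (hA : IsUnitaryInvariantEnsemble P V A) :
    Measurable fun ω => minorEigenvalues (hA.hermitian ω) :=
  by
  have h : Measurable (Herm.minors ∘ hA.toHerm) :=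
    measurable_herm_minors.comp hA.measurable_toHerm
  exact h

/-- The law of the eigenvalue minor process. -/
theorem IsUnitaryInvariantEnsemble.exists_map_minorEigenvalues_eq [IsProbabilityMeasure P]
    (hn : 0 < n) (hV : Continuous V) (hA : IsUnitaryInvariantEnsemble P V A) :
    ∃ Z : ℝ, 0 < Z ∧ P.map (fun ω => minorEigenvalues (hA.hermitian ω)) =
      ENNReal.ofReal Z⁻¹ • patternMeasure V n hn := by
  obtain ⟨k, hk0, hk1, hk⟩ := hA.exists_map_toHerm_eq hV
  obtain ⟨c, hc0, hc1, hc⟩ := lintegral_minors n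
  have hkc0 : k * c ≠ 0 := mul_ne_zero hk0 hc0
  have hkc1 : k * c ≠ ∞ := ENNReal.mul_ne_top hk1 hc1
  have hm : Measurable fun H : Herm n => expWeight V H.eig :=
    (measurable_expWeight hV n).comp measurable_eig
  refine ⟨(k * c).toReal⁻¹, inv_pos.2 (ENNReal.toReal_pos hkc0 hkc1), ?_⟩
  rw [inv_inv, ENNReal.ofReal_toReal hkc1]
  refine Measure.ext_of_lintegral _ fun F hF => ?_
  have h1 : P.map (fun ω => minorEigenvalues (hA.hermitian ω)) =
      (P.map hA.toHerm).map Herm.minors :=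
    (Measure.map_map measurable_herm_minors hA.measurable_toHerm).symm
  have hFm : Measurable fun H : Herm n => F H.minors := hF.comp measurable_herm_minors
  rw [h1, lintegral_map hF measurable_herm_minors, hk, lintegral_smul_measure,
    lintegral_withDensity_eq_lintegral_mul _ hm hFm,
    lintegral_smul_measure, lintegral_patternMeasure hV n hn hF, smul_eq_mul, smul_eq_mul, mul_assoc,
    ← hc (fun y => expWeight V y.top * F y)
      (((measurable_expWeight hV n).comp measurable_top).mul hF)]
  simp only [Herm.top_minors]
  rfl

end

section

/-! ## Orthogonal polynomials -/

section

variable {V : ℝ → ℝ} {ψ : ℕ → ℝ[X]} {c : ℕ → ℝ}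

theorem IsMonicOrthogonal.eq_one (hψ : IsMonicOrthogonal V ψ c) : ψ 0 = 1 :=
  (hψ.monic 0).natDegree_eq_zero.1 (hψ.natDegree 0)

/-- A property of polynomials that is stable under linear combinations and holds for `ψ_j`,
`j < n`, holds for all polynomials of degree less than `n`. -/
theorem IsMonicOrthogonal.induction (hψ : IsMonicOrthogonal V ψ c) {M : ℝ[X] → Prop} (n : ℕ)
    (h0 : M 0) (hadd : ∀ p q, M p → M q → M (p + q)) (hsmul : ∀ (a : ℝ) p, M p → M (C a * p))
    (h : ∀ j < n, M (ψ j)) : ∀ q : ℝ[X], q.degree < n → M q := by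
  induction n with
  | zero =>
    intro q hq
    rwa [degree_lt_iff_coeff_zero q 0 |>.1 (by exact_mod_cast hq) |> fun h => (Polynomial.ext
      (fun m => by simpa using h m (Nat.zero_le m)) : q = 0)]
  | succ n ih =>
    intro q hq
    have e : q = (q - C (q.coeff n) * ψ n) + C (q.coeff n) * ψ n := by ring
    rw [e]
    refine hadd _ _ (ih (fun j hj => h j (hj.trans n.lt_succ_self)) _ ?_)
      (hsmul _ _ (h n n.lt_succ_self))
    rw [degree_lt_iff_coeff_zero] at hq ⊢
    intro m hm
    rw [coeff_sub, coeff_C_mul]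
    rcases hm.eq_or_lt with rfl | hm
    · have : (ψ n).coeff n = 1 := by
        have := (hψ.monic n).coeff_natDegree
        rwa [hψ.natDegree n] at this
      rw [this, mul_one, sub_self]
    · have : (ψ n).coeff m = 0 := coeff_eq_zero_of_natDegree_lt (by rwa [hψ.natDegree n])
      rw [hq m hm, this, mul_zero, sub_zero]

theorem IsMonicOrthogonal.integrable_eval (hψ : IsMonicOrthogonal V ψ c) (p : ℝ[X]) :
    Integrable fun x => p.eval x * Real.exp (-V x) := by
  refine hψ.induction (M := fun p => Integrable fun x => p.eval x * Real.exp (-V x))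
    (p.natDegree + 1) ?_ ?_ ?_ ?_ p (by
      exact_mod_cast degree_le_natDegree.trans_lt (WithBot.coe_lt_coe.2 (Nat.lt_succ_self _)))
  · simp
  · intro p q hp hq
    simp only [eval_add, add_mul]
    exact hp.add hq
  · intro a p hp
    simp only [eval_mul, eval_C, mul_assoc]
    exact hp.const_mul a
  · intro j _
    simpa [hψ.eq_one] using hψ.integrable 0 j

/-- The moment functional `p ↦ ∫ p e^{-V}`. -/
def IsMonicOrthogonal.moment (hψ : IsMonicOrthogonal V ψ c) : ℝ[X] →ₗ[ℝ] ℝ where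
  toFun p := ∫ x, p.eval x * Real.exp (-V x)
  map_add' p q := by
    simp only [eval_add, add_mul]
    exact integral_add (hψ.integrable_eval p) (hψ.integrable_eval q)
  map_smul' a p := by
    simp only [eval_smul, smul_eq_mul, mul_assoc, RingHom.id_apply]
    exact integral_const_mul _ _

theorem IsMonicOrthogonal.moment_apply (hψ : IsMonicOrthogonal V ψ c) (p : ℝ[X]) :
    hψ.moment p = ∫ x, p.eval x * Real.exp (-V x) := rfl

theorem IsMonicOrthogonal.moment_mul (hψ : IsMonicOrthogonal V ψ c) (i j : ℕ) :
    hψ.moment (ψ i * ψ j) = if i = j then c j ^ 2 else 0 := by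
  rw [hψ.moment_apply]
  simp only [eval_mul]
  rw [hψ.orthogonal]
  split_ifs with h
  · rw [h, sq]
  · rfl

/-- Otherwise `ψ_j² e^{-V}` would vanish almost everywhere, although a monic polynomial has only
finitely many roots. -/
theorem IsMonicOrthogonal.ne_zero (hψ : IsMonicOrthogonal V ψ c) (j : ℕ) : c j ≠ 0 := by
  intro hc
  have h := hψ.moment_mul j j
  rw [if_pos rfl, hc, zero_pow two_ne_zero, hψ.moment_apply] at h
  have h0 : 0 ≤ fun x => (ψ j * ψ j).eval x * Real.exp (-V x) := fun x => by
    simp only [eval_mul, Pi.zero_apply]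
    exact mul_nonneg (mul_self_nonneg _) (Real.exp_pos _).le
  rw [integral_eq_zero_iff_of_nonneg h0 (hψ.integrable_eval _)] at h
  have hf : ({x | (ψ j).IsRoot x}).Finite := finite_setOfPred_isRoot (hψ.monic j).ne_zero
  have h1 : ∀ᵐ x : ℝ, x ∉ {x | (ψ j).IsRoot x} := hf.countable.ae_notMem volume
  have h2 : ∀ᵐ _ : ℝ, False := by
    filter_upwards [h, h1] with x hx hx'
    simp only [eval_mul, Pi.zero_apply, mul_eq_zero, (Real.exp_pos _).ne', or_false, or_self] at hx
    exact hx' hx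
  have h3 : (volume : Measure ℝ) = 0 := ae_eq_bot.1 (Filter.eventually_false_iff_eq_bot.1 h2)
  have h4 := congrArg (fun μ => μ (Set.Icc (0 : ℝ) 1)) h3
  simp at h4

theorem IsMonicOrthogonal.moment_mul_of_degree_lt (hψ : IsMonicOrthogonal V ψ c) {j : ℕ}
    {q : ℝ[X]} (hq : q.degree < j) : hψ.moment (ψ j * q) = 0 := by
  refine hψ.induction (M := fun q => hψ.moment (ψ j * q) = 0) j ?_ ?_ ?_ ?_ q hq
  · simp
  · intro p q hp hq
    rw [mul_add, map_add, hp, hq, add_zero]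
  · intro a p hp
    rw [mul_left_comm, ← smul_eq_C_mul, map_smul, hp, smul_zero]
  · intro i hi
    rw [hψ.moment_mul, if_neg hi.ne']

end

/-- The polynomial `κ` with `∫ κ q e^{-V} = q^{(b)}(v)` for `deg q < n`. -/
def reproducing (ψ : ℕ → ℝ[X]) (c : ℕ → ℝ) (n b : ℕ) (v : ℝ) : ℝ[X] :=
  ∑ j ∈ Finset.range n, C ((c j ^ 2)⁻¹ * (derivative^[b] (ψ j)).eval v) * ψ j

/-- The normalised power `(X - v)^k / k!`. -/
def normPow (v : ℝ) (k : ℕ) : ℝ[X] := C ((k.factorial : ℝ)⁻¹) * (X - C v) ^ k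

theorem eval_normPow (v : ℝ) (k : ℕ) (x : ℝ) :
    (normPow v k).eval x = (x - v) ^ k / (k.factorial : ℝ) := by
  simp [normPow, div_eq_inv_mul]

theorem degree_normPow_lt (v : ℝ) {k n : ℕ} (h : k < n) : (normPow v k).degree < n := by
  rw [normPow, degree_C_mul (inv_ne_zero (Nat.cast_ne_zero.2 k.factorial_ne_zero)),
    degree_pow, degree_X_sub_C]
  simpa using h

theorem eval_iterate_derivative_normPow (v : ℝ) (k d : ℕ) :
    (derivative^[d] (normPow v k)).eval v = if k = d then 1 else 0 := by
  have h1 : (k.factorial : ℝ) ≠ 0 := Nat.cast_ne_zero.2 k.factorial_ne_zero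
  rw [normPow, iterate_derivative_C_mul, iterate_derivative_X_sub_pow]
  rcases lt_trichotomy k d with h | h | h
  · simp [Nat.descFactorial_eq_zero_iff_lt.2 h, h.ne]
  · subst h
    simp [h1, Nat.descFactorial_self]
  · have : k - d ≠ 0 := by omega
    simp [h.ne', this]

theorem eq_sum_normPow (v : ℝ) {q : ℝ[X]} {m : ℕ} (hq : q.degree < m) :
    q = ∑ k ∈ Finset.range m, C ((derivative^[k] q).eval v) * normPow v k := by
  have hk : ∀ k, (taylor v q).coeff k = (derivative^[k] q).eval v * ((k.factorial : ℝ)⁻¹) := by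
    intro k
    have h1 : (k.factorial : ℝ) ≠ 0 := Nat.cast_ne_zero.2 k.factorial_ne_zero
    rw [taylor_coeff, ← factorial_smul_hasseDeriv]
    rw [LinearMap.smul_apply, eval_smul, nsmul_eq_mul]
    field_simp
  by_cases h0 : q = 0
  · simp [h0]
  have h := sum_taylor_eq q v
  rw [sum_over_range' _ (by simp) m] at h
  · rw [← h]
    refine Finset.sum_congr rfl fun k _ => ?_
    rw [h, hk, normPow, C_mul, mul_assoc]
  · rw [natDegree_taylor]
    exact (natDegree_lt_iff_degree_lt h0).2 hq

section

variable {V : ℝ → ℝ} {ψ : ℕ → ℝ[X]} {c : ℕ → ℝ}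

/-- By linearity it suffices to test on `ψ_i` with `i < n`, where orthogonality leaves a single
term. -/
theorem IsMonicOrthogonal.moment_reproducing (hψ : IsMonicOrthogonal V ψ c) {n : ℕ} (b : ℕ)
    (v : ℝ) {q : ℝ[X]} (hq : q.degree < n) :
    hψ.moment (reproducing ψ c n b v * q) = (derivative^[b] q).eval v := by
  refine hψ.induction (M := fun q => hψ.moment (reproducing ψ c n b v * q) =
    (derivative^[b] q).eval v) n ?_ ?_ ?_ ?_ q hq
  · simp
  · intro p q hp hq
    rw [mul_add, map_add, hp, hq, iterate_map_add, eval_add]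
  · intro a p hp
    rw [mul_left_comm, ← smul_eq_C_mul, map_smul, hp, iterate_derivative_C_mul,
      eval_mul, eval_C, smul_eq_mul]
  · intro i hi
    rw [reproducing, Finset.sum_mul, map_sum, Finset.sum_eq_single i]
    · rw [mul_assoc, ← smul_eq_C_mul, map_smul, hψ.moment_mul, if_pos rfl, smul_eq_mul]
      have := hψ.ne_zero i
      field_simp
    · intro j _ hj
      rw [mul_assoc, ← smul_eq_C_mul, map_smul, hψ.moment_mul, if_neg hj, smul_zero]
    · intro h
      exact absurd (Finset.mem_range.2 hi) h

theorem IsMonicOrthogonal.moment_reproducing_normPow (hψ : IsMonicOrthogonal V ψ c) {n : ℕ}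
    (b : ℕ) (v : ℝ) {k : ℕ} (hk : k < n) :
    hψ.moment (reproducing ψ c n b v * normPow v k) = if k = b then 1 else 0 := by
  rw [hψ.moment_reproducing b v (degree_normPow_lt v hk), eval_iterate_derivative_normPow]

end

end

/-! ## Repeated integration on half-lines -/

theorem hasDerivAt_sub_pow_div_factorial (u v : ℝ) (k : ℕ) :
    HasDerivAt (fun v => (v - u) ^ (k + 1) / ((k + 1).factorial : ℝ))
      ((v - u) ^ k / (k.factorial : ℝ)) v := by
  have h := (((hasDerivAt_id v).sub_const u).pow (k + 1)).div_const ((k + 1).factorial : ℝ)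
  refine h.congr_deriv ?_
  have h1 : (k.factorial : ℝ) ≠ 0 := Nat.cast_ne_zero.2 k.factorial_ne_zero
  rw [Nat.factorial_succ]
  push_cast
  have h2 : (k : ℝ) + 1 ≠ 0 := by positivity
  simp only [id, mul_one]
  field_simp

theorem hasDerivAt_const_sub_pow_div_factorial (x v : ℝ) (k : ℕ) :
    HasDerivAt (fun v => (x - v) ^ (k + 1) / ((k + 1).factorial : ℝ))
      (-((x - v) ^ k / (k.factorial : ℝ))) v := by
  have h := ((((hasDerivAt_id v).const_sub x)).pow (k + 1)).div_const ((k + 1).factorial : ℝ)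
  refine h.congr_deriv ?_
  have h1 : (k.factorial : ℝ) ≠ 0 := Nat.cast_ne_zero.2 k.factorial_ne_zero
  rw [Nat.factorial_succ]
  push_cast
  have h2 : (k : ℝ) + 1 ≠ 0 := by positivity
  simp only [id]
  field_simp

/-- The beta integral, by induction on `k`: integration by parts moves one power from the left
factor to the right one. -/
theorem intervalIntegral_pow_mul_pow (u x : ℝ) (k b : ℕ) :
    ∫ v in u..x, (v - u) ^ k / (k.factorial : ℝ) * ((x - v) ^ b / (b.factorial : ℝ)) =
      (x - u) ^ (k + b + 1) / ((k + b + 1).factorial : ℝ) := by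
  induction k generalizing b with
  | zero =>
    have h := intervalIntegral.integral_eq_sub_of_hasDerivAt
      (fun v _ => hasDerivAt_const_sub_pow_div_factorial x v b)
      (Continuous.intervalIntegrable (by fun_prop) u x)
    rw [intervalIntegral.integral_neg] at h
    simp only [pow_zero, Nat.factorial_zero, Nat.cast_one, div_one, one_mul, zero_add]
    rw [← neg_inj, h]
    simp
  | succ k ih =>
    have h := intervalIntegral.integral_eq_sub_of_hasDerivAt
      (fun v _ => (hasDerivAt_sub_pow_div_factorial u v k).mul
        (hasDerivAt_const_sub_pow_div_factorial x v b))
      (Continuous.intervalIntegrable (by fun_prop) u x)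
    rw [intervalIntegral.integral_add (Continuous.intervalIntegrable (by fun_prop) u x)
      (Continuous.intervalIntegrable (by fun_prop) u x), ih (b + 1)] at h
    simp only [mul_neg, intervalIntegral.integral_neg, Pi.mul_apply, sub_self, ne_eq,
      Nat.succ_ne_zero, not_false_eq_true, zero_pow, zero_div, mul_zero, zero_mul] at h
    rw [show k + 1 + b + 1 = k + (b + 1) + 1 by ring]
    linarith

theorem integral_Ioo_pow_mul_pow {u x : ℝ} (h : u ≤ x) (k b : ℕ) :
    ∫ v in Set.Ioo u x, (v - u) ^ k / (k.factorial : ℝ) * ((x - v) ^ b / (b.factorial : ℝ)) =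
      (x - u) ^ (k + b + 1) / ((k + b + 1).factorial : ℝ) := by
  rw [← intervalIntegral_pow_mul_pow, intervalIntegral.integral_of_le h,
    integral_Ioc_eq_integral_Ioo]

/-- Fubini on `u < v < x`, with the beta integral over `v` inside. The powers are nonnegative on
this region, so absolute integrability reduces to the hypothesis `hi`. -/
theorem integrableOn_and_integral_Ioi {h : ℝ → ℝ} (hm : Measurable h) (u : ℝ) (k b : ℕ)
    (hi : IntegrableOn (fun x => (x - u) ^ (k + b + 1) * h x) (Set.Ioi u)) :
    IntegrableOn (fun v => (v - u) ^ k / (k.factorial : ℝ) *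
      ∫ x in Set.Ioi v, (x - v) ^ b / (b.factorial : ℝ) * h x) (Set.Ioi u) ∧
    ∫ v in Set.Ioi u, (v - u) ^ k / (k.factorial : ℝ) *
      ∫ x in Set.Ioi v, (x - v) ^ b / (b.factorial : ℝ) * h x =
    ∫ x in Set.Ioi u, (x - u) ^ (k + b + 1) / ((k + b + 1).factorial : ℝ) * h x := by
  set g : ℝ → ℝ → ℝ := fun v x =>
    (v - u) ^ k / (k.factorial : ℝ) * ((x - v) ^ b / (b.factorial : ℝ)) with hg
  set F : ℝ → ℝ → ℝ := fun v x => if v < x then g v x * h x else 0 with hF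
  have hFm : Measurable (Function.uncurry F) := by
    refine Measurable.ite (measurableSet_lt measurable_fst measurable_snd) ?_ measurable_const
    have : Continuous fun p : ℝ × ℝ => g p.1 p.2 := by simp only [hg]; fun_prop
    exact this.measurable.mul (hm.comp measurable_snd)
  have hFv : ∀ x, (fun v => F v x) = (Set.Iio x).indicator fun v => g v x * h x := fun x => by
    funext v
    simp [hF, Set.indicator]
  have hFx : ∀ v, F v = (Set.Ioi v).indicator fun x => g v x * h x := fun v => by
    funext x
    simp [hF, Set.indicator]
  have hset : ∀ x, Set.Ioi u ∩ Set.Iio x = Set.Ioo u x := fun x => Set.Ioi_inter_Iio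
  have hgi : ∀ x, IntegrableOn (fun v => g v x) (Set.Ioo u x) := fun x => by
    refine (Continuous.integrableOn_Icc ?_).mono_set Set.Ioo_subset_Icc_self
    simp only [hg]
    fun_prop
  have hint : Integrable (Function.uncurry F)
      ((volume.restrict (Set.Ioi u)).prod (volume.restrict (Set.Ioi u))) := by
    rw [integrable_prod_iff' hFm.aestronglyMeasurable]
    refine ⟨Filter.Eventually.of_forall fun x => ?_, ?_⟩
    · simp only [Function.uncurry]
      rw [hFv, integrable_indicator_iff measurableSet_Iio, IntegrableOn,
        Measure.restrict_restrict measurableSet_Iio, Set.inter_comm, hset]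
      exact (hgi x).mul_const _
    · refine ((hi.norm).div_const ((k + b + 1).factorial : ℝ)).congr ?_
      filter_upwards [self_mem_ae_restrict measurableSet_Ioi] with x hx
      have e : ∀ v, ‖Function.uncurry F (v, x)‖ =
          (Set.Iio x).indicator (fun v => ‖g v x * h x‖) v := fun v => by
        rw [Function.uncurry, congrFun (hFv x) v, norm_indicator_eq_indicator_norm]
      simp only [e]
      rw [setIntegral_indicator measurableSet_Iio, hset]
      have e2 : ∫ v in Set.Ioo u x, ‖g v x * h x‖ = ∫ v in Set.Ioo u x, g v x * ‖h x‖ := by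
        refine setIntegral_congr_fun measurableSet_Ioo fun v hv => ?_
        have h1 : 0 ≤ v - u := sub_nonneg.2 hv.1.le
        have h2 : 0 ≤ x - v := sub_nonneg.2 hv.2.le
        have h3 : 0 ≤ g v x := by simp only [hg]; positivity
        simp only [norm_mul, Real.norm_of_nonneg h3]
      rw [e2, integral_mul_const, integral_Ioo_pow_mul_pow (Set.mem_Ioi.1 hx).le, norm_mul,
        Real.norm_of_nonneg (pow_nonneg (sub_nonneg.2 (Set.mem_Ioi.1 hx).le) _)]
      ring
  have hl : ∀ v ∈ Set.Ioi u, ∫ x in Set.Ioi u, F v x = (v - u) ^ k / (k.factorial : ℝ) *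
      ∫ x in Set.Ioi v, (x - v) ^ b / (b.factorial : ℝ) * h x := fun v hv => by
    rw [hFx, setIntegral_indicator measurableSet_Ioi, Set.Ioi_inter_Ioi,
      max_eq_right (Set.mem_Ioi.1 hv).le, ← integral_const_mul]
    simp only [hg, mul_assoc]
  have hr : ∀ x ∈ Set.Ioi u, ∫ v in Set.Ioi u, F v x =
      (x - u) ^ (k + b + 1) / ((k + b + 1).factorial : ℝ) * h x := fun x hx => by
    rw [hFv, setIntegral_indicator measurableSet_Iio, hset, integral_mul_const,
      integral_Ioo_pow_mul_pow (Set.mem_Ioi.1 hx).le]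
  refine ⟨IntegrableOn.congr_fun hint.integral_prod_left hl measurableSet_Ioi, ?_⟩
  rw [← setIntegral_congr_fun measurableSet_Ioi hl, ← setIntegral_congr_fun measurableSet_Ioi hr]
  exact integral_integral_swap hint

/-- Reflection `x ↦ -x` of the case of `(u, ∞)`. The powers contribute `(-1)^(k + b)` on the left
and `(-1)^(k + b + 1)` on the right, which explains the minus sign. -/
theorem integrableOn_and_integral_Iic {h : ℝ → ℝ} (hm : Measurable h) (u : ℝ) (k b : ℕ)
    (hi : IntegrableOn (fun x => (x - u) ^ (k + b + 1) * h x) (Set.Iic u)) :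
    IntegrableOn (fun v => (v - u) ^ k / (k.factorial : ℝ) *
      ∫ x in Set.Iic v, (x - v) ^ b / (b.factorial : ℝ) * h x) (Set.Iic u) ∧
    ∫ v in Set.Iic u, (v - u) ^ k / (k.factorial : ℝ) *
      ∫ x in Set.Iic v, (x - v) ^ b / (b.factorial : ℝ) * h x =
    -∫ x in Set.Iic u, (x - u) ^ (k + b + 1) / ((k + b + 1).factorial : ℝ) * h x := by
  have hneg : ∀ f : ℝ → ℝ, IntegrableOn f (Set.Iic u) ↔
      IntegrableOn (fun x => f (-x)) (Set.Ioi (-u)) := fun f => by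
    rw [← integrableOn_Ici_iff_integrableOn_Ioi]
    have := (Measure.measurePreserving_neg (volume : Measure ℝ)).integrableOn_comp_preimage
      (MeasurableEquiv.neg ℝ).measurableEmbedding (f := f) (s := Set.Iic u)
    rw [← this]
    simp [Function.comp_def]
  have hpow : ∀ (x y : ℝ) (m : ℕ), (-x - y) ^ m = (-1) ^ m * (x - -y) ^ m := fun x y m => by
    rw [← mul_pow]
    ring
  have hin : ∀ v, ∫ x in Set.Iic (-v), (x - -v) ^ b / (b.factorial : ℝ) * h x =
      (-1) ^ b * ∫ x in Set.Ioi v, (x - v) ^ b / (b.factorial : ℝ) * h (-x) := fun v => by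
    rw [← integral_const_mul, ← integral_comp_neg_Ioi]
    refine integral_congr_ae (Filter.Eventually.of_forall fun x => ?_)
    simp only [hpow, neg_neg]
    ring
  have hs : ∀ m : ℕ, ((-1 : ℝ) ^ m) * (-1) ^ m = 1 := fun m => by
    rw [← mul_pow]; simp
  rw [hneg] at hi ⊢
  have hi' : IntegrableOn (fun x => (x - -u) ^ (k + b + 1) * h (-x)) (Set.Ioi (-u)) := by
    refine (hi.const_mul ((-1) ^ (k + b + 1))).congr ?_
    refine Filter.Eventually.of_forall fun x => ?_
    simp only [hpow]
    rw [← mul_assoc, ← mul_assoc, hs, one_mul]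
  obtain ⟨h1, h2⟩ := integrableOn_and_integral_Ioi (hm.comp measurable_neg) (-u) k b hi'
  constructor
  · refine (h1.const_mul ((-1) ^ (k + b))).congr (Filter.Eventually.of_forall fun x => ?_)
    simp only [hin, hpow, Function.comp_apply]
    ring
  · have hflip : ∀ f : ℝ → ℝ, ∫ x in Set.Iic u, f x = ∫ x in Set.Ioi (-u), f (-x) := fun f => by
      rw [integral_comp_neg_Ioi, neg_neg]
    rw [hflip, hflip, ← integral_neg]
    refine Eq.trans ?_ ((congrArg (fun t => (-1) ^ (k + b) * t) h2).trans ?_)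
    · rw [← integral_const_mul]
      refine integral_congr_ae (Filter.Eventually.of_forall fun x => ?_)
      simp only [hin, hpow, Function.comp_apply]
      ring
    · simp only [← integral_const_mul]
      refine integral_congr_ae (Filter.Eventually.of_forall fun x => ?_)
      simp only [hpow, Function.comp_apply]
      ring

section

/-! ## The kernel and its convolution identities -/

/-- The `a`-fold integral over `(u, ∞)` of `p e^{-V}`. -/
def tailInt (V : ℝ → ℝ) : ℕ → ℝ[X] → ℝ → ℝ
  | 0, p, u => p.eval u * Real.exp (-V u)
  | a + 1, p, u => ∫ x in Set.Ioi u, (x - u) ^ a / (a.factorial : ℝ) *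
      (p.eval x * Real.exp (-V x))

/-- The `a`-fold integral over `(-∞, u]` of `p e^{-V}`, with the sign of an `a`-fold primitive
from the right. -/
def headInt (V : ℝ → ℝ) : ℕ → ℝ[X] → ℝ → ℝ
  | 0, p, u => p.eval u * Real.exp (-V u)
  | a + 1, p, u => -∫ x in Set.Iic u, (x - u) ^ a / (a.factorial : ℝ) *
      (p.eval x * Real.exp (-V x))

/-- The kernel `1_{v > u} (v - u)^{a - b - 1} / (a - b - 1)!` for `b < a`. -/
def transition (a b : ℕ) (u v : ℝ) : ℝ :=
  if b < a ∧ u < v then (v - u) ^ (a - b - 1) / ((a - b - 1).factorial : ℝ) else 0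

/-- The correlation kernel between particles at depth `a` and `b` below the top level. -/
def minorKernel (V : ℝ → ℝ) (ψ : ℕ → ℝ[X]) (c : ℕ → ℝ) (n a b : ℕ) (u v : ℝ) : ℝ :=
  tailInt V a (reproducing ψ c n b v) u - transition a b u v

theorem eval_iterate_derivative_normPow' (v w : ℝ) (k d : ℕ) :
    (derivative^[d] (normPow v k)).eval w =
      if d ≤ k then (w - v) ^ (k - d) / ((k - d).factorial : ℝ) else 0 := by
  have h1 : (k.factorial : ℝ) ≠ 0 := Nat.cast_ne_zero.2 k.factorial_ne_zero
  rw [normPow, iterate_derivative_C_mul, iterate_derivative_X_sub_pow]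
  split_ifs with h
  · have h2 : ((k - d).factorial : ℝ) ≠ 0 := Nat.cast_ne_zero.2 (k - d).factorial_ne_zero
    have h3 : ((k - d).factorial : ℝ) * (k.descFactorial d : ℝ) = k.factorial := by
      exact_mod_cast Nat.factorial_mul_descFactorial h
    simp only [eval_mul, eval_C, nsmul_eq_mul, eval_natCast, eval_pow, eval_sub, eval_X]
    field_simp
    rw [← h3]
    ring
  · simp [Nat.descFactorial_eq_zero_iff_lt.2 (not_le.1 h)]

section

variable {V : ℝ → ℝ} {ψ : ℕ → ℝ[X]} {c : ℕ → ℝ} {n : ℕ}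

theorem measurable_eval_mul_exp (hV : Continuous V) (p : ℝ[X]) :
    Measurable fun x => p.eval x * Real.exp (-V x) := by
  have : Continuous fun x => p.eval x * Real.exp (-V x) := by fun_prop
  exact this.measurable

theorem IsMonicOrthogonal.integrable_pow_mul (hψ : IsMonicOrthogonal V ψ c) (p : ℝ[X]) (u : ℝ)
    (k : ℕ) : Integrable fun x => (x - u) ^ k * (p.eval x * Real.exp (-V x)) := by
  refine (hψ.integrable_eval ((X - C u) ^ k * p)).congr (Filter.Eventually.of_forall fun x => ?_)
  simp [mul_assoc]

theorem IsMonicOrthogonal.integrable_pow_div_mul (hψ : IsMonicOrthogonal V ψ c) (p : ℝ[X])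
    (u : ℝ) (k : ℕ) :
    Integrable fun x => (x - u) ^ k / (k.factorial : ℝ) * (p.eval x * Real.exp (-V x)) := by
  refine ((hψ.integrable_pow_mul p u k).div_const (k.factorial : ℝ)).congr
    (Filter.Eventually.of_forall fun x => ?_)
  ring

/-- The two are, up to sign, the halves of one integral over the line. Their difference is a full
moment, to which orthogonality applies. -/
theorem IsMonicOrthogonal.tailInt_sub_headInt (hψ : IsMonicOrthogonal V ψ c) (a : ℕ) (p : ℝ[X])
    (u : ℝ) : tailInt V (a + 1) p u - headInt V (a + 1) p u = hψ.moment (p * normPow u a) := by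
  have hi := hψ.integrable_pow_div_mul p u a
  rw [tailInt, headInt, sub_neg_eq_add, add_comm,
    intervalIntegral.integral_Iic_add_Ioi hi.integrableOn hi.integrableOn, hψ.moment_apply]
  refine integral_congr_ae (Filter.Eventually.of_forall fun x => ?_)
  simp only [eval_mul, eval_normPow]
  ring

theorem IsMonicOrthogonal.tailInt_sum (hψ : IsMonicOrthogonal V ψ c) (a : ℕ) {ι : Type*}
    (s : Finset ι) (t : ι → ℝ) (p : ι → ℝ[X]) (u : ℝ) :
    tailInt V a (∑ j ∈ s, C (t j) * p j) u = ∑ j ∈ s, t j * tailInt V a (p j) u := by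
  cases a with
  | zero => simp only [tailInt, eval_finsetSum, eval_mul, eval_C, Finset.sum_mul, mul_assoc]
  | succ a =>
    simp only [tailInt, ← integral_const_mul]
    rw [← integral_finsetSum _ fun j _ =>
      ((hψ.integrable_pow_div_mul (p j) u a).const_mul (t j)).integrableOn]
    refine integral_congr_ae (Filter.Eventually.of_forall fun x => ?_)
    simp only [eval_finsetSum, eval_mul, eval_C, Finset.sum_mul, Finset.mul_sum]
    refine Finset.sum_congr rfl fun j _ => ?_
    ring

theorem IsMonicOrthogonal.tailInt_reproducing (hψ : IsMonicOrthogonal V ψ c) (a b : ℕ)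
    (u v : ℝ) : tailInt V a (reproducing ψ c n b v) u = ∑ j ∈ Finset.range n,
      (c j ^ 2)⁻¹ * (derivative^[b] (ψ j)).eval v * tailInt V a (ψ j) u :=
  hψ.tailInt_sum a _ _ _ u

theorem IsMonicOrthogonal.integral_Ioi_tailInt (hψ : IsMonicOrthogonal V ψ c) (hV : Continuous V)
    (p : ℝ[X]) (u : ℝ) (k b : ℕ) :
    IntegrableOn (fun v => (v - u) ^ k / (k.factorial : ℝ) * tailInt V b p v) (Set.Ioi u) ∧
    ∫ v in Set.Ioi u, (v - u) ^ k / (k.factorial : ℝ) * tailInt V b p v =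
      tailInt V (k + b + 1) p u := by
  cases b with
  | zero => exact ⟨(hψ.integrable_pow_div_mul p u k).integrableOn, rfl⟩
  | succ b =>
    exact integrableOn_and_integral_Ioi (measurable_eval_mul_exp hV p) u k b
      (hψ.integrable_pow_mul p u _).integrableOn

theorem IsMonicOrthogonal.integral_Iic_headInt (hψ : IsMonicOrthogonal V ψ c) (hV : Continuous V)
    (p : ℝ[X]) (u : ℝ) (k b : ℕ) :
    IntegrableOn (fun v => (v - u) ^ k / (k.factorial : ℝ) * headInt V b p v) (Set.Iic u) ∧
    ∫ v in Set.Iic u, (v - u) ^ k / (k.factorial : ℝ) * headInt V b p v =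
      -headInt V (k + b + 1) p u := by
  cases b with
  | zero => exact ⟨(hψ.integrable_pow_div_mul p u k).integrableOn, (neg_neg _).symm⟩
  | succ b =>
    obtain ⟨h1, h2⟩ := integrableOn_and_integral_Iic (measurable_eval_mul_exp hV p) u k b
      (hψ.integrable_pow_mul p u _).integrableOn
    simp only [headInt, mul_neg, integral_neg]
    exact ⟨h1.neg, congrArg _ h2⟩

/-- Moments of the function that is `tailInt` to the right and `headInt` to the left of `w`. -/
theorem IsMonicOrthogonal.integral_pow_mul_ite (hψ : IsMonicOrthogonal V ψ c) (hV : Continuous V)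
    (p : ℝ[X]) (w : ℝ) (k b : ℕ) :
    Integrable (fun v => (v - w) ^ k / (k.factorial : ℝ) *
      if w ≤ v then tailInt V b p v else headInt V b p v) ∧
    ∫ v, (v - w) ^ k / (k.factorial : ℝ) *
      (if w ≤ v then tailInt V b p v else headInt V b p v) =
      hψ.moment (p * normPow w (k + b)) := by
  obtain ⟨h1, h2⟩ := hψ.integral_Ioi_tailInt hV p w k b
  obtain ⟨h3, h4⟩ := hψ.integral_Iic_headInt hV p w k b
  set G : ℝ → ℝ := fun v => (v - w) ^ k / (k.factorial : ℝ) *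
    if w ≤ v then tailInt V b p v else headInt V b p v with hG
  have e1 : Set.EqOn (fun v => (v - w) ^ k / (k.factorial : ℝ) * tailInt V b p v) G
      (Set.Ici w) := fun v hv => by
    simp only [hG, if_pos (Set.mem_Ici.1 hv)]
  have e2 : Set.EqOn (fun v => (v - w) ^ k / (k.factorial : ℝ) * headInt V b p v) G
      (Set.Iio w) := fun v hv => by
    simp only [hG, if_neg (not_le.2 (Set.mem_Iio.1 hv))]
  rw [← integrableOn_Ici_iff_integrableOn_Ioi] at h1
  rw [integrableOn_Iic_iff_integrableOn_Iio] at h3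
  rw [← integral_Ici_eq_integral_Ioi] at h2
  rw [integral_Iic_eq_integral_Iio] at h4
  have i1 : IntegrableOn G (Set.Ici w) := h1.congr_fun e1 measurableSet_Ici
  have i2 : IntegrableOn G (Set.Iio w) := h3.congr_fun e2 measurableSet_Iio
  constructor
  · rw [← integrableOn_univ, ← Set.Iio_union_Ici (a := w)]
    exact i2.union i1
  · rw [← intervalIntegral.integral_Iio_add_Ici i2 i1, ← setIntegral_congr_fun measurableSet_Iio e2,
      ← setIntegral_congr_fun measurableSet_Ici e1, h2, h4, ← hψ.tailInt_sub_headInt]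
    ring

/-- For depth `b ≥ 1`, tail minus head is the moment of `κ` against `(x - v)^(b - 1) / (b - 1)!`, a
polynomial of degree less than `n`. The reproducing property evaluates it as the `d`-th derivative
at `w`, which for `v < w` is exactly the transition kernel. -/
theorem IsMonicOrthogonal.minorKernel_eq_ite (hψ : IsMonicOrthogonal V ψ c) {b d : ℕ} (hb : b ≤ n)
    (v w : ℝ) : minorKernel V ψ c n b d v w =
      if w ≤ v then tailInt V b (reproducing ψ c n d w) v
      else headInt V b (reproducing ψ c n d w) v := by
  rw [minorKernel, transition]
  split_ifs with h1 h2 h2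
  · exact absurd h1.2 (not_lt.2 h2)
  · obtain _ | b := b
    · exact absurd h1.1 (Nat.not_lt_zero _)
    have h := hψ.tailInt_sub_headInt b (reproducing ψ c n d w) v
    rw [hψ.moment_reproducing d w (degree_normPow_lt v hb), eval_iterate_derivative_normPow',
      if_pos (Nat.lt_succ_iff.1 h1.1)] at h
    rw [show b + 1 - d - 1 = b - d by omega]
    linarith
  · rw [sub_zero]
  · rw [sub_zero]
    obtain _ | b := b
    · rfl
    have h := hψ.tailInt_sub_headInt b (reproducing ψ c n d w) v
    rw [hψ.moment_reproducing d w (degree_normPow_lt v hb), eval_iterate_derivative_normPow',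
      if_neg (fun h3 => h1 ⟨Nat.lt_succ_iff.2 h3, not_le.1 h2⟩)] at h
    exact sub_eq_zero.1 h

theorem IsMonicOrthogonal.integral_eval_mul_ite (hψ : IsMonicOrthogonal V ψ c) (hV : Continuous V)
    (p : ℝ[X]) (w : ℝ) (b : ℕ) {q : ℝ[X]} {m : ℕ} (hq : q.degree < m) :
    Integrable (fun v => q.eval v * if w ≤ v then tailInt V b p v else headInt V b p v) ∧
    ∫ v, q.eval v * (if w ≤ v then tailInt V b p v else headInt V b p v) =
      ∑ k ∈ Finset.range m, (derivative^[k] q).eval w * hψ.moment (p * normPow w (k + b)) := by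
  have e : ∀ v, q.eval v * (if w ≤ v then tailInt V b p v else headInt V b p v) =
      ∑ k ∈ Finset.range m, (derivative^[k] q).eval w * ((v - w) ^ k / (k.factorial : ℝ) *
        if w ≤ v then tailInt V b p v else headInt V b p v) := fun v => by
    conv_lhs => rw [eq_sum_normPow w hq]
    simp only [eval_finsetSum, eval_mul, eval_C, eval_normPow, Finset.sum_mul, mul_assoc]
  simp only [e]
  have hi : ∀ k ∈ Finset.range m, Integrable fun v => (derivative^[k] q).eval w *
      ((v - w) ^ k / (k.factorial : ℝ) *
        if w ≤ v then tailInt V b p v else headInt V b p v) := fun k _ =>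
    (hψ.integral_pow_mul_ite hV p w k b).1.const_mul _
  refine ⟨integrable_finsetSum _ hi, ?_⟩
  rw [integral_finsetSum _ hi]
  refine Finset.sum_congr rfl fun k _ => ?_
  rw [integral_const_mul, (hψ.integral_pow_mul_ite hV p w k b).2]

/-- Expand `q` in powers of `v - w`. The degree bound keeps every `k + b` below `n`, so the
reproducing property applies and only the term `k + b = d` survives. -/
theorem IsMonicOrthogonal.integral_eval_mul_minorKernel (hψ : IsMonicOrthogonal V ψ c)
    (hV : Continuous V) {b d : ℕ} (hb : b ≤ n) (hd : d < n) (w : ℝ) {q : ℝ[X]}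
    (hq : q.degree < (n - b : ℕ)) :
    Integrable (fun v => q.eval v * minorKernel V ψ c n b d v w) ∧
    ∫ v, q.eval v * minorKernel V ψ c n b d v w =
      if b ≤ d then (derivative^[d - b] q).eval w else 0 := by
  simp only [hψ.minorKernel_eq_ite hb]
  obtain ⟨h1, h2⟩ := hψ.integral_eval_mul_ite hV (reproducing ψ c n d w) w b hq
  refine ⟨h1, h2.trans ?_⟩
  have e : ∀ k ∈ Finset.range (n - b), (derivative^[k] q).eval w *
      hψ.moment (reproducing ψ c n d w * normPow w (k + b)) =
      if k + b = d then (derivative^[k] q).eval w else 0 := fun k hk => by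
    have hk' : k + b < n := by have := Finset.mem_range.1 hk; omega
    rw [hψ.moment_reproducing_normPow d w hk', mul_ite, mul_one, mul_zero]
  rw [Finset.sum_congr rfl e]
  split_ifs with h
  · rw [Finset.sum_eq_single (d - b), if_pos (by omega)]
    · intro k _ hk
      rw [if_neg (by omega)]
    · intro h'
      exact absurd (Finset.mem_range.2 (by omega)) h'
  · exact Finset.sum_eq_zero fun k _ => if_neg (by omega)

theorem IsMonicOrthogonal.degree_iterate_derivative_lt (hψ : IsMonicOrthogonal V ψ c) {b j : ℕ}
    (hb : b < n) (hj : j < n) : (derivative^[b] (ψ j)).degree < (n - b : ℕ) := by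
  refine degree_le_natDegree.trans_lt ?_
  have h := natDegree_iterate_derivative (ψ j) b
  rw [hψ.natDegree] at h
  exact_mod_cast (show _ < n - b by omega)

/-- The trace of the kernel at one level. -/
theorem IsMonicOrthogonal.integral_minorKernel_self (hψ : IsMonicOrthogonal V ψ c)
    (hV : Continuous V) {b : ℕ} (hb : b < n) :
    Integrable (fun v => minorKernel V ψ c n b b v v) ∧
    ∫ v, minorKernel V ψ c n b b v v = (n - b : ℕ) := by
  have e : ∀ v, minorKernel V ψ c n b b v v = ∑ j ∈ Finset.range n,
      (c j ^ 2)⁻¹ * ((derivative^[b] (ψ j)).eval v * tailInt V b (ψ j) v) := fun v => by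
    rw [minorKernel, hψ.tailInt_reproducing, transition, if_neg (fun h => lt_irrefl _ h.1),
      sub_zero]
    simp only [mul_assoc]
  have hj : ∀ j ∈ Finset.range n,
      Integrable (fun v => (derivative^[b] (ψ j)).eval v * tailInt V b (ψ j) v) ∧
      ∫ v, (derivative^[b] (ψ j)).eval v * tailInt V b (ψ j) v =
        if b ≤ j then c j ^ 2 else 0 := by
    intro j hjn
    split_ifs with hbj
    -- For `b ≤ j`, orthogonality of `ψ_j` to lower degrees makes tail and head equal, so the moment
    -- formula for the function glued at any point, here `0`, is available.
    · have e2 : ∀ v, tailInt V b (ψ j) v =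
          if (0 : ℝ) ≤ v then tailInt V b (ψ j) v else headInt V b (ψ j) v := fun v => by
        split_ifs
        · rfl
        · obtain _ | b := b
          · rfl
          rw [← sub_eq_zero, hψ.tailInt_sub_headInt,
            hψ.moment_mul_of_degree_lt (degree_normPow_lt v hbj)]
      have hdeg : (ψ j).degree < (j + 1 : ℕ) := by
        refine degree_le_natDegree.trans_lt ?_
        rw [hψ.natDegree]
        exact_mod_cast Nat.lt_succ_self j
      have hdeg' : (derivative^[b] (ψ j)).degree < (j + 1 - b : ℕ) :=
        hψ.degree_iterate_derivative_lt (n := j + 1) (by omega) (Nat.lt_succ_self j)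
      obtain ⟨h1, h2⟩ := hψ.integral_eval_mul_ite hV (ψ j) 0 b hdeg'
      simp only [← e2] at h1 h2
      refine ⟨h1, h2.trans ?_⟩
      have h3 : ∀ k ∈ Finset.range (j + 1 - b), (derivative^[k] (derivative^[b] (ψ j))).eval 0 *
          hψ.moment (ψ j * normPow 0 (k + b)) =
          hψ.moment (ψ j * (C ((derivative^[k + b] (ψ j)).eval 0) * normPow 0 (k + b))) :=
        fun k _ => by
          rw [← Function.iterate_add_apply, mul_left_comm, ← smul_eq_C_mul, map_smul, smul_eq_mul]
      rw [Finset.sum_congr rfl h3]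
      have h4 := hψ.moment_mul j j
      rw [if_pos rfl] at h4
      -- Taylor expansion of the second factor at `0`. The terms of degree below `b` vanish by
      -- orthogonality, and the remaining ones are the sum above.
      have h5 : hψ.moment (ψ j * ψ j) = ∑ k ∈ Finset.range (b + (j + 1 - b)),
          hψ.moment (ψ j * (C ((derivative^[k] (ψ j)).eval 0) * normPow 0 k)) := by
        rw [Nat.add_sub_cancel' (by omega), ← map_sum, ← Finset.mul_sum, ← eq_sum_normPow 0 hdeg]
      rw [← h4, h5, Finset.sum_range_add]
      simp only [add_comm b]
      refine (zero_add _).symm.trans (congrArg (· + _) (Finset.sum_eq_zero fun k hk => ?_).symm)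
      · rw [mul_left_comm, ← smul_eq_C_mul, map_smul, hψ.moment_mul_of_degree_lt
          (degree_normPow_lt 0 ((Finset.mem_range.1 hk).trans_le hbj)), smul_zero]
    · rw [iterate_derivative_eq_zero (by rw [hψ.natDegree]; omega)]
      simp
  simp only [e]
  have hi : ∀ j ∈ Finset.range n, Integrable fun v =>
      (c j ^ 2)⁻¹ * ((derivative^[b] (ψ j)).eval v * tailInt V b (ψ j) v) := fun j h =>
    (hj j h).1.const_mul _
  refine ⟨integrable_finsetSum _ hi, ?_⟩
  rw [integral_finsetSum _ hi]
  have h1 : ∀ j ∈ Finset.range n,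
      ∫ v, (c j ^ 2)⁻¹ * ((derivative^[b] (ψ j)).eval v * tailInt V b (ψ j) v) =
        if b ≤ j then (1 : ℝ) else 0 := fun j h => by
    rw [integral_const_mul, (hj j h).2]
    split_ifs
    · exact inv_mul_cancel₀ (pow_ne_zero 2 (hψ.ne_zero j))
    · rw [mul_zero]
  rw [Finset.sum_congr rfl h1, Finset.sum_ite, Finset.sum_const_zero, add_zero, Finset.sum_const,
    nsmul_eq_mul, mul_one]
  congr 1
  rw [show (Finset.range n).filter (fun j => b ≤ j) = Finset.Ico b n by ext; simp; omega,
    Nat.card_Ico]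

end

end

section

section

variable {V : ℝ → ℝ} {ψ : ℕ → ℝ[X]} {c : ℕ → ℝ} {n : ℕ}

theorem transition_eq_indicator {a b : ℕ} (h : b < a) (u v : ℝ) : transition a b u v =
    (Set.Ioi u).indicator
      (fun v => (v - u) ^ (a - b - 1) / ((a - b - 1).factorial : ℝ)) v := by
  simp [transition, h, Set.indicator]

theorem transition_of_le {a b : ℕ} (h : a ≤ b) (u v : ℝ) : transition a b u v = 0 :=
  if_neg fun h' => absurd h'.1 (not_lt.2 h)

theorem IsMonicOrthogonal.integral_transition_mul_tailInt (hψ : IsMonicOrthogonal V ψ c)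
    (hV : Continuous V) {a b : ℕ} (h : b < a) (p : ℝ[X]) (u : ℝ) :
    Integrable (fun v => transition a b u v * tailInt V b p v) ∧
    ∫ v, transition a b u v * tailInt V b p v = tailInt V a p u := by
  have e : (fun v => transition a b u v * tailInt V b p v) = (Set.Ioi u).indicator
      fun v => (v - u) ^ (a - b - 1) / ((a - b - 1).factorial : ℝ) * tailInt V b p v := by
    funext v
    rw [transition_eq_indicator h, Set.indicator_mul_left]
  obtain ⟨h1, h2⟩ := hψ.integral_Ioi_tailInt hV p u (a - b - 1) b
  rw [e, integral_indicator measurableSet_Ioi, h2]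
  exact ⟨(integrable_indicator_iff measurableSet_Ioi).2 h1, by congr 1; omega⟩

/-- Transition kernels compose like repeated integration; the integrand lives on `(u, w)` and gives
the beta integral. -/
theorem integral_transition_mul_transition {a b d : ℕ} (hab : b < a) (hbd : d < b) (u w : ℝ) :
    Integrable (fun v => transition a b u v * transition b d v w) ∧
    ∫ v, transition a b u v * transition b d v w = transition a d u w := by
  have e : (fun v => transition a b u v * transition b d v w) = (Set.Ioo u w).indicator
      fun v => (v - u) ^ (a - b - 1) / ((a - b - 1).factorial : ℝ) *
        ((w - v) ^ (b - d - 1) / ((b - d - 1).factorial : ℝ)) := by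
    funext v
    rw [transition, transition, Set.indicator]
    by_cases h1 : u < v <;> by_cases h2 : v < w <;> simp [h1, h2, hab, hbd]
  rw [e, integral_indicator measurableSet_Ioo]
  refine ⟨(integrable_indicator_iff measurableSet_Ioo).2
    ((Continuous.integrableOn_Icc (by fun_prop)).mono_set Set.Ioo_subset_Icc_self), ?_⟩
  by_cases h : u < w
  · rw [integral_Ioo_pow_mul_pow h.le, transition, if_pos ⟨hbd.trans hab, h⟩,
      show a - b - 1 + (b - d - 1) + 1 = a - d - 1 by omega]
  · rw [Set.Ioo_eq_empty h, transition, if_neg fun h' => h h'.2]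
    simp

/-- Convolution of the kernel with itself at an intermediate level. -/
theorem IsMonicOrthogonal.integral_minorKernel_mul (hψ : IsMonicOrthogonal V ψ c)
    (hV : Continuous V) {a b d : ℕ} (hb : b < n) (hd : d < n) (u w : ℝ) :
    Integrable (fun v => minorKernel V ψ c n a b u v * minorKernel V ψ c n b d v w) ∧
    ∫ v, minorKernel V ψ c n a b u v * minorKernel V ψ c n b d v w =
      minorKernel V ψ c n a d u w * ((if a ≤ b then 1 else 0) - if d < b then 1 else 0) := by
  -- The finite rank part of the left kernel, as a polynomial in the intermediate variable; the `b`
  -- derivatives bring its degree below `n - b`.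
  set q : ℝ[X] := ∑ j ∈ Finset.range n,
    ((c j ^ 2)⁻¹ * tailInt V a (ψ j) u) • derivative^[b] (ψ j) with hq
  have hqe : ∀ v, tailInt V a (reproducing ψ c n b v) u = q.eval v := fun v => by
    rw [hψ.tailInt_reproducing, hq, eval_finsetSum]
    refine Finset.sum_congr rfl fun j _ => ?_
    rw [eval_smul, smul_eq_mul]
    ring
  have hqd : q.degree < (n - b : ℕ) := by
    rw [← mem_degreeLT]
    exact Submodule.sum_mem _ fun j hj => Submodule.smul_mem _ _
      (mem_degreeLT.2 (hψ.degree_iterate_derivative_lt hb (Finset.mem_range.1 hj)))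
  have hqt : b ≤ d → (derivative^[d - b] q).eval w = tailInt V a (reproducing ψ c n d w) u :=
    fun h => by
      rw [hψ.tailInt_reproducing, hq, iterate_derivative_sum, eval_finsetSum]
      refine Finset.sum_congr rfl fun j _ => ?_
      rw [iterate_derivative_smul, eval_smul, smul_eq_mul, ← Function.iterate_add_apply,
        Nat.sub_add_cancel h]
      ring
  obtain ⟨h1, h2⟩ := hψ.integral_eval_mul_minorKernel hV hb.le hd w hqd
  have h3 : Integrable (fun v => transition a b u v * minorKernel V ψ c n b d v w) ∧
      ∫ v, transition a b u v * minorKernel V ψ c n b d v w =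
        if b < a then tailInt V a (reproducing ψ c n d w) u -
          (if d < b then transition a d u w else 0) else 0 := by
    split_ifs with hab hdb
    · simp only [minorKernel, mul_sub]
      obtain ⟨i1, i2⟩ := hψ.integral_transition_mul_tailInt hV hab (reproducing ψ c n d w) u
      obtain ⟨i3, i4⟩ := integral_transition_mul_transition hab hdb u w
      exact ⟨i1.sub i3, by rw [integral_sub i1 i3, i2, i4]⟩
    · simp only [minorKernel, transition_of_le (not_lt.1 hdb), sub_zero]
      exact hψ.integral_transition_mul_tailInt hV hab (reproducing ψ c n d w) u
    · simp [transition_of_le (not_lt.1 hab)]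
  have e : (fun v => minorKernel V ψ c n a b u v * minorKernel V ψ c n b d v w) = fun v =>
      q.eval v * minorKernel V ψ c n b d v w -
        transition a b u v * minorKernel V ψ c n b d v w := by
    funext v
    rw [minorKernel, hqe, sub_mul]
  rw [e]
  refine ⟨h1.sub h3.1, ?_⟩
  rw [integral_sub h1 h3.1, h2, h3.2, minorKernel]
  -- The polynomial part contributes only for `b ≤ d`, the transition part only for `b < a`. If both
  -- contribute they cancel; if just one does, the kernel remains, with sign `+` or `-`
  -- respectively.
  by_cases hab : a ≤ b <;> by_cases hbd : b ≤ d
  · rw [if_pos hbd, if_pos hab, if_neg (not_lt.2 hab), if_neg (not_lt.2 hbd), hqt hbd,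
      transition_of_le (hab.trans hbd)]
    ring
  · rw [if_neg hbd, if_pos hab, if_neg (not_lt.2 hab), if_pos (not_le.1 hbd)]
    ring
  · rw [if_pos hbd, if_neg hab, if_pos (not_le.1 hab), if_neg (not_lt.2 hbd),
      if_neg (not_lt.2 hbd), hqt hbd]
    ring
  · rw [if_neg hbd, if_neg hab, if_pos (not_le.1 hab), if_pos (not_le.1 hbd),
      if_pos (not_le.1 hbd)]
    ring

/-- The kernel in the form with explicit sums and integrals. -/
theorem IsMonicOrthogonal.minorKernel_eq_kernel (hψ : IsMonicOrthogonal V ψ c) {r s : ℕ}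
    (hr : r < n) (u v : ℝ) :
    minorKernel V ψ c n (n - r) (n - s) u v = kernel V ψ c n r s u v := by
  -- The derivative of order `n - s` kills `ψ_j` for `j < n - s`.
  have hsum : ∀ f : ℕ → ℝ, ∑ j ∈ Finset.range n, (c j ^ 2)⁻¹ *
      (derivative^[n - s] (ψ j)).eval v * f j = ∑ j ∈ Finset.Ico (n - s) n, (c j ^ 2)⁻¹ *
      (derivative^[n - s] (ψ j)).eval v * f j := fun f => by
    refine (Finset.sum_subset (fun j hj => ?_) fun j hj hj' => ?_).symm
    · exact Finset.mem_range.2 (Finset.mem_Ico.1 hj).2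
    · rw [iterate_derivative_eq_zero, eval_zero, mul_zero, zero_mul]
      rw [hψ.natDegree]
      by_contra h
      exact hj' (Finset.mem_Ico.2 ⟨not_lt.1 h, Finset.mem_range.1 hj⟩)
  -- Below the top level the depth is positive, so `tailInt` and `headInt` are genuine integrals,
  -- with exponent `a = n - r - 1`.
  obtain ⟨a, ha⟩ : ∃ a, n - r = a + 1 := ⟨n - r - 1, by omega⟩
  rw [hψ.minorKernel_eq_ite (Nat.sub_le _ _), kernel, ha, Nat.add_sub_cancel]
  have e1 := hψ.tailInt_reproducing (n := n) (a + 1) (n - s) u v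
  have e2 : headInt V (a + 1) (reproducing ψ c n (n - s) v) u = -∑ j ∈ Finset.range n,
      (c j ^ 2)⁻¹ * (derivative^[n - s] (ψ j)).eval v * ∫ x in Set.Iic u,
        (x - u) ^ a / (a.factorial : ℝ) * ((ψ j).eval x * Real.exp (-V x)) := by
    simp only [headInt, ← integral_const_mul]
    rw [← integral_finsetSum _ fun j _ => ((hψ.integrable_pow_div_mul (ψ j) u a).const_mul
      _).integrableOn]
    refine congrArg _ (integral_congr_ae (Filter.Eventually.of_forall fun x => ?_))
    simp only [reproducing, eval_finsetSum, eval_mul, eval_C, Finset.sum_mul, Finset.mul_sum]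
    refine Finset.sum_congr rfl fun j _ => ?_
    ring
  rw [hsum] at e1 e2
  simp only [tailInt, ← mul_assoc] at e1 e2
  split_ifs with h1 h2 h2
  · exact absurd h1 (not_le.2 h2)
  · rw [sub_zero, ← e1]
    simp only [tailInt, mul_assoc]
  · rw [zero_sub, e2]
  · exact absurd (not_le.1 h1) h2

end

end

section

/-! ## The determinant of the kernel at a full configuration -/

/-- The determinant of the comparison matrix of two consecutive levels. -/
theorem det_comparison_eq_ite {r : ℕ} {u : Fin r → ℝ} {v : Fin (r + 1) → ℝ} (hu : StrictAnti u)
    (hv : StrictAnti v) (h : ∀ k j, u k ≠ v j) :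
    (Matrix.of fun k j : Fin (r + 1) =>
      if hk : (k : ℕ) < r then (if u ⟨k, hk⟩ < v j then (1 : ℝ) else 0) else 1).det =
      (open Classical in if Interlaced u v then 1 else 0) := by
  classical
  -- The positions of the ones. Each row is an initial segment, the rows increase with `k`, and the
  -- last row is full.
  set R : Fin (r + 1) → Fin (r + 1) → Prop := fun k j => ∀ hk : (k : ℕ) < r, u ⟨k, hk⟩ < v j with hR
  have hM : (Matrix.of fun k j : Fin (r + 1) =>
      if hk : (k : ℕ) < r then (if u ⟨k, hk⟩ < v j then (1 : ℝ) else 0) else 1) =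
      Matrix.of fun k j => if R k j then (1 : ℝ) else 0 := by
    ext k j
    simp only [Matrix.of_apply, hR]
    by_cases hk : (k : ℕ) < r
    · simp [hk]
    · simp [hk]
  have hdown : ∀ k j j', j ≤ j' → R k j' → R k j := fun k j j' hj hk h' =>
    (hk h').trans_le (hv.antitone hj)
  have hmono : ∀ k k' j, k ≤ k' → R k j → R k' j := fun k k' j hk hj h' =>
    (hu.antitone (Fin.mk_le_mk.2 hk)).trans_lt (hj (lt_of_le_of_lt (Fin.le_def.1 hk) h'))
  rw [hM]
  split_ifs with hI
  -- Interlacing makes the matrix lower triangular with ones on the diagonal.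
  · have hRle : ∀ k j, R k j ↔ j ≤ k := by
      intro k j
      constructor
      · intro hkj
        by_contra hlt
        rw [not_le] at hlt
        have hk : (k : ℕ) < r := by have := Fin.lt_def.1 hlt; omega
        have h1 := (hI ⟨k, hk⟩).2
        have h2 : v j ≤ v (Fin.succ ⟨k, hk⟩) := hv.antitone (by
          rw [Fin.le_def]; exact Fin.lt_def.1 hlt)
        exact absurd (hkj hk) (not_lt.2 (h2.trans h1))
      · intro hjk hk
        have h1 := (hI ⟨k, hk⟩).1
        have h2 : v (Fin.castSucc ⟨k, hk⟩) ≤ v j := hv.antitone (by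
          rw [Fin.le_def]; exact Fin.le_def.1 hjk)
        exact lt_of_le_of_ne (h1.trans h2) (h _ _)
    rw [Matrix.det_of_isLowerTriangular]
    · simp [hRle]
    · intro i j hij
      have : ¬ j ≤ i := not_le.2 (OrderDual.toDual_lt_toDual.1 hij)
      simp [hRle, this]
  · by_contra hdet
    -- A nonzero determinant forbids empty rows and equal rows, so the `r + 1` nested segments have
    -- strictly increasing sizes between `1` and `r + 1`. Row `k` then has `k + 1` ones, which
    -- amounts to interlacing.
    set cnt : Fin (r + 1) → ℕ := fun k => (Finset.univ.filter (R k)).card with hcnt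
    have hsub : ∀ k k', k ≤ k' → Finset.univ.filter (R k) ⊆ Finset.univ.filter (R k') :=
      fun k k' hk => Finset.monotone_filter_right _ fun j _ => hmono k k' j hk
    have hpos : ∀ k, 0 < cnt k := fun k => by
      rw [hcnt, Finset.card_pos]
      by_contra hne
      rw [Finset.not_nonempty_iff_eq_empty, Finset.filter_eq_empty_iff] at hne
      exact hdet (Matrix.det_eq_zero_of_row_eq_zero k fun j => by
        simp [hne (Finset.mem_univ j)])
    have hstrict : StrictMono cnt := fun k k' hk => by
      refine lt_of_le_of_ne (Finset.card_le_card (hsub k k' hk.le)) fun heq => ?_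
      have hs := Finset.eq_of_subset_of_card_le (hsub k k' hk.le) heq.ge
      refine hdet (Matrix.det_zero_of_row_eq hk.ne (funext fun j => ?_))
      have hj := Finset.ext_iff.1 hs j
      simp only [Finset.mem_filter, Finset.mem_univ, true_and] at hj
      simp [hj]
    have hle : ∀ k, cnt k ≤ r + 1 := fun k => (Finset.card_le_univ _).trans_eq (Fintype.card_fin _)
    have hid : ∀ k, cnt k = (k : ℕ) + 1 := by
      set g : Fin (r + 1) → Fin (r + 1) := fun k => ⟨cnt k - 1, by
        have := hle k; have := hpos k; omega⟩ with hg
      have hgm : StrictMono g := fun k k' hk => by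
        have h1 := hstrict hk
        have h2 := hpos k
        rw [Fin.lt_def]
        simp only [hg]
        omega
      have hgid : g = id := by
        funext k
        exact le_antisymm hgm.apply_le hgm.le_apply
      intro k
      have h1 := congrArg Fin.val (congrFun hgid k)
      have h2 := hpos k
      simp only [hg, id] at h1
      omega
    have hRle : ∀ k j, R k j ↔ j ≤ k := by
      intro k j
      constructor
      · intro hkj
        have h1 : Finset.Iic j ⊆ Finset.univ.filter (R k) := fun i hi => by
          simp only [Finset.mem_filter, Finset.mem_univ, true_and]
          exact hdown k i j (Finset.mem_Iic.1 hi) hkj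
        have h2 := Finset.card_le_card h1
        rw [Fin.card_Iic] at h2
        have h3 : (Finset.univ.filter (R k)).card = (k : ℕ) + 1 := hid k
        rw [Fin.le_def]
        omega
      · intro hjk
        by_contra hn
        have h1 : Finset.univ.filter (R k) ⊆ Finset.Iio j := fun i hi => by
          simp only [Finset.mem_filter, Finset.mem_univ, true_and] at hi
          rw [Finset.mem_Iio]
          by_contra hij
          exact hn (hdown k j i (not_lt.1 hij) hi)
        have h2 := Finset.card_le_card h1
        rw [Fin.card_Iio] at h2
        have h3 : (Finset.univ.filter (R k)).card = (k : ℕ) + 1 := hid k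
        have h4 := Fin.le_def.1 hjk
        omega
    refine hI fun k => ⟨?_, ?_⟩
    · exact ((hRle k.castSucc k.castSucc).2 le_rfl k.isLt).le
    · have : ¬ R k.castSucc k.succ := by
        rw [hRle, not_le]
        exact Fin.castSucc_lt_succ
      simp only [hR, not_forall, not_lt] at this
      exact this.2

section

variable {V : ℝ → ℝ} {ψ : ℕ → ℝ[X]} {c : ℕ → ℝ} {n : ℕ}

/-- The matrix of the kernel at particles of levels `l` and positions `u`; the level index `i`
stands for level `i + 1`, at depth `n - (i + 1)`. -/
def corrMatrix (V : ℝ → ℝ) (ψ : ℕ → ℝ[X]) (c : ℕ → ℝ) {n : ℕ} {ι : Type*} (l : ι → Fin n)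
    (u : ι → ℝ) : Matrix ι ι ℝ :=
  Matrix.of fun i j => minorKernel V ψ c n (n - (l i + 1)) (n - (l j + 1)) (u i) (u j)

/-- The transition part of `corrMatrix`. -/
def transMatrix {n : ℕ} {ι : Type*} (l : ι → Fin n) (u : ι → ℝ) : Matrix ι ι ℝ :=
  Matrix.of fun i j => transition (n - (l i + 1)) (n - (l j + 1)) (u i) (u j)

/-- The left factor of the finite rank part of `corrMatrix`. -/
def leftMatrix (V : ℝ → ℝ) (ψ : ℕ → ℝ[X]) (c : ℕ → ℝ) {n : ℕ} {ι : Type*} (l : ι → Fin n)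
    (u : ι → ℝ) : Matrix ι (Fin n) ℝ :=
  Matrix.of fun i j => (c j ^ 2)⁻¹ * tailInt V (n - (l i + 1)) (ψ j) (u i)

/-- The right factor of the finite rank part of `corrMatrix`. -/
def rightMatrix (ψ : ℕ → ℝ[X]) {n : ℕ} {ι : Type*} (l : ι → Fin n) (u : ι → ℝ) :
    Matrix (Fin n) ι ℝ :=
  Matrix.of fun j i => (derivative^[n - (l i + 1)] (ψ j)).eval (u i)

theorem IsMonicOrthogonal.corrMatrix_eq (hψ : IsMonicOrthogonal V ψ c) {ι : Type*}
    (l : ι → Fin n) (u : ι → ℝ) :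
    corrMatrix V ψ c l u = leftMatrix V ψ c l u * rightMatrix ψ l u - transMatrix l u := by
  ext i j
  rw [Matrix.sub_apply, Matrix.mul_apply]
  simp only [corrMatrix, leftMatrix, rightMatrix, transMatrix, Matrix.of_apply, minorKernel]
  rw [hψ.tailInt_reproducing, Finset.sum_range]
  congr 1
  exact Finset.sum_congr rfl fun k _ => by ring

theorem IsMonicOrthogonal.rightMatrix_eq_zero (hψ : IsMonicOrthogonal V ψ c) {ι : Type*}
    (l : ι → Fin n) (u : ι → ℝ) {j : Fin n} {i : ι} (h : (j : ℕ) + (l i + 1) < n) :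
    rightMatrix ψ l u j i = 0 := by
  rw [rightMatrix, Matrix.of_apply, iterate_derivative_eq_zero, eval_zero]
  rw [hψ.natDegree]
  omega

theorem transMatrix_eq_zero {ι : Type*} (l : ι → Fin n) (u : ι → ℝ) {i j : ι} (h : l j ≤ l i) :
    transMatrix l u i j = 0 := by
  have := Fin.le_def.1 h
  exact transition_of_le (by omega) _ _

/-- The kernel matrix is singular if there are too many particles at some level. -/
theorem IsMonicOrthogonal.det_corrMatrix_eq_zero (hψ : IsMonicOrthogonal V ψ c) {ι : Type*}
    [Fintype ι] [DecidableEq ι] (l : ι → Fin n) (u : ι → ℝ) (s : Fin n)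
    (h : (s : ℕ) + 1 < (Finset.univ.filter fun i => l i = s).card) :
    (corrMatrix V ψ c l u).det = 0 := by
  rw [← Matrix.exists_mulVec_eq_zero_iff, hψ.corrMatrix_eq]
  -- A null vector is sought among those supported on levels up to `s`. There the transition part
  -- imposes one condition per particle strictly below `s`, and the right factor at most `s + 1`
  -- conditions, by degree. More than `s + 1` particles at level `s` leave a nonzero solution.
  let ext : ({i // l i ≤ s} → ℝ) →ₗ[ℝ] ι → ℝ :=
    { toFun := fun x i => if hi : l i ≤ s then x ⟨i, hi⟩ else 0
      map_add' := fun x y => by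
        funext i
        simp only [Pi.add_apply]
        split_ifs <;> simp
      map_smul' := fun a x => by
        funext i
        simp only [Pi.smul_apply, RingHom.id_apply]
        split_ifs <;> simp }
  have hext : ∀ x i, ¬ l i ≤ s → ext x i = 0 := fun x i hi => dif_neg hi
  let f : ({i // l i ≤ s} → ℝ) →ₗ[ℝ] ({i // l i < s} ⊕ {j : Fin n // n ≤ j + (s + 1)}) → ℝ :=
    LinearMap.pi (Sum.elim
      (fun r => LinearMap.proj r.1 ∘ₗ (transMatrix l u).mulVecLin ∘ₗ ext)
      (fun j => LinearMap.proj j.1 ∘ₗ (rightMatrix ψ l u).mulVecLin ∘ₗ ext))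
  have hcard : Module.finrank ℝ (({i // l i < s} ⊕ {j : Fin n // n ≤ j + (s + 1)}) → ℝ) <
      Module.finrank ℝ ({i // l i ≤ s} → ℝ) := by
    rw [Module.finrank_fintype_fun_eq_card, Module.finrank_fintype_fun_eq_card, Fintype.card_sum,
      Fintype.card_subtype, Fintype.card_subtype, Fintype.card_subtype]
    have h1 : (Finset.univ.filter fun i => l i ≤ s).card =
        (Finset.univ.filter fun i => l i < s).card +
          (Finset.univ.filter fun i => l i = s).card := by
      rw [← Finset.card_union_of_disjoint]
      · congr 1
        ext i
        simp [le_iff_lt_or_eq]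
      · rw [Finset.disjoint_filter]
        exact fun i _ h2 => h2.ne
    have h2 : (Finset.univ.filter fun j : Fin n => n ≤ j + (s + 1)).card ≤ (s : ℕ) + 1 := by
      rw [← Finset.card_map Fin.valEmbedding]
      refine (Finset.card_le_card (t := Finset.Ico (n - (s + 1)) n) fun j hj => ?_).trans ?_
      · simp only [Finset.mem_map, Finset.mem_filter, Finset.mem_univ, true_and,
          Fin.valEmbedding_apply] at hj
        obtain ⟨j, hj, rfl⟩ := hj
        rw [Finset.mem_Ico]
        omega
      · rw [Nat.card_Ico]
        omega
    omega
  obtain ⟨x, hx, hx0⟩ := (Submodule.ne_bot_iff _).1 (LinearMap.ker_ne_bot_of_finrank_lt (f := f)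
    hcard)
  rw [LinearMap.mem_ker] at hx
  have hT : (transMatrix l u).mulVec (ext x) = 0 := by
    funext r
    by_cases hr : l r < s
    · exact congrFun hx (Sum.inl ⟨r, hr⟩)
    · rw [Matrix.mulVec, Pi.zero_apply]
      refine Finset.sum_eq_zero fun i _ => ?_
      by_cases hi : l i ≤ s
      · exact mul_eq_zero_of_left (transMatrix_eq_zero l u (hi.trans (not_lt.1 hr))) _
      · rw [hext x i hi, mul_zero]
  have hR : (rightMatrix ψ l u).mulVec (ext x) = 0 := by
    funext j
    by_cases hj : n ≤ j + (s + 1)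
    · exact congrFun hx (Sum.inr ⟨j, hj⟩)
    · rw [Matrix.mulVec, Pi.zero_apply]
      refine Finset.sum_eq_zero fun i _ => ?_
      by_cases hi : l i ≤ s
      · have := Fin.le_def.1 hi
        exact mul_eq_zero_of_left (hψ.rightMatrix_eq_zero l u (by omega)) _
      · rw [hext x i hi, mul_zero]
  refine ⟨ext x, fun h0 => hx0 (funext fun i => ?_), ?_⟩
  · have := congrFun h0 i.1
    simpa [ext, i.2] using this
  · rw [Matrix.sub_mulVec, hT, ← Matrix.mulVec_mulVec, hR, Matrix.mulVec_zero, sub_zero]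

end

end

/-! ### The kernel matrix as a Schur complement of a block triangular matrix -/

section

/-- The labels of the particles of a pattern. -/
abbrev PatternIndex (n : ℕ) : Type := Σ i : Fin n, Fin ((i : ℕ) + 1)

theorem PatternIndex.ext_iff {n : ℕ} {p q : PatternIndex n} :
    p = q ↔ (p.1 : ℕ) = q.1 ∧ (p.2 : ℕ) = q.2 := by
  obtain ⟨i, k⟩ := p
  obtain ⟨j, m⟩ := q
  constructor
  · rintro h
    cases h
    exact ⟨rfl, rfl⟩
  · rintro ⟨h1, h2⟩
    obtain rfl : i = j := Fin.ext h1
    obtain rfl : k = m := Fin.ext h2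
    rfl

/-- The matching of columns with rows that makes the extended kernel matrix block triangular. -/
def rowMatch {N : ℕ} : PatternIndex (N + 1) ⊕ Fin (N + 1) → PatternIndex (N + 1) ⊕ Fin (N + 1)
  | Sum.inl p =>
    -- Level index `i` has one more column than index `i - 1` has rows. The surplus column takes the
    -- row of `ψ_{N - i}`, whose derivative of order `N - i` is constant; the columns without a
    -- particle take the rows of the top level.
    if h : (p.2 : ℕ) < p.1 then
      Sum.inl ⟨⟨p.1 - 1, (Nat.sub_le _ _).trans_lt p.1.isLt⟩, ⟨p.2, by simp only; omega⟩⟩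
    else Sum.inr p.1.rev
  | Sum.inr k => Sum.inl ⟨Fin.last N, k⟩

theorem rowMatch_of_not_lt {N : ℕ} {p : PatternIndex (N + 1)} (h : ¬ (p.2 : ℕ) < p.1) :
    rowMatch (Sum.inl p) = Sum.inr p.1.rev := dif_neg h

theorem rowMatch_injective {N : ℕ} : Function.Injective (rowMatch (N := N)) := by
  rintro (p | k) (q | m) h
  · have hp := p.2.isLt
    have hq := q.2.isLt
    simp only [rowMatch] at h
    split_ifs at h with h1 h2 h2
    · have h3 := PatternIndex.ext_iff.1 (Sum.inl_injective h)
      simp only at h3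
      exact congrArg _ (PatternIndex.ext_iff.2 ⟨by omega, h3.2⟩)
    · have h3 := congrArg Fin.val (Fin.rev_injective (Sum.inr_injective h))
      exact congrArg _ (PatternIndex.ext_iff.2 ⟨h3, by omega⟩)
  · have hp := p.2.isLt
    have hp' := p.1.isLt
    simp only [rowMatch] at h
    split_ifs at h with h1
    have h3 := (PatternIndex.ext_iff.1 (Sum.inl_injective h)).1
    simp only [Fin.val_last] at h3
    omega
  · have hq := q.2.isLt
    have hq' := q.1.isLt
    simp only [rowMatch] at h
    split_ifs at h with h1
    have h3 := (PatternIndex.ext_iff.1 (Sum.inl_injective h)).1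
    simp only [Fin.val_last] at h3
    omega
  · simp only [rowMatch] at h
    exact congrArg _ (Fin.ext (PatternIndex.ext_iff.1 (Sum.inl_injective h)).2)

/-- `rowMatch` as a permutation. -/
def rowPerm (N : ℕ) : Equiv.Perm (PatternIndex (N + 1) ⊕ Fin (N + 1)) :=
  Equiv.ofBijective rowMatch (Finite.injective_iff_bijective.1 rowMatch_injective)

/-- The block of a column. -/
def colBlock {N : ℕ} : PatternIndex (N + 1) ⊕ Fin (N + 1) → Fin (N + 2)
  | Sum.inl p => p.1.castSucc
  | Sum.inr _ => Fin.last (N + 1)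

section

variable {V : ℝ → ℝ} {ψ : ℕ → ℝ[X]} {c : ℕ → ℝ} {N : ℕ}

/-- The matrix whose Schur complement is the kernel matrix of a pattern. -/
def extMatrix (V : ℝ → ℝ) (ψ : ℕ → ℝ[X]) (c : ℕ → ℝ) {N : ℕ} (y : Pattern (N + 1)) :
    Matrix (PatternIndex (N + 1) ⊕ Fin (N + 1)) (PatternIndex (N + 1) ⊕ Fin (N + 1)) ℝ :=
  Matrix.fromBlocks (-transMatrix Sigma.fst fun p => y p.1 p.2)
    (leftMatrix V ψ c Sigma.fst fun p => y p.1 p.2)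
    (-rightMatrix ψ Sigma.fst fun p => y p.1 p.2) 1

/-- The Schur complement of the identity corner is `-T - L (-R) = L R - T`. -/
theorem IsMonicOrthogonal.det_extMatrix (hψ : IsMonicOrthogonal V ψ c) (y : Pattern (N + 1)) :
    (extMatrix V ψ c y).det = (corrMatrix V ψ c Sigma.fst fun p : PatternIndex (N + 1) =>
      y p.1 p.2).det := by
  rw [extMatrix, Matrix.det_fromBlocks_one₂₂, hψ.corrMatrix_eq, Matrix.mul_neg]
  congr 1
  abel

/-- Two vanishing rules suffice: a transition to the same or a lower level is zero, and a derivative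
of order above the degree is zero. -/
theorem IsMonicOrthogonal.blockTriangular_extMatrix (hψ : IsMonicOrthogonal V ψ c)
    (y : Pattern (N + 1)) :
    ((extMatrix V ψ c y).submatrix (rowPerm N) id).BlockTriangular colBlock := by
  rintro q (p | j) h
  · rw [Matrix.submatrix_apply]
    change extMatrix V ψ c y (rowMatch q) (Sum.inl p) = 0
    obtain q | k := q
    · have h1 : (p.1 : ℕ) < q.1 := h
      have hq := q.2.isLt
      have hq' := q.1.isLt
      simp only [rowMatch]
      split_ifs with h2
      · rw [extMatrix, Matrix.fromBlocks_apply₁₁, Matrix.neg_apply, transMatrix_eq_zero, neg_zero]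
        rw [Fin.le_def]
        simp only
        omega
      · rw [extMatrix, Matrix.fromBlocks_apply₂₁, Matrix.neg_apply, hψ.rightMatrix_eq_zero,
          neg_zero]
        rw [Fin.val_rev]
        omega
    · rw [rowMatch, extMatrix, Matrix.fromBlocks_apply₁₁, Matrix.neg_apply, transMatrix_eq_zero,
        neg_zero]
      exact Fin.le_last _
  · exact absurd h (not_lt.2 (Fin.le_last _))

/-- The columns of one level. -/
def levelEquiv {N : ℕ} (i : Fin (N + 1)) :
    Fin ((i : ℕ) + 1) ≃ {q : PatternIndex (N + 1) ⊕ Fin (N + 1) // colBlock q = i.castSucc} :=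
  Equiv.ofBijective (fun k => ⟨Sum.inl ⟨i, k⟩, rfl⟩) (by
    constructor
    · intro k m h
      have h1 := Sum.inl_injective (Subtype.ext_iff.1 h)
      exact Fin.ext (PatternIndex.ext_iff.1 h1).2
    · rintro ⟨⟨i', k⟩ | k, h⟩
      · obtain rfl : i' = i := Fin.castSucc_injective _ h
        exact ⟨k, rfl⟩
      · exact absurd h (Fin.castSucc_lt_last i).ne')

/-- The columns that do not belong to a particle. -/
def lastEquiv (N : ℕ) :
    Fin (N + 1) ≃ {q : PatternIndex (N + 1) ⊕ Fin (N + 1) // colBlock q = Fin.last (N + 1)} :=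
  Equiv.ofBijective (fun k => ⟨Sum.inr k, rfl⟩) (by
    constructor
    · intro k m h
      exact Sum.inr_injective (Subtype.ext_iff.1 h)
    · rintro ⟨p | k, h⟩
      · exact absurd h (Fin.castSucc_lt_last p.1).ne
      · exact ⟨k, rfl⟩)

theorem IsMonicOrthogonal.eval_iterate_derivative_self (hψ : IsMonicOrthogonal V ψ c) (j : ℕ)
    (x : ℝ) : (derivative^[j] (ψ j)).eval x = j.factorial := by
  have h := natDegree_iterate_derivative (ψ j) j
  have h1 := (hψ.monic j).coeff_natDegree
  rw [hψ.natDegree] at h h1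
  rw [eq_C_of_natDegree_le_zero (h.trans (Nat.sub_self j).le), eval_C, coeff_iterate_derivative,
    zero_add, Nat.descFactorial_self, h1, nsmul_eq_mul, mul_one]

theorem IsMonicOrthogonal.det_block_zero (hψ : IsMonicOrthogonal V ψ c) (y : Pattern (N + 1)) :
    (((extMatrix V ψ c y).submatrix (rowPerm N) id).toSquareBlock colBlock
      (0 : Fin (N + 1)).castSucc).det = -(N.factorial : ℝ) := by
  rw [← Matrix.det_submatrix_equiv_self (levelEquiv (0 : Fin (N + 1)))]
  refine (Matrix.det_fin_one _).trans ?_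
  change extMatrix V ψ c y (rowMatch (Sum.inl ⟨0, 0⟩)) (Sum.inl ⟨0, 0⟩) = _
  rw [rowMatch_of_not_lt (lt_irrefl _), extMatrix, Matrix.fromBlocks_apply₂₁, Matrix.neg_apply,
    rightMatrix, Matrix.of_apply]
  have := hψ.eval_iterate_derivative_self N (y 0 0)
  simpa using this

/-- Between consecutive levels the transition kernel has exponent `0` and is a mere comparison of
positions, while the surplus row is a constant factorial. Up to row factors this is the comparison
matrix. -/
theorem IsMonicOrthogonal.det_block_succ (hψ : IsMonicOrthogonal V ψ c) {y : Pattern (N + 1)}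
    (hy : ∀ i, StrictAnti (y i))
    (hinj : Function.Injective fun p : PatternIndex (N + 1) => y p.1 p.2) (i : Fin N) :
    (((extMatrix V ψ c y).submatrix (rowPerm N) id).toSquareBlock colBlock
      i.succ.castSucc).det =
      (∏ k : Fin ((i : ℕ) + 2), if (k : ℕ) < i + 1 then (-1 : ℝ) else
        -((N - (i + 1)).factorial : ℝ)) *
      (open Classical in if Interlaced (y i.castSucc) (y i.succ) then 1 else 0) := by
  rw [← Matrix.det_submatrix_equiv_self (levelEquiv i.succ),
    ← det_comparison_eq_ite (hy i.castSucc) (hy i.succ) (fun k j h => by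
      have h1 := PatternIndex.ext_iff.1 (@hinj ⟨i.castSucc, k⟩ ⟨i.succ, j⟩ h)
      simp at h1), ← Matrix.det_mul_column]
  congr 1
  ext k j
  change extMatrix V ψ c y (rowMatch (Sum.inl ⟨i.succ, k⟩)) (Sum.inl ⟨i.succ, j⟩) = _
  have hi := i.isLt
  simp only [rowMatch, Matrix.of_apply]
  by_cases hk : (k : ℕ) < i + 1
  · rw [dif_pos (show (k : ℕ) < (i.succ : ℕ) from hk), extMatrix, Matrix.fromBlocks_apply₁₁,
      Matrix.neg_apply, transMatrix, Matrix.of_apply, if_pos hk,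
      dif_pos (show (k : ℕ) < (i.castSucc : ℕ) + 1 from hk), transition]
    have h1 : N + 1 - ((i : ℕ) + 1 + 1) < N + 1 - ((i : ℕ) + 1) := by omega
    have h2 : N + 1 - ((i : ℕ) + 1) - (N + 1 - ((i : ℕ) + 1 + 1)) - 1 = 0 := by omega
    change -(if N + 1 - ((i : ℕ) + 1 + 1) < N + 1 - ((i : ℕ) + 1) ∧
      y i.castSucc ⟨k, hk⟩ < y i.succ j then (y i.succ j - y i.castSucc ⟨k, hk⟩) ^
        (N + 1 - ((i : ℕ) + 1) - (N + 1 - ((i : ℕ) + 1 + 1)) - 1) /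
        ((N + 1 - ((i : ℕ) + 1) - (N + 1 - ((i : ℕ) + 1 + 1)) - 1).factorial : ℝ) else 0) = _
    rw [h2, pow_zero, Nat.factorial_zero, Nat.cast_one, div_one, neg_one_mul]
    simp only [h1, true_and]
  · rw [dif_neg (show ¬ (k : ℕ) < (i.succ : ℕ) from hk), extMatrix, Matrix.fromBlocks_apply₂₁,
      Matrix.neg_apply, rightMatrix, Matrix.of_apply, if_neg hk,
      dif_neg (show ¬ (k : ℕ) < (i.castSucc : ℕ) + 1 from hk), mul_one]
    have := hψ.eval_iterate_derivative_self (N - (i + 1)) (y i.succ j)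
    rw [neg_inj, ← this, Fin.val_rev, Fin.val_succ, show N + 1 - ((i : ℕ) + 1 + 1) = N - (i + 1) by
      omega]

/-- At depth `0` there is no integration, so the block has entries `c_j^{-2} ψ_j(y_i) e^{-V(y_i)}`,
and monic polynomials of degrees `0, …, N` give a Vandermonde determinant. The product of `-1`
converts between the two orders of subtraction. -/
theorem IsMonicOrthogonal.det_block_last (hψ : IsMonicOrthogonal V ψ c) (y : Pattern (N + 1)) :
    (((extMatrix V ψ c y).submatrix (rowPerm N) id).toSquareBlock colBlock
      (Fin.last (N + 1))).det =
      ((∏ j : Fin (N + 1), (c j ^ 2)⁻¹) * ∏ i : Fin (N + 1), ∏ _j ∈ Finset.Ioi i, (-1 : ℝ)) *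
        (vandermonde y.top * ∏ i, Real.exp (-V (y.top i))) := by
  have hv : vandermonde y.top = (∏ i : Fin (N + 1), ∏ _j ∈ Finset.Ioi i, (-1 : ℝ)) *
      (Matrix.vandermonde y.top).det := by
    rw [Matrix.det_vandermonde, vandermonde, ← Finset.prod_mul_distrib]
    refine Finset.prod_congr rfl fun i _ => ?_
    rw [← Finset.prod_mul_distrib]
    exact Finset.prod_congr rfl fun j _ => by ring
  have hs : (∏ i : Fin (N + 1), ∏ _j ∈ Finset.Ioi i, (-1 : ℝ)) *
      ∏ i : Fin (N + 1), ∏ _j ∈ Finset.Ioi i, (-1 : ℝ) = 1 := by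
    simp only [← Finset.prod_mul_distrib]
    simp
  rw [← Matrix.det_submatrix_equiv_self (lastEquiv N), hv,
    Matrix.det_eval_matrixOfPolynomials_eq_det_vandermonde y.top (fun j => ψ j)
      (fun j => hψ.natDegree j) (fun j => hψ.monic j)]
  have e : (((extMatrix V ψ c y).submatrix (rowPerm N) id).toSquareBlock colBlock
      (Fin.last (N + 1))).submatrix (lastEquiv N) (lastEquiv N) =
      Matrix.of fun i j : Fin (N + 1) => (c j ^ 2)⁻¹ * (Matrix.of fun i j : Fin (N + 1) =>
        Real.exp (-V (y.top i)) * (Matrix.of fun i j : Fin (N + 1) =>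
          (ψ j).eval (y.top i)) i j) i j := by
    ext k j
    change leftMatrix V ψ c Sigma.fst (fun p : PatternIndex (N + 1) => y p.1 p.2)
      ⟨Fin.last N, k⟩ j = _
    simp only [leftMatrix, Matrix.of_apply, Fin.val_last, Nat.sub_self, tailInt]
    rw [mul_comm (Real.exp _)]
    rfl
  rw [e, Matrix.det_mul_row, Matrix.det_mul_column]
  linear_combination (-(∏ j : Fin (N + 1), (c j ^ 2)⁻¹) *
    (∏ i, Real.exp (-V (y.top i))) * (Matrix.of fun i j : Fin (N + 1) =>
          (ψ j).eval (y.top i)).det) * hs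

theorem mem_gtPatterns_iff {y : Pattern (N + 1)} (hy : ∀ i, StrictAnti (y i)) :
    y ∈ gtPatterns (N + 1) ↔ ∀ i : Fin N, Interlaced (y i.castSucc) (y i.succ) :=
  ⟨fun h i => h.2 i (Nat.succ_lt_succ i.isLt),
    fun h => ⟨fun i => (hy i).antitone, fun i hi => h ⟨i, Nat.lt_of_succ_lt_succ hi⟩⟩⟩

/-- At a generic pattern with decreasing levels, the determinant of the kernel matrix is
proportional to the density of the eigenvalue minor process. -/
theorem IsMonicOrthogonal.exists_det_corrMatrix_eq (hψ : IsMonicOrthogonal V ψ c) (N : ℕ) :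
    ∃ C : ℝ, ∀ y : Pattern (N + 1), (∀ i, StrictAnti (y i)) →
      (Function.Injective fun p : PatternIndex (N + 1) => y p.1 p.2) →
      (corrMatrix V ψ c Sigma.fst fun p : PatternIndex (N + 1) => y p.1 p.2).det =
        C * (gtPatterns (N + 1)).indicator
          (fun y => vandermonde y.top * ∏ i, Real.exp (-V (y.top i))) y := by
  classical
  have hs : ∀ y : Pattern (N + 1), (extMatrix V ψ c y).det =
      (Equiv.Perm.sign (rowPerm N) : ℝ) *
        ((extMatrix V ψ c y).submatrix (rowPerm N) id).det := fun y => by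
    rw [Matrix.det_permute, ← mul_assoc]
    norm_cast
    simp [Int.units_mul_self]
  -- Only independence of `y` matters; the total mass of the process determines the value.
  refine ⟨(Equiv.Perm.sign (rowPerm N) : ℝ) * ((-(N.factorial : ℝ)) *
    (∏ i : Fin N, ∏ k : Fin ((i : ℕ) + 2), if (k : ℕ) < i + 1 then (-1 : ℝ) else
        -((N - (i + 1)).factorial : ℝ)) *
    ((∏ j : Fin (N + 1), (c j ^ 2)⁻¹) * ∏ i : Fin (N + 1), ∏ _j ∈ Finset.Ioi i, (-1 : ℝ))),
    fun y hy hinj => ?_⟩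
  rw [← hψ.det_extMatrix, hs, (hψ.blockTriangular_extMatrix y).det_fintype, Fin.prod_univ_castSucc,
    Fin.prod_univ_succ, hψ.det_block_last, hψ.det_block_zero]
  simp only [hψ.det_block_succ hy hinj]
  rw [Finset.prod_mul_distrib, Fintype.prod_ite_zero, Finset.prod_const_one, Set.indicator]
  simp only [mem_gtPatterns_iff hy]
  split_ifs <;> ring

end

end

section

/-! ## Integrating out one particle -/

section

variable {V : ℝ → ℝ} {ψ : ℕ → ℝ[X]} {c : ℕ → ℝ} {n : ℕ}

theorem corrMatrix_submatrix {ι κ : Type*} (l : ι → Fin n) (u : ι → ℝ) (e : κ → ι) :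
    (corrMatrix V ψ c l u).submatrix e e = corrMatrix V ψ c (l ∘ e) (u ∘ e) := rfl

theorem corrMatrix_sumElim {ι : Type*} (l : ι → Fin n) (u : ι → ℝ) (s : Fin n) (v : ℝ) :
    corrMatrix V ψ c (Sum.elim l fun _ : Unit => s) (Sum.elim u fun _ => v) =
      bordered (corrMatrix V ψ c l u)
        (fun i => minorKernel V ψ c n (n - (l i + 1)) (n - (s + 1)) (u i) v)
        (fun j => minorKernel V ψ c n (n - (s + 1)) (n - (l j + 1)) v (u j))
        (minorKernel V ψ c n (n - (s + 1)) (n - (s + 1)) v v) := by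
  ext (i | i) (j | j) <;> rfl

/-- Expand the bordered determinant: the corner integrates to the trace `s + 1`, and the products of
border entries to multiples of entries of `A` by the convolution identity. -/
theorem IsMonicOrthogonal.integral_det_corrMatrix_sumElim (hψ : IsMonicOrthogonal V ψ c)
    (hV : Continuous V) {ι : Type*} [Fintype ι] [DecidableEq ι] (l : ι → Fin n) (u : ι → ℝ)
    (s : Fin n) :
    Integrable (fun v => (corrMatrix V ψ c (Sum.elim l fun _ : Unit => s)
      (Sum.elim u fun _ => v)).det) ∧
    ∫ v, (corrMatrix V ψ c (Sum.elim l fun _ : Unit => s) (Sum.elim u fun _ => v)).det =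
      ((s : ℝ) + 1 - (Finset.univ.filter fun i => l i = s).card) *
        (corrMatrix V ψ c l u).det := by
  set A := corrMatrix V ψ c l u with hA
  have hs := s.isLt
  have hconv : ∀ i j, Integrable (fun v =>
      minorKernel V ψ c n (n - (l i + 1)) (n - (s + 1)) (u i) v *
        minorKernel V ψ c n (n - (s + 1)) (n - (l j + 1)) v (u j)) ∧
      ∫ v, minorKernel V ψ c n (n - (l i + 1)) (n - (s + 1)) (u i) v *
        minorKernel V ψ c n (n - (s + 1)) (n - (l j + 1)) v (u j) =
      A i j * ((if s ≤ l i then 1 else 0) - if s < l j then 1 else 0) := fun i j => by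
    have h := hψ.integral_minorKernel_mul (n := n) hV (a := n - (l i + 1)) (b := n - (s + 1))
      (d := n - (l j + 1)) (by omega) (by omega) (u i) (u j)
    have hi := (l i).isLt
    have hj := (l j).isLt
    have e1 : n - ((l i : ℕ) + 1) ≤ n - ((s : ℕ) + 1) ↔ s ≤ l i := by
      rw [Fin.le_def]; omega
    have e2 : n - ((l j : ℕ) + 1) < n - ((s : ℕ) + 1) ↔ s < l j := by
      rw [Fin.lt_def]; omega
    simp only [e1, e2] at h
    exact h
  obtain ⟨ht1, ht2⟩ := hψ.integral_minorKernel_self (n := n) hV (b := n - (s + 1)) (by omega)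
  have e : ∀ v, (corrMatrix V ψ c (Sum.elim l fun _ : Unit => s) (Sum.elim u fun _ => v)).det =
      minorKernel V ψ c n (n - (s + 1)) (n - (s + 1)) v v * A.det -
        ∑ j, ∑ i, A.adjugate j i *
          (minorKernel V ψ c n (n - (l i + 1)) (n - (s + 1)) (u i) v *
            minorKernel V ψ c n (n - (s + 1)) (n - (l j + 1)) v (u j)) := fun v => by
    rw [corrMatrix_sumElim, det_bordered]
    congr 1
    simp only [dotProduct, Matrix.mulVec, Finset.mul_sum]
    exact Finset.sum_congr rfl fun j _ => Finset.sum_congr rfl fun i _ => by ring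
  simp only [e]
  have hi : ∀ j ∈ (Finset.univ : Finset ι), Integrable fun v => ∑ i, A.adjugate j i *
      (minorKernel V ψ c n (n - (l i + 1)) (n - (s + 1)) (u i) v *
        minorKernel V ψ c n (n - (s + 1)) (n - (l j + 1)) v (u j)) := fun j _ =>
    integrable_finsetSum _ fun i _ => (hconv i j).1.const_mul _
  refine ⟨(ht1.mul_const _).sub (integrable_finsetSum _ hi), ?_⟩
  rw [integral_sub (ht1.mul_const _) (integrable_finsetSum _ hi), integral_mul_const, ht2,
    integral_finsetSum _ hi]
  have h1 : ∀ j, ∫ v, ∑ i, A.adjugate j i *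
      (minorKernel V ψ c n (n - (l i + 1)) (n - (s + 1)) (u i) v *
        minorKernel V ψ c n (n - (s + 1)) (n - (l j + 1)) v (u j)) =
      ∑ i, A.adjugate j i * (A i j *
        ((if s ≤ l i then 1 else 0) - if s < l j then 1 else 0)) := fun j => by
    rw [integral_finsetSum _ fun i _ => (hconv i j).1.const_mul _]
    exact Finset.sum_congr rfl fun i _ => by rw [integral_const_mul, (hconv i j).2]
  simp only [h1]
  have h2 : ∀ i, ∑ j, A i j * A.adjugate j i = A.det := fun i => by
    rw [← Matrix.mul_apply, Matrix.mul_adjugate]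
    simp
  have h3 : ∀ j, ∑ i, A.adjugate j i * A i j = A.det := fun j => by
    rw [← Matrix.mul_apply, Matrix.adjugate_mul]
    simp
  -- Each indicator depends on one index only, so summing over the other one gives `det A`. What
  -- remains is the sum over `i` of `[s ≤ l i] - [s < l i]`, the number of particles at level `s`.
  have h4 : ∑ j, ∑ i, A.adjugate j i * (A i j *
      ((if s ≤ l i then 1 else 0) - if s < l j then 1 else 0)) =
      (Finset.univ.filter fun i => l i = s).card * A.det := by
    simp only [← mul_assoc, mul_sub, Finset.sum_sub_distrib, ← Finset.sum_mul, h3]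
    rw [Finset.sum_comm]
    simp only [← Finset.sum_mul, mul_comm (A.adjugate _ _), h2]
    rw [← Finset.sum_sub_distrib, Finset.card_filter, Nat.cast_sum, Finset.sum_mul]
    refine Finset.sum_congr rfl fun i _ => ?_
    rcases lt_trichotomy (l i) s with h | h | h
    · simp [not_le.2 h, not_lt.2 h.le, h.ne]
    · simp [h]
    · simp [h.le, h, h.ne']
  rw [h4, show n - (n - ((s : ℕ) + 1)) = s + 1 by omega]
  push_cast
  ring

theorem IsMonicOrthogonal.integral_det_corrMatrix_cons (hψ : IsMonicOrthogonal V ψ c)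
    (hV : Continuous V) {m : ℕ} (l : Fin m → Fin n) (u : Fin m → ℝ) (s : Fin n) :
    ∫ v, (corrMatrix V ψ c (Fin.cons s l : Fin (m + 1) → Fin n) (Fin.cons v u)).det =
      ((s : ℝ) + 1 - (Finset.univ.filter fun i => l i = s).card) *
        (corrMatrix V ψ c l u).det := by
  rw [← (hψ.integral_det_corrMatrix_sumElim hV l u s).2]
  let e : Fin m ⊕ Unit ≃ Fin (m + 1) :=
    ((finSuccEquiv m).trans (Equiv.optionEquivSumPUnit (Fin m))).symm
  refine integral_congr_ae (Filter.Eventually.of_forall fun v => ?_)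
  simp only
  rw [← Matrix.det_submatrix_equiv_self e, corrMatrix_submatrix]
  congr 2 <;>
  · funext i
    rcases i with i | i <;> simp [e]

end

end

/-! ## Factorial moments with prescribed levels -/

/-- The positions of the particles with labels `f k`. -/
def readOff {m n : ℕ} (f : Fin m → PatternIndex n) (y : Pattern n) : Fin m → ℝ :=
  fun k => y (f k).1 (f k).2

theorem measurable_readOff {m n : ℕ} (f : Fin m → PatternIndex n) : Measurable (readOff f) :=
  measurable_pi_lambda _ fun _ => (measurable_pi_apply _).comp (measurable_pi_apply _)

/-- The expected number of tuples of distinct particles at the levels `l` with positions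
in `B`. -/
def levelMoment {m n : ℕ} (ν : Measure (Pattern n)) (l : Fin m → Fin n) (B : Set (Fin m → ℝ)) :
    ℝ :=
  ∑ f : Fin m ↪ PatternIndex n, if ∀ k, (f k).1 = l k then ν.real (readOff f ⁻¹' B) else 0

theorem sum_patternIndex_ite {n : ℕ} (s : Fin n) :
    ∑ i : PatternIndex n, (if i.1 = s then (1 : ℝ) else 0) = s + 1 := by
  rw [Fintype.sum_sigma, Finset.sum_eq_single s]
  · simp
  · intro i _ hi
    simp [hi]
  · simp

/-- The counterpart for moments: once labels for `l` are chosen, the new particle may be any of the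
`s + 1` particles of level `s` not yet used. -/
theorem levelMoment_cons {m n : ℕ} (ν : Measure (Pattern n)) (l : Fin m → Fin n) (s : Fin n)
    (B : Set (Fin m → ℝ)) :
    levelMoment ν (Fin.cons s l : Fin (m + 1) → Fin n) {u | Fin.tail u ∈ B} =
      ((s : ℝ) + 1 - (Finset.univ.filter fun i => l i = s).card) * levelMoment ν l B := by
  rw [levelMoment, ← (Equiv.embeddingFinSucc m (PatternIndex n)).symm.sum_comp, Fintype.sum_sigma,
    levelMoment, Finset.mul_sum]
  refine Finset.sum_congr rfl fun g _ => ?_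
  have h1 : ∀ i : {i // i ∉ Set.range g},
      (if ∀ k, ((Equiv.embeddingFinSucc m (PatternIndex n)).symm ⟨g, i⟩ k).1 =
        (Fin.cons s l : Fin (m + 1) → Fin n) k then
        ν.real (readOff ((Equiv.embeddingFinSucc m (PatternIndex n)).symm ⟨g, i⟩) ⁻¹'
          {u | Fin.tail u ∈ B}) else 0) =
      (if i.1.1 = s then 1 else 0) *
        (if ∀ k, (g k).1 = l k then ν.real (readOff g ⁻¹' B) else 0) := fun i => by
    have h2 : readOff ((Equiv.embeddingFinSucc m (PatternIndex n)).symm ⟨g, i⟩) ⁻¹'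
        {u | Fin.tail u ∈ B} = readOff g ⁻¹' B := rfl
    have h3 : (∀ k, ((Equiv.embeddingFinSucc m (PatternIndex n)).symm ⟨g, i⟩ k).1 =
        (Fin.cons s l : Fin (m + 1) → Fin n) k) ↔ i.1.1 = s ∧ ∀ k, (g k).1 = l k := by
      rw [Fin.forall_fin_succ]
      rfl
    rw [h2]
    simp only [h3]
    by_cases h4 : i.1.1 = s <;> simp [h4]
  rw [Finset.sum_congr rfl fun i _ => h1 i, ← Finset.sum_mul]
  split_ifs with hg
  · congr 1
    have h2 := Fintype.sum_subtype_add_sum_subtype (fun i => i ∈ Set.range g)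
      (fun i : PatternIndex n => if i.1 = s then (1 : ℝ) else 0)
    rw [sum_patternIndex_ite] at h2
    have h3 : ∑ i : {i // i ∈ Set.range g}, (if i.1.1 = s then (1 : ℝ) else 0) =
        (Finset.univ.filter fun i => l i = s).card := by
      rw [← (Equiv.ofInjective g g.injective).sum_comp, Finset.card_filter, Nat.cast_sum]
      refine Finset.sum_congr rfl fun k _ => ?_
      rw [Equiv.ofInjective_apply, hg k]
      split_ifs <;> simp
    rw [← h3, eq_sub_iff_add_eq']
    convert h2
  · rw [mul_zero, mul_zero]

theorem levelMoment_eq_zero {m n : ℕ} (ν : Measure (Pattern n)) (l : Fin m → Fin n)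
    (B : Set (Fin m → ℝ)) {s : Fin n}
    (h : (s : ℕ) + 1 < (Finset.univ.filter fun i => l i = s).card) : levelMoment ν l B = 0 := by
  refine Finset.sum_eq_zero fun f _ => if_neg fun hf => ?_
  have h1 : (Finset.univ.filter fun i => l i = s).card ≤
      (Finset.univ : Finset (Fin ((s : ℕ) + 1))).card := by
    refine Finset.card_le_card_of_injOn (fun k => Fin.ofNat _ (f k).2) (fun _ _ => Finset.mem_univ _) ?_
    intro k hk k' hk' hkk
    have e1 := hf k
    have e2 := hf k'
    simp only [Finset.coe_filter, Finset.mem_univ, true_and, Set.mem_ofPred_eq] at hk hk'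
    rw [hk] at e1
    rw [hk'] at e2
    have b1 := (f k).2.isLt
    have b2 := (f k').2.isLt
    have e3 := congrArg Fin.val e1
    have e4 := congrArg Fin.val e2
    have e5 := congrArg Fin.val hkk
    simp only [Fin.val_ofNat] at e5
    rw [Nat.mod_eq_of_lt (by omega), Nat.mod_eq_of_lt (by omega)] at e5
    exact f.injective (PatternIndex.ext_iff.2 ⟨by omega, e5⟩)
  rw [Finset.card_univ, Fintype.card_fin] at h1
  omega

/-! ## Full configurations -/

theorem sum_card_filter_eq {m n : ℕ} (l : Fin m → Fin n) :
    ∑ s, (Finset.univ.filter fun i => l i = s).card = m := by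
  rw [← Finset.card_eq_sum_card_fiberwise fun _ _ => Finset.mem_univ _, Finset.card_univ,
    Fintype.card_fin]

theorem card_patternIndex (n : ℕ) : Fintype.card (PatternIndex n) = ∑ s : Fin n, ((s : ℕ) + 1) := by
  rw [Fintype.card_sigma]
  simp

/-- The level sizes add up to `m`, so none of the inequalities can be strict. -/
theorem exists_equiv_of_card_le {m n : ℕ} {l : Fin m → Fin n}
    (hm : m = Fintype.card (PatternIndex n))
    (h : ∀ s, (Finset.univ.filter fun i => l i = s).card ≤ (s : ℕ) + 1) :
    ∃ e : Fin m ≃ PatternIndex n, ∀ k, (e k).1 = l k := by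
  have h1 : ∀ s, (Finset.univ.filter fun i => l i = s).card = (s : ℕ) + 1 := fun s =>
    (Finset.sum_eq_sum_iff_of_le (fun s _ => h s)).1
      ((sum_card_filter_eq l).trans (hm.trans (card_patternIndex n))) s (Finset.mem_univ s)
  refine ⟨(Equiv.sigmaFiberEquiv l).symm.trans (Equiv.sigmaCongrRight fun s =>
    Fintype.equivFinOfCardEq ((Fintype.card_subtype _).trans (h1 s))), fun k => rfl⟩

/-- The coordinates of a pattern in the order prescribed by `e`. -/
def patternCoord {m n : ℕ} (e : Fin m ≃ PatternIndex n) : Pattern n ≃ᵐ (Fin m → ℝ) where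
  toFun := readOff e
  invFun u i k := u (e.symm ⟨i, k⟩)
  left_inv y := by
    funext i k
    exact congrArg (fun p : PatternIndex n => y p.1 p.2) (e.apply_symm_apply _)
  right_inv u := by
    funext k
    simp [readOff]
  measurable_toFun := measurable_readOff e
  measurable_invFun := measurable_pi_lambda _ fun _ => measurable_pi_lambda _ fun _ =>
    measurable_pi_apply _

theorem patternCoord_symm_apply {m n : ℕ} (e : Fin m ≃ PatternIndex n) (u : Fin m → ℝ) (i : Fin n)
    (k : Fin ((i : ℕ) + 1)) : (patternCoord e).symm u i k = u (e.symm ⟨i, k⟩) := rfl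

theorem measurePreserving_patternCoord {m n : ℕ} (e : Fin m ≃ PatternIndex n) :
    MeasurePreserving (patternCoord e) := by
  refine ⟨(patternCoord e).measurable, (Measure.pi_eq fun s hs => ?_).symm⟩
  rw [Measure.map_apply (patternCoord e).measurable (MeasurableSet.univ_pi hs)]
  have h : patternCoord e ⁻¹' Set.univ.pi s =
      Set.univ.pi fun i : Fin n => Set.univ.pi fun k : Fin ((i : ℕ) + 1) => s (e.symm ⟨i, k⟩) := by
    ext y
    simp only [Set.mem_preimage, Set.mem_univ_pi]
    constructor
    · intro h i k
      have h1 : y i k = patternCoord e y (e.symm ⟨i, k⟩) :=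
        congrArg (fun p : PatternIndex n => y p.1 p.2) (e.apply_symm_apply ⟨i, k⟩).symm
      rw [h1]
      exact h _
    · intro h k
      have h1 := h (e k).1 (e k).2
      rwa [show e.symm ⟨(e k).1, (e k).2⟩ = k from e.symm_apply_apply k] at h1
  rw [h, volume_pi_pi]
  simp only [volume_pi_pi]
  rw [← e.symm.prod_comp, Fintype.prod_sigma]

theorem exists_equiv_strictAnti {m n : ℕ} (e₀ : Fin m ≃ PatternIndex n) {u : Fin m → ℝ}
    (hu : Function.Injective u) : ∃ e : Fin m ≃ PatternIndex n, (∀ k, (e k).1 = (e₀ k).1) ∧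
      ∀ i, StrictAnti ((patternCoord e).symm u i) := by
  set y := (patternCoord e₀).symm u with hy
  refine ⟨e₀.trans (Equiv.sigmaCongrRight fun i => (Tuple.sort fun k => -y i k).symm),
    fun k => rfl, fun i => ?_⟩
  have h1 := Tuple.monotone_sort fun k => -y i k
  have h2 : Antitone ((patternCoord (e₀.trans
      (Equiv.sigmaCongrRight fun i => (Tuple.sort fun k => -y i k).symm))).symm u i) :=
    fun k k' hk => neg_le_neg_iff.1 (h1 hk)
  refine h2.strictAnti_of_injective fun k k' hk => ?_
  have h3 := Equiv.injective _ (hu hk)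
  exact Fin.ext (PatternIndex.ext_iff.1 h3).2

theorem equiv_eq_of_strictAnti {m n : ℕ} {e e' : Fin m ≃ PatternIndex n} {u : Fin m → ℝ}
    (hu : Function.Injective u) (h : ∀ k, (e k).1 = (e' k).1)
    (he : ∀ i, StrictAnti ((patternCoord e).symm u i))
    (he' : ∀ i, StrictAnti ((patternCoord e').symm u i)) : e = e' := by
  have hr : ∀ (e : Fin m ≃ PatternIndex n) (i : Fin n),
      Set.range ((patternCoord e).symm u i) = u '' {k | (e k).1 = i} := fun e i => by
    ext x
    constructor
    · rintro ⟨k, rfl⟩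
      exact ⟨e.symm ⟨i, k⟩, by simp, rfl⟩
    · rintro ⟨k, rfl, rfl⟩
      exact ⟨(e k).2, by rw [patternCoord_symm_apply]; simp⟩
  have h1 : ∀ i, (patternCoord e).symm u i = (patternCoord e').symm u i := fun i => by
    rw [← (he i).range_inj (he' i), hr, hr]
    simp only [h]
  have h3 : e.symm = e'.symm := Equiv.ext fun p => hu (congrFun (h1 p.1) p.2)
  rw [← Equiv.symm_symm e, h3, Equiv.symm_symm]

section

/-! ## The correlation functions at prescribed levels -/

/-- The density of the eigenvalue minor process on the space of patterns, not normalised. -/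
def gtDensity (V : ℝ → ℝ) {n : ℕ} (y : Pattern n) : ℝ :=
  (gtPatterns n).indicator (fun y => vandermonde y.top * ∏ i, Real.exp (-V (y.top i))) y

section

variable {V : ℝ → ℝ} {ψ : ℕ → ℝ[X]} {c : ℕ → ℝ} {N : ℕ}

/-- For distinct positions exactly one labelling with the given levels is decreasing on each level.
The other terms vanish, and relabelling does not change the determinant. -/
theorem det_corrMatrix_eq_sum {C : ℝ} (hC : ∀ y : Pattern (N + 1), (∀ i, StrictAnti (y i)) →
      (Function.Injective fun p : PatternIndex (N + 1) => y p.1 p.2) →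
      (corrMatrix V ψ c Sigma.fst fun p : PatternIndex (N + 1) => y p.1 p.2).det =
        C * gtDensity V y) {m : ℕ} {l : Fin m → Fin (N + 1)}
    {e₀ : Fin m ≃ PatternIndex (N + 1)} (he₀ : ∀ k, (e₀ k).1 = l k) {u : Fin m → ℝ}
    (hu : Function.Injective u) : (corrMatrix V ψ c l u).det =
      C * ∑ e : Fin m ≃ PatternIndex (N + 1), if ∀ k, (e k).1 = l k then
        gtDensity V ((patternCoord e).symm u) else 0 := by
  obtain ⟨e, hel, he⟩ := exists_equiv_strictAnti e₀ hu
  simp only [he₀] at hel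
  have hinj : ∀ e : Fin m ≃ PatternIndex (N + 1), Function.Injective fun p : PatternIndex (N + 1) =>
      (patternCoord e).symm u p.1 p.2 := fun e => hu.comp e.symm.injective
  rw [Finset.sum_eq_single e, if_pos hel, ← hC _ he (hinj e), ← Matrix.det_submatrix_equiv_self
    e.symm, corrMatrix_submatrix]
  · congr 2
    funext p
    rw [Function.comp_apply, ← hel, Equiv.apply_symm_apply]
  · intro e' _ hne
    split_ifs with h
    · refine Set.indicator_of_notMem (fun hgt => hne ?_) _
      refine equiv_eq_of_strictAnti hu (fun k => (h k).trans (hel k).symm) (fun i => ?_) he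
      refine (hgt.1 i).strictAnti_of_injective fun k k' hk => ?_
      exact Fin.ext (PatternIndex.ext_iff.1 (@hinj e' ⟨i, k⟩ ⟨i, k'⟩ hk)).2
    · rfl
  · exact fun h => absurd (Finset.mem_univ _) h

/-- Full configurations. -/
theorem integral_det_corrMatrix_of_equiv {C : ℝ} (hC : ∀ y : Pattern (N + 1),
      (∀ i, StrictAnti (y i)) →
      (Function.Injective fun p : PatternIndex (N + 1) => y p.1 p.2) →
      (corrMatrix V ψ c Sigma.fst fun p : PatternIndex (N + 1) => y p.1 p.2).det =
        C * gtDensity V y) {ν : Measure (Pattern (N + 1))} {Z : ℝ}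
    (hi : Integrable (gtDensity V : Pattern (N + 1) → ℝ))
    (hν : ∀ S, MeasurableSet S → Z * ν.real S = ∫ y in S, gtDensity V y) {m : ℕ}
    {l : Fin m → Fin (N + 1)} {e₀ : Fin m ≃ PatternIndex (N + 1)} (he₀ : ∀ k, (e₀ k).1 = l k) :
    Integrable (fun u => (corrMatrix V ψ c l u).det) ∧ ∀ B, MeasurableSet B →
      C * Z * levelMoment ν l B = ∫ u in B, (corrMatrix V ψ c l u).det := by
  have hae : (fun u : Fin m → ℝ => (corrMatrix V ψ c l u).det) =ᵐ[volume] fun u =>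
      C * ∑ e : Fin m ≃ PatternIndex (N + 1), if ∀ k, (e k).1 = l k then
        gtDensity V ((patternCoord e).symm u) else 0 := by
    filter_upwards [ae_injective m] with u hu
    exact det_corrMatrix_eq_sum hC he₀ hu
  have hint : ∀ e : Fin m ≃ PatternIndex (N + 1), Integrable fun u : Fin m → ℝ =>
      if ∀ k, (e k).1 = l k then gtDensity V ((patternCoord e).symm u) else 0 := fun e => by
    split_ifs
    · exact (measurePreserving_patternCoord e).symm.integrable_comp_of_integrable hi
    · exact integrable_zero _ _ _
  refine ⟨((integrable_finsetSum _ fun e _ => hint e).const_mul C).congr hae.symm, fun B hB => ?_⟩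
  rw [integral_congr_ae (ae_restrict_of_ae hae), integral_const_mul,
    integral_finsetSum _ fun e _ => (hint e).integrableOn, mul_assoc, levelMoment, Finset.mul_sum]
  congr 1
  have hcard : Fintype.card (Fin m) = Fintype.card (PatternIndex (N + 1)) := Fintype.card_congr e₀
  -- In a full tuple every injective labelling is a bijection.
  refine (Fintype.sum_bijective (fun e : Fin m ≃ PatternIndex (N + 1) => e.toEmbedding)
    ⟨fun e e' h => Equiv.ext fun k => DFunLike.congr_fun h k, fun f => ⟨Equiv.ofBijective f
      ((Fintype.bijective_iff_injective_and_card f).2 ⟨f.injective, hcard⟩), Function.Embedding.ext fun _ => rfl⟩⟩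
    _ _ fun e => ?_).symm
  simp only [Equiv.coe_toEmbedding]
  split_ifs
  · have h := (measurePreserving_patternCoord e).setIntegral_preimage_emb
      (patternCoord e).measurableEmbedding (fun u => gtDensity V ((patternCoord e).symm u)) B
    rw [← h, hν _ (measurable_readOff e hB)]
    simp only [MeasurableEquiv.symm_apply_apply]
    rfl
  · rw [mul_zero, integral_zero]

/-- Downward induction on the number of points, with `k` points missing. Determinants and moments
satisfy the same recursion, and at full configurations overfilled levels make both sides zero. -/
theorem IsMonicOrthogonal.integral_det_corrMatrix (hψ : IsMonicOrthogonal V ψ c)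
    (hV : Continuous V) {C : ℝ} (hC : ∀ y : Pattern (N + 1),
      (∀ i, StrictAnti (y i)) →
      (Function.Injective fun p : PatternIndex (N + 1) => y p.1 p.2) →
      (corrMatrix V ψ c Sigma.fst fun p : PatternIndex (N + 1) => y p.1 p.2).det =
        C * gtDensity V y) {ν : Measure (Pattern (N + 1))} {Z : ℝ}
    (hi : Integrable (gtDensity V : Pattern (N + 1) → ℝ))
    (hν : ∀ S, MeasurableSet S → Z * ν.real S = ∫ y in S, gtDensity V y) (k : ℕ) :
    ∀ {m : ℕ} (l : Fin m → Fin (N + 1)), m + k = Fintype.card (PatternIndex (N + 1)) →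
    Integrable (fun u => (corrMatrix V ψ c l u).det) ∧ ∀ B, MeasurableSet B →
      C * Z * levelMoment ν l B = ∫ u in B, (corrMatrix V ψ c l u).det := by
  induction k with
  | zero =>
    intro m l hm
    by_cases h : ∃ s : Fin (N + 1), (s : ℕ) + 1 < (Finset.univ.filter fun i => l i = s).card
    · obtain ⟨s, hs⟩ := h
      simp only [hψ.det_corrMatrix_eq_zero l _ s hs, levelMoment_eq_zero ν l _ hs]
      simp
    · push Not at h
      obtain ⟨e, he⟩ := exists_equiv_of_card_le hm h
      exact integral_det_corrMatrix_of_equiv hC hi hν he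
  | succ k ih =>
    intro m l hm
    -- A level whose occupation number differs from `s + 1`; the factor gained by adding a particle
    -- there is nonzero and can be cancelled.
    obtain ⟨s, hs⟩ : ∃ s : Fin (N + 1),
        (Finset.univ.filter fun i => l i = s).card ≠ (s : ℕ) + 1 := by
      by_contra! h
      have h1 := sum_card_filter_eq l
      rw [Finset.sum_congr rfl fun s _ => h s, ← card_patternIndex] at h1
      omega
    obtain ⟨h1, h2⟩ := ih (Fin.cons s l : Fin (m + 1) → Fin (N + 1)) (by omega)
    have ha : (s : ℝ) + 1 - (Finset.univ.filter fun i => l i = s).card ≠ 0 := by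
      rw [sub_ne_zero]
      exact_mod_cast hs.symm
    have hp := (volume_preserving_piFinSuccAbove (fun _ : Fin (m + 1) => ℝ) 0).symm
    have hcons : ∀ p : ℝ × (Fin m → ℝ),
        (MeasurableEquiv.piFinSuccAbove (fun _ : Fin (m + 1) => ℝ) 0).symm p =
          Fin.cons p.1 p.2 := fun p => Fin.insertNth_zero' p.1 p.2
    have h3 := hp.integrable_comp_of_integrable h1
    simp only [Function.comp_def, hcons] at h3
    have h4 := h3.integral_prod_right
    simp only [hψ.integral_det_corrMatrix_cons hV] at h4
    have h5 : Integrable fun u : Fin m → ℝ => (corrMatrix V ψ c l u).det := by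
      refine (h4.const_mul ((s : ℝ) + 1 -
        (Finset.univ.filter fun i => l i = s).card)⁻¹).congr
        (Filter.Eventually.of_forall fun u => ?_)
      simp only
      rw [inv_mul_cancel_left₀ ha]
    refine ⟨h5, fun B hB => mul_left_cancel₀ ha ?_⟩
    -- The induction hypothesis is applied to the cylinder over `B`, which leaves the added particle
    -- unrestricted.
    have hB' : MeasurableSet {u : Fin (m + 1) → ℝ | Fin.tail u ∈ B} := by
      have : Measurable fun u : Fin (m + 1) → ℝ => Fin.tail u :=
        measurable_pi_lambda _ fun _ => measurable_pi_apply _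
      exact this hB
    have h6 := h2 _ hB'
    rw [levelMoment_cons, ← hp.setIntegral_preimage_emb (MeasurableEquiv.measurableEmbedding _)] at h6
    have h7 : (MeasurableEquiv.piFinSuccAbove (fun _ : Fin (m + 1) => ℝ) 0).symm ⁻¹'
        {u | Fin.tail u ∈ B} = Set.univ ×ˢ B := by
      ext p
      simp only [Set.mem_preimage, hcons, Set.mem_ofPred_eq, Set.mem_prod, Set.mem_univ, true_and,
        Fin.tail_cons]
    rw [h7] at h6
    simp only [hcons] at h6
    have h8 := h3.integrableOn (s := Set.univ ×ˢ B)
    rw [Measure.volume_eq_prod] at h6 h8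
    rw [IntegrableOn, ← Measure.prod_restrict] at h8
    rw [← Measure.prod_restrict, integral_prod_symm _ h8] at h6
    simp only [Measure.restrict_univ, hψ.integral_det_corrMatrix_cons hV] at h6
    rw [integral_const_mul] at h6
    rw [← h6]
    ring

/-- The factorial moments at prescribed levels. -/
theorem IsMonicOrthogonal.levelMoment_eq (hψ : IsMonicOrthogonal V ψ c)
    (hV : Continuous V) {ν : Measure (Pattern (N + 1))} [IsProbabilityMeasure ν] {Z : ℝ}
    (hi : Integrable (gtDensity V : Pattern (N + 1) → ℝ))
    (hν : ∀ S, MeasurableSet S → Z * ν.real S = ∫ y in S, gtDensity V y) {m : ℕ}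
    (l : Fin m → Fin (N + 1)) (hm : m ≤ Fintype.card (PatternIndex (N + 1))) :
    Integrable (fun u => (corrMatrix V ψ c l u).det) ∧ ∀ B, MeasurableSet B →
      levelMoment ν l B = ∫ u in B, (corrMatrix V ψ c l u).det := by
  obtain ⟨C, hC⟩ := hψ.exists_det_corrMatrix_eq N
  -- For the empty tuple the moment and the determinant are both `1`, which forces `C * Z = 1`.
  have h0 := (hψ.integral_det_corrMatrix hV hC hi hν (Fintype.card (PatternIndex (N + 1)))
    (Fin.elim0 : Fin 0 → Fin (N + 1)) (zero_add _)).2 Set.univ MeasurableSet.univ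
  have h1 : levelMoment ν (Fin.elim0 : Fin 0 → Fin (N + 1)) Set.univ = 1 := by
    rw [levelMoment, Fintype.sum_unique, if_pos fun k => k.elim0]
    simp
  have h2 : C * Z = 1 := by
    rw [h1, mul_one] at h0
    rw [h0]
    simp [measureReal_def, volume_pi]
  have h3 := hψ.integral_det_corrMatrix hV hC hi hν (Fintype.card (PatternIndex (N + 1)) - m) l
    (Nat.add_sub_cancel' hm)
  simpa only [h2, one_mul] using h3

end

end

section

/-! ## The eigenvalue minor process as a determinantal point field -/

/-- The points at the levels `l`. -/
def levelEmbedding {m n : ℕ} (l : Fin m → Fin n) (u : Fin m → ℝ) : Fin m → Fin n × ℝ :=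
  fun k => (l k, u k)

theorem measurable_levelEmbedding {m n : ℕ} (l : Fin m → Fin n) : Measurable (levelEmbedding l) :=
  measurable_pi_lambda _ fun _ => measurable_const.prodMk (measurable_pi_apply _)

theorem measurableEmbedding_levelEmbedding {m n : ℕ} (l : Fin m → Fin n) :
    MeasurableEmbedding (levelEmbedding l) := by
  refine MeasurableEmbedding.of_measurable_inverse (g := fun z k => (z k).2)
    (measurable_levelEmbedding l) ?_
    (measurable_pi_lambda _ fun _ => measurable_snd.comp (measurable_pi_apply _)) fun u => rfl
  have h : Set.range (levelEmbedding l) = ⋂ k, {z | (z k).1 = l k} := by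
    ext z
    simp only [Set.mem_range, Set.mem_iInter, Set.mem_ofPred_eq]
    constructor
    · rintro ⟨u, rfl⟩ k
      rfl
    · intro hz
      exact ⟨fun k => (z k).2, funext fun k => Prod.ext (hz k).symm rfl⟩
  rw [h]
  exact MeasurableSet.iInter fun k =>
    (measurable_fst.comp (measurable_pi_apply k)) (measurableSet_singleton (l k))

/-- Splitting by levels turns integration over `({1, …, n} × ℝ)^m` into a finite sum of Lebesgue
integrals, one for each choice of levels. -/
theorem pi_refMeasure (m n : ℕ) : Measure.pi (fun _ : Fin m => refMeasure n) =
    ∑ l : Fin m → Fin n, (volume : Measure (Fin m → ℝ)).map (levelEmbedding l) := by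
  have : SigmaFinite (refMeasure n) := by
    unfold refMeasure
    infer_instance
  refine Measure.pi_eq fun s hs => ?_
  have h1 : ∀ k, refMeasure n (s k) = ∑ i : Fin n, volume (Prod.mk i ⁻¹' s k) := fun k => by
    rw [refMeasure, Measure.prod_apply (hs k), lintegral_count, tsum_fintype]
  have h2 : ∀ l : Fin m → Fin n, (volume : Measure (Fin m → ℝ)).map (levelEmbedding l)
      (Set.univ.pi s) = ∏ k, volume (Prod.mk (l k) ⁻¹' s k) := fun l => by
    rw [Measure.map_apply (measurable_levelEmbedding l) (MeasurableSet.univ_pi hs), ← volume_pi_pi]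
    congr 1
  rw [Measure.finsetSum_apply, Finset.sum_congr rfl fun l _ => h2 l]
  simp only [h1]
  rw [Finset.prod_univ_sum, Fintype.piFinset_univ]

theorem factorialMoment_particles {m n : ℕ} (ν : Measure (Pattern n)) [IsFiniteMeasure ν]
    {B : Set (Fin m → Fin n × ℝ)} (hB : MeasurableSet B) :
    factorialMoment ν particles m B ≠ ∞ ∧ (factorialMoment ν particles m B).toReal =
      ∑ l : Fin m → Fin n, levelMoment ν l (levelEmbedding l ⁻¹' B) := by
  have hf : ∀ f : Fin m ↪ PatternIndex n, (fun (y : Pattern n) k => particles y (f k)) =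
      levelEmbedding (fun k => (f k).1) ∘ readOff f := fun f => rfl
  have hm : ∀ f : Fin m ↪ PatternIndex n,
      Measurable fun (y : Pattern n) k => particles y (f k) := fun f => by
    rw [hf]
    exact (measurable_levelEmbedding _).comp (measurable_readOff _)
  have h1 : factorialMoment ν particles m B = ∑ f : Fin m ↪ PatternIndex n,
      ν ((fun (y : Pattern n) k => particles y (f k)) ⁻¹' B) := by
    have h2 : ∀ f : Fin m ↪ PatternIndex n, Measurable fun y : Pattern n =>
        B.indicator (fun _ => (1 : ℝ≥0∞)) fun k => particles y (f k) := fun f =>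
      (measurable_const.indicator hB).comp (hm f)
    rw [factorialMoment, lintegral_finsetSum _ fun f _ => h2 f]
    refine Finset.sum_congr rfl fun f _ => ?_
    rw [← lintegral_indicator_one (hm f hB)]
    rfl
  constructor
  · rw [h1]
    exact (ENNReal.sum_lt_top.2 fun f _ => measure_lt_top _ _).ne
  · rw [h1, ENNReal.toReal_sum fun f _ => measure_ne_top _ _]
    simp only [levelMoment]
    rw [Finset.sum_comm]
    refine Finset.sum_congr rfl fun f _ => ?_
    -- An injective labelling contributes to one choice of levels only.
    rw [Finset.sum_eq_single fun k => (f k).1]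
    · rw [if_pos fun k => rfl]
      rfl
    · intro l _ hl
      exact if_neg fun h => hl (funext fun k => (h k).symm)
    · exact fun h => absurd (Finset.mem_univ _) h

section

variable {V : ℝ → ℝ} {ψ : ℕ → ℝ[X]} {c : ℕ → ℝ} {N : ℕ}

theorem gtDensity_nonneg (y : Pattern (N + 1)) : 0 ≤ gtDensity V y := by
  refine Set.indicator_nonneg (fun y hy => ?_) y
  exact mul_nonneg (vandermonde_nonneg (hy.1 (Fin.last N)))
    (Finset.prod_nonneg fun _ _ => (Real.exp_pos _).le)

theorem measurable_gtDensity (hV : Continuous V) :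
    Measurable (gtDensity V : Pattern (N + 1) → ℝ) := by
  refine Measurable.indicator ?_ (measurableSet_gtPatterns _)
  have h1 : Continuous fun y : Fin (N + 1) → ℝ => ∏ i, Real.exp (-V (y i)) := by fun_prop
  exact ((measurable_vandermonde (N + 1)).comp measurable_top).mul (h1.measurable.comp measurable_top)

theorem patternMeasure_eq (V : ℝ → ℝ) (N : ℕ) : patternMeasure V (N + 1) N.succ_pos =
    (volume : Measure (Pattern (N + 1))).withDensity fun y => ENNReal.ofReal (gtDensity V y) := by
  have h : (fun y : Pattern (N + 1) => ENNReal.ofReal (gtDensity V y)) =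
      (gtPatterns (N + 1)).indicator fun y =>
        ENNReal.ofReal (vandermonde y.top * ∏ i, Real.exp (-V (y.top i))) := by
    funext y
    rw [gtDensity, Set.indicator, Set.indicator]
    split_ifs
    · rfl
    · exact ENNReal.ofReal_zero
  rw [h, withDensity_indicator (measurableSet_gtPatterns _)]
  rfl

theorem integrable_gtDensity (hV : Continuous V) {ν : Measure (Pattern (N + 1))}
    [IsProbabilityMeasure ν] {Z : ℝ} (hZ : 0 < Z)
    (hν : ν = ENNReal.ofReal Z⁻¹ • patternMeasure V (N + 1) N.succ_pos) :
    Integrable (gtDensity V : Pattern (N + 1) → ℝ) ∧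
      ∀ S, MeasurableSet S → Z * ν.real S = ∫ y in S, gtDensity V y := by
  rw [patternMeasure_eq] at hν
  have hS : ∀ S, MeasurableSet S →
      ν S = ENNReal.ofReal Z⁻¹ * ∫⁻ y in S, ENNReal.ofReal (gtDensity V y) := fun S hS => by
    rw [hν, Measure.smul_apply, withDensity_apply _ hS, smul_eq_mul]
  have hZ' : 0 < Z⁻¹ := inv_pos.2 hZ
  constructor
  · refine ⟨(measurable_gtDensity hV).aestronglyMeasurable,
      (hasFiniteIntegral_iff_ofReal (Filter.Eventually.of_forall gtDensity_nonneg)).2 ?_⟩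
    have h := hS Set.univ MeasurableSet.univ
    rw [measure_univ, Measure.restrict_univ] at h
    -- An infinite integral of the density would contradict total mass `1`, since `Z⁻¹` is positive.
    refine lt_of_le_of_ne le_top fun htop => ?_
    rw [htop, ENNReal.mul_top (by simpa using hZ')] at h
    exact ENNReal.one_ne_top h
  · intro S hSm
    rw [measureReal_def, hS S hSm, ENNReal.toReal_mul, ENNReal.toReal_ofReal hZ'.le, ← mul_assoc,
      mul_inv_cancel₀ hZ.ne', one_mul, integral_eq_lintegral_of_nonneg_ae
        (Filter.Eventually.of_forall gtDensity_nonneg)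
        (measurable_gtDensity hV).aestronglyMeasurable]

/-- A random pattern with the law of the eigenvalue minor process is determinantal. -/
theorem IsMonicOrthogonal.isDeterminantal (hψ : IsMonicOrthogonal V ψ c) (hV : Continuous V)
    {ν : Measure (Pattern (N + 1))} [IsProbabilityMeasure ν] {Z : ℝ} (hZ : 0 < Z)
    (hν : ν = ENNReal.ofReal Z⁻¹ • patternMeasure V (N + 1) N.succ_pos) :
    IsDeterminantal ν particles (refMeasure (N + 1)) fun z w =>
      (minorKernel V ψ c (N + 1) (N + 1 - (z.1 + 1)) (N + 1 - (w.1 + 1)) z.2 w.2 : ℂ) := by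
  obtain ⟨hi, hνS⟩ := integrable_gtDensity hV hZ hν
  intro m hm
  have key := fun l : Fin m → Fin (N + 1) => hψ.levelMoment_eq hV hi hνS l hm
  set ρ : (Fin m → Fin (N + 1) × ℝ) → ℝ := fun z =>
    (corrMatrix V ψ c (fun k => (z k).1) fun k => (z k).2).det with hρ
  have hi1 : ∀ l ∈ (Finset.univ : Finset (Fin m → Fin (N + 1))),
      Integrable ρ ((volume : Measure (Fin m → ℝ)).map (levelEmbedding l)) := fun l _ => by
    rw [(measurableEmbedding_levelEmbedding l).integrable_map_iff]
    exact (key l).1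
  have hint : Integrable ρ (Measure.pi fun _ : Fin m => refMeasure (N + 1)) := by
    rw [pi_refMeasure]
    exact integrable_finsetSum_measure.2 hi1
  refine ⟨ρ, ⟨hint, fun B hB => ?_⟩, fun y => ?_⟩
  · obtain ⟨h1, h2⟩ := factorialMoment_particles ν hB
    refine ⟨h1, h2.trans ?_⟩
    rw [← integral_indicator hB, pi_refMeasure, integral_finsetSum_measure fun l hl =>
      (hi1 l hl).indicator hB]
    refine Finset.sum_congr rfl fun l _ => ?_
    have hl := measurable_levelEmbedding l hB
    rw [(measurableEmbedding_levelEmbedding l).integral_map, (key l).2 _ hl, ← integral_indicator hl]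
    rfl
  · exact Complex.ofRealHom.map_det _

end

end

end UIE

end

/-- The eigenvalue minor process of a unitary invariant ensemble with potential `V` has
distribution `ν_n = Z⁻¹ Δ_n(y⁽ⁿ⁾) ∏ e^{-V(y⁽ⁿ⁾_i)} dy⁽ⁿ⁾ ⋯ dy⁽¹⁾` on the Gelfand-Tsetlin patterns,
and is a determinantal random point field with the given kernel. -/
theorem mainTheorem4 {Ω : Type*} [MeasurableSpace Ω] (P : Measure Ω) [IsProbabilityMeasure P]
    (n : ℕ) (hn : 0 < n) (V : ℝ → ℝ) (hV : Continuous V)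
    (A : Ω → Matrix (Fin n) (Fin n) ℂ) (hA : UIE.IsUnitaryInvariantEnsemble P V A)
    (ψ : ℕ → ℝ[X]) (c : ℕ → ℝ) (hψ : UIE.IsMonicOrthogonal V ψ c) :
    (∃ Z : ℝ, 0 < Z ∧ P.map (fun ω => UIE.minorEigenvalues (hA.hermitian ω)) =
      ENNReal.ofReal Z⁻¹ • UIE.patternMeasure V n hn) ∧
    ∃ K : Fin n × ℝ → Fin n × ℝ → ℂ,
      UIE.IsDeterminantal (P.map fun ω => UIE.minorEigenvalues (hA.hermitian ω))
        UIE.particles (UIE.refMeasure n) K ∧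
      ∀ (r s : Fin n) (u v : ℝ), (r : ℕ) + 1 < n →
        K (r, u) (s, v) = (UIE.kernel V ψ c n ((r : ℕ) + 1) ((s : ℕ) + 1) u v : ℂ) := by
  obtain ⟨Z, hZ, hν⟩ := hA.exists_map_minorEigenvalues_eq hn hV
  refine ⟨⟨Z, hZ, hν⟩, ?_⟩
  obtain ⟨N, rfl⟩ : ∃ N, n = N + 1 := ⟨n - 1, by omega⟩
  have hP : IsProbabilityMeasure (P.map fun ω => UIE.minorEigenvalues (hA.hermitian ω)) :=
    Measure.isProbabilityMeasure_map hA.measurable_minors.aemeasurable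
  -- The kernel is also defined on the top level, where `ψ_j e^{-V}` itself replaces the integrals;
  -- `hr` restricts the explicit formula to the levels below.
  refine ⟨_, hψ.isDeterminantal hV hZ hν, fun r s u v hr => ?_⟩
  exact congrArg _ (hψ.minorKernel_eq_kernel hr u v)
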